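/- There is a deterministic algorithm that, given a finite simple undirected graph $G$ with $n$ vertices, minimum degree at least $2$ and maximum degree at most $4$ (not necessarily connected), together with an integer $k$, decides whether $G$ has a vertex cover of size at most $k$, that is, whether there is a set $S$ of at most $k$ vertices such that every edge of $G$ is incident on at least one vertex of $S$. With the parameter $r = k - n/3$, its running time is $O^*(1.6253^{r})$ when $r \ge 0$ and polynomial when $r < 0$; that is, there is one polynomial $p$ such that on every such instance $(G,k)$ the algorithm halts after at most $$p(n + \ell(k)) \cdot 1.6253^{\max(r,0)}$$ steps, where $\ell(k)$ is the number of binary digits of $|k|$ (with $\ell(0) = 0$). Here an algorithm is a fixed program in a first-order recursive functional language over binary trees, in which each elementary operation (looking up a local variable, creating the empty tree, pairing two trees, taking a component of a pair, testing for the empty tree, binding a local variable, calling a function) counts as one step; the graph is given by its adjacency matrix and $k$ by its sign and its binary digits. -/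

import Mathlib

/-! ### Computation model

A deterministic first-order functional language ("pure LISP" over binary trees) in which every
elementary operation costs one step. A program is one fixed finite list of function bodies that
may call each other recursively. On a random access machine or a pointer machine a tree is a
pointer to a pair of pointers, so every step below (pairing, taking a component, testing for the
empty tree, looking up one of the boundedly many local variables, entering a function) takes
a constant number of machine operations. There is no arithmetic, equality test or copying of
trees at unit cost. -/

namespace TreeLang

/-- Values: binary trees with unlabelled leaves. -/
inductive Data : Type
  | nil : Data
  | cons : Data → Data → Data

/-- Expressions. Local variables are de Bruijn indices into an environment; functions are
numbered and take one argument. -/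
inductive Term : Type
  | var : ℕ → Term
  | nil : Term
  | cons : Term → Term → Term
  | head : Term → Term
  | tail : Term → Term
  | ite : Term → Term → Term → Term
  | letIn : Term → Term → Term
  | call : ℕ → Term → Term

/-- A program is the finite list of the bodies of its functions; in a body the variable `0` is the
argument. Function number `0` is the main function. -/
abbrev Program : Type := List Term

/-- The head of a tree; the head of the empty tree is the empty tree. -/
def Data.head : Data → Data
  | .nil => .nil
  | .cons a _ => a

/-- The tail of a tree; the tail of the empty tree is the empty tree. -/
def Data.tail : Data → Data
  | .nil => .nil
  | .cons _ b => b

/-- `Eval P env e v t`: in the program `P`, with the values `env` of the local variables, the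
evaluation of `e` terminates with value `v` after exactly `t` steps. In `ite c a b` the empty tree
counts as false and every other tree as true, and only the selected branch is evaluated. A variable
or a function number that does not exist has no evaluation. -/
inductive Eval (P : Program) : List Data → Term → Data → ℕ → Prop
  | var {env : List Data} {i : ℕ} {v : Data} (h : env[i]? = some v) :
      Eval P env (.var i) v 1
  | nil {env : List Data} : Eval P env .nil .nil 1
  | cons {env : List Data} {a b : Term} {u v : Data} {s t : ℕ}
      (ha : Eval P env a u s) (hb : Eval P env b v t) :
      Eval P env (.cons a b) (.cons u v) (s + t + 1)
  | head {env : List Data} {a : Term} {u : Data} {s : ℕ} (ha : Eval P env a u s) :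
      Eval P env (.head a) u.head (s + 1)
  | tail {env : List Data} {a : Term} {u : Data} {s : ℕ} (ha : Eval P env a u s) :
      Eval P env (.tail a) u.tail (s + 1)
  | iteTrue {env : List Data} {c a b : Term} {x y u : Data} {s t : ℕ}
      (hc : Eval P env c (.cons x y) s) (ha : Eval P env a u t) :
      Eval P env (.ite c a b) u (s + t + 1)
  | iteFalse {env : List Data} {c a b : Term} {u : Data} {s t : ℕ}
      (hc : Eval P env c .nil s) (hb : Eval P env b u t) :
      Eval P env (.ite c a b) u (s + t + 1)
  | letIn {env : List Data} {a b : Term} {u v : Data} {s t : ℕ}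
      (ha : Eval P env a u s) (hb : Eval P (u :: env) b v t) :
      Eval P env (.letIn a b) v (s + t + 1)
  | call {env : List Data} {f : ℕ} {a body : Term} {u v : Data} {s t : ℕ}
      (ha : Eval P env a u s) (hf : P[f]? = some body) (hb : Eval P [u] body v t) :
      Eval P env (.call f a) v (s + t + 1)

/-- Evaluation is deterministic, in its value and in its number of steps. -/
theorem Eval.deterministic {P : Program} {env : List Data} {e : Term} {v w : Data} {s t : ℕ}
    (h₁ : Eval P env e v s) (h₂ : Eval P env e w t) : v = w ∧ s = t := by
  induction h₁ generalizing w t <;> cases h₂ <;> grind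

/-- `P.Run x y t`: started on the input `x`, the program `P` halts with output `y` after exactly
`t` steps. -/
def Program.Run (P : Program) (x y : Data) (t : ℕ) : Prop :=
  ∃ main : Term, P[0]? = some main ∧ Eval P [x] main y t

/-! ### Encoding of instances -/

/-- `false` is the empty tree, `true` is the tree with one inner node. -/
def Data.ofBool : Bool → Data
  | false => .nil
  | true => .cons .nil .nil

/-- A list is encoded as a right comb. -/
def Data.ofList : List Data → Data
  | [] => .nil
  | a :: l => .cons a (Data.ofList l)

/-- An integer: its sign (`true` for negative) and the binary digits of its absolute value, least
significant digit first. -/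
def Data.ofInt (k : ℤ) : Data :=
  .cons (Data.ofBool (decide (k < 0))) (Data.ofList (k.natAbs.bits.map Data.ofBool))

/-- The adjacency matrix of a graph, as the list of its rows. -/
def Data.ofGraph {n : ℕ} (G : SimpleGraph (Fin n)) [DecidableRel G.Adj] : Data :=
  Data.ofList ((List.finRange n).map fun u =>
    Data.ofList ((List.finRange n).map fun v => Data.ofBool (decide (G.Adj u v))))

/-- The instance `(G, k)` of the vertex cover problem, as an input of a program. -/
def Data.ofInstance {n : ℕ} (G : SimpleGraph (Fin n)) [DecidableRel G.Adj] (k : ℤ) : Data :=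
  .cons (Data.ofGraph G) (Data.ofInt k)

end TreeLang

/-- `G` has a vertex cover of size at most `k`. -/
def HasVertexCoverOfSizeAtMost {V : Type*} (G : SimpleGraph V) (k : ℤ) : Prop :=
  ∃ S : Finset V, G.IsVertexCover (S : Set V) ∧ (S.card : ℤ) ≤ k

/-! Call |N(I)| − |I| the surplus of an independent set I. A state has a vertex set V and a
remaining budget b for the cover; its measure is ψ = 3b − |V|, which is three times the parameter r.
It suffices to build a search tree with O(y^ψ) leaves, where y³ = 1.6253, and polynomial work per
node.

Reductions (`red`, `norm`) raise the minimum surplus to 2. An independent set of maximum deficiency,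
or one of surplus 0, is deleted with its neighbours, which go into the cover. A set J of surplus 1
is deleted in the same way if N(J) contains an edge, and otherwise J ∪ N(J) is folded to one vertex
(`sol_fold_iff`). Such sets are found by bipartite matching in the double cover of the graph
(`isCrit_crit`), also when they have to contain prescribed vertices (`IsCrit.extend`). The
accounting is `norm_spec`: reduction raises ψ by at most d if all surpluses are at least −d, and
lowers it if the minimum surplus is 0 or 1. The degree bounds 2 and 4 enter only at the root:
counting edges gives |I| ≤ 2|N(I)| (`card_le_two_mul_nb`), so the first reduction does not raise ψ.

With nonnegative surplus every cover has at least |V|/2 vertices (`Good.card_le`). A reduced state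
with |V| > 2b is therefore rejected, and every other reduced state has ψ ≥ 0.

Branching (`branch_spec`) looks first for an independent set with at least two vertices and surplus
2; this lowers ψ by 6 and 4. If there is none, deleting a vertex of degree d ≥ 4 with its neighbours
gains d + 3, since the larger surplus limits what reduction can give back. This yields (8,2) for
degree at least 5 and (7,3) for degree 4 next to degree 3. Otherwise no edge joins degree 3 to
degree 4: cubic parts give (6,3), or (5,5) for a K₄, and a 4-regular graph gives only (7,2). In that
last case the graph without the chosen vertex is still reduced, and its own branching is one of
(6,4), (7,3), (5,5) (`branch_of_regular`), so two levels together give three children. The worst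
recurrence, (7,9,5), determines the base (`branchFactors`, `leaves_le`).

For the running time, `FP` is a class of functions computed by relocatable program fragments in
polynomial time, closed under the usual list operations. One step of the search lies in it, and
states never outgrow bounds fixed at the root (`Small`), so the total time is the number of leaves
times a polynomial (`eval_searchBody`). -/

namespace TreeLang

/-! ### Encodings as trees and their sizes -/

/-- Number of nodes of a tree. -/
def Data.size : Data → ℕ
  | .nil => 1
  | .cons a b => a.size + b.size + 1

/-- Types whose elements are represented by trees. -/
class Enc (α : Type) where
  enc : α → Data

open Enc (enc)

instance : Enc Bool := ⟨Data.ofBool⟩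

/-- Unary representation of natural numbers. -/
def natData : ℕ → Data
  | 0 => .nil
  | n + 1 => .cons .nil (natData n)

instance : Enc ℕ := ⟨natData⟩

instance {α : Type} [Enc α] : Enc (List α) := ⟨fun l => Data.ofList (l.map enc)⟩

instance {α β : Type} [Enc α] [Enc β] : Enc (α × β) := ⟨fun x => .cons (enc x.1) (enc x.2)⟩

instance {α : Type} [Enc α] : Enc (Option α) := ⟨fun x => x.elim .nil fun a => .cons (enc a) .nil⟩

/-- Size of the representation. -/
def esize {α : Type} [Enc α] (x : α) : ℕ := (enc x).size

theorem Data.size_pos (d : Data) : 0 < d.size := by cases d <;> simp [Data.size]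

section
variable {α β γ σ : Type} [Enc α] [Enc β] [Enc γ] [Enc σ]

@[simp] theorem enc_nil : enc ([] : List α) = .nil := rfl
@[simp] theorem enc_cons (a : α) (l : List α) : enc (a :: l) = .cons (enc a) (enc l) := rfl
@[simp] theorem enc_mk (a : α) (b : β) : enc (a, b) = .cons (enc a) (enc b) := rfl
@[simp] theorem enc_none : enc (none : Option α) = .nil := rfl
@[simp] theorem enc_some (a : α) : enc (some a) = .cons (enc a) .nil := rfl
@[simp] theorem enc_zero : enc (0 : ℕ) = .nil := rfl
@[simp] theorem enc_succ (n : ℕ) : enc (n + 1) = .cons .nil (enc n) := rfl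
@[simp] theorem enc_true : enc true = .cons .nil .nil := rfl
@[simp] theorem enc_false : enc false = .nil := rfl

theorem esize_pos (a : α) : 0 < esize a := Data.size_pos _
@[simp] theorem esize_nil : esize ([] : List α) = 1 := rfl
@[simp] theorem esize_cons (a : α) (l : List α) : esize (a :: l) = esize a + esize l + 1 := rfl
@[simp] theorem esize_mk (a : α) (b : β) : esize (a, b) = esize a + esize b + 1 := rfl
theorem esize_prod (x : α × β) : esize x = esize x.1 + esize x.2 + 1 := rfl
@[simp] theorem esize_none : esize (none : Option α) = 1 := rfl
@[simp] theorem esize_some (a : α) : esize (some a) = esize a + 2 := rfl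
@[simp] theorem esize_nat (n : ℕ) : esize n = 2 * n + 1 := by
  induction n with
  | zero => rfl
  | succ n ih => rw [esize, enc_succ, Data.size, Data.size]; rw [esize] at ih; omega
theorem esize_bool (b : Bool) : esize b ≤ 3 := by cases b <;> decide

theorem poly_mono (p : Polynomial ℕ) {m n : ℕ} (h : m ≤ n) : p.eval m ≤ p.eval n := by
  rw [Polynomial.eval_eq_sum_range, Polynomial.eval_eq_sum_range]
  exact Finset.sum_le_sum fun i _ => Nat.mul_le_mul_left _ (Nat.pow_le_pow_left h i)

/-! ### Relocatable program fragments and polynomial-time functions -/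

/-- The fragment `w` of function bodies stands at position `o` of the program `P`. -/
def Linked (P : Program) (o : ℕ) (w : List Term) : Prop :=
  ∀ i, i < w.length → P[o + i]? = w[i]?

theorem Linked.head {P : Program} {o : ℕ} {b : Term} {w : List Term} (h : Linked P o (b :: w)) :
    P[o]? = some b := by
  simpa using h 0 (by simp)

theorem Linked.tail {P : Program} {o : ℕ} {b : Term} {w : List Term} (h : Linked P o (b :: w)) :
    Linked P (o + 1) w := by
  intro i hi
  have := h (i + 1) (by simpa using hi)
  simpa [Nat.add_assoc, Nat.add_comm 1] using this

theorem Linked.left {P : Program} {o : ℕ} {b w : List Term} (h : Linked P o (b ++ w)) :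
    Linked P o b := by
  intro i hi
  rw [h i (by simp; omega), List.getElem?_append_left hi]

theorem Linked.right {P : Program} {o : ℕ} {b w : List Term} (h : Linked P o (b ++ w)) :
    Linked P (o + b.length) w := by
  intro i hi
  rw [Nat.add_assoc, h (b.length + i) (by simp; omega),
    List.getElem?_append_right (by omega), Nat.add_sub_cancel_left]

/-- Function number `o` of the program `P` computes `f`, in time and output size bounded by the
polynomial `p`. -/
def Impl (P : Program) (o : ℕ) (f : α → β) (p : Polynomial ℕ) : Prop :=
  ∀ x, ∃ body t, P[o]? = some body ∧ Eval P [enc x] body (enc (f x)) t ∧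
    t ≤ p.eval (esize x) ∧ esize (f x) ≤ p.eval (esize x)

/-- The function `f` is computed in polynomial time by a relocatable program fragment. -/
def FP (f : α → β) : Prop :=
  ∃ (m : ℕ) (code : ℕ → List Term) (p : Polynomial ℕ), ∀ o, (code o).length = m ∧
    ∀ P, Linked P o (code o) → Impl P o f p

theorem Impl.call {P : Program} {o : ℕ} {f : α → β} {p : Polynomial ℕ} (h : Impl P o f p)
    {env : List Data} {a : Term} {x : α} {s : ℕ} (ha : Eval P env a (enc x) s) :
    ∃ t, Eval P env (.call o a) (enc (f x)) t ∧ t ≤ s + p.eval (esize x) + 1 := by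
  obtain ⟨body, t, hb, he, ht, -⟩ := h x
  exact ⟨_, .call ha hb he, by omega⟩

theorem Eval.arg {P : Program} {x : α} : Eval P [enc x] (.var 0) (enc x) 1 := .var rfl

theorem FP.of_term {f : α → β} (body : Term) (c : ℕ)
    (h : ∀ P x, ∃ t ≤ c, Eval P [enc x] body (enc (f x)) t)
    (hs : ∀ x, esize (f x) ≤ esize x + c) : FP f := by
  refine ⟨1, fun _ => [body], .X + .C c, fun o => ⟨rfl, fun P hP x => ?_⟩⟩
  obtain ⟨t, ht, he⟩ := h P x
  refine ⟨body, t, hP.head, he, ?_, ?_⟩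
  · simp; omega
  · simpa using hs x

theorem FP.id : FP (fun x : α => x) :=
  .of_term (.var 0) 1 (fun _ _ => ⟨1, le_rfl, .var rfl⟩) fun _ => by simp

theorem FP.fst : FP (fun x : α × β => x.1) :=
  .of_term (.head (.var 0)) 2 (fun _ x => ⟨2, le_rfl, .head (.arg (x := x))⟩) fun x => by
    rw [esize_prod]; omega

theorem FP.snd : FP (fun x : α × β => x.2) :=
  .of_term (.tail (.var 0)) 2 (fun _ x => ⟨2, le_rfl, .tail (.arg (x := x))⟩) fun x => by
    rw [esize_prod]; omega

/-- A closed expression for a given tree. -/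
def Data.quote : Data → Term
  | .nil => .nil
  | .cons a b => .cons a.quote b.quote

theorem Data.eval_quote (P : Program) (env : List Data) (d : Data) :
    ∃ t ≤ d.size, Eval P env d.quote d t := by
  induction d with
  | nil => exact ⟨1, le_rfl, .nil⟩
  | cons a b iha ihb =>
    obtain ⟨s, hs, ha⟩ := iha
    obtain ⟨t, ht, hb⟩ := ihb
    exact ⟨_, by simp only [Data.size]; omega, .cons ha hb⟩

theorem FP.const (b : β) : FP (fun _ : α => b) :=
  .of_term (enc b).quote (esize b) (fun P _ => Data.eval_quote P _ _) fun _ => by omega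

theorem FP.comp {g : β → γ} {f : α → β} (hg : FP g) (hf : FP f) : FP (fun x => g (f x)) := by
  obtain ⟨mg, cg, pg, hg⟩ := hg
  obtain ⟨mf, cf, pf, hf⟩ := hf
  -- The driver comes first and the two fragments follow it. The second one runs on `f x`, whose
  -- size is at most `pf`, hence the composed polynomial.
  refine ⟨mf + mg + 1, fun o => .call (o + 1 + mf) (.call (o + 1) (.var 0)) ::
    (cf (o + 1) ++ cg (o + 1 + mf)), pf + pg.comp pf + 3,
    fun o => ⟨by simp [hf, hg], fun P hP x => ?_⟩⟩
  have h1 := (hf (o + 1)).2 P hP.tail.left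
  have h2 := (hg (o + 1 + mf)).2 P (by simpa [(hf (o + 1)).1] using hP.tail.right)
  obtain ⟨s, hs, hsb⟩ := h1.call (.arg (x := x))
  obtain ⟨t, ht, htb⟩ := h2.call hs
  obtain ⟨-, -, -, -, -, h3⟩ := h1 x
  obtain ⟨-, -, -, -, -, h4⟩ := h2 (f x)
  have h5 := poly_mono pg h3
  refine ⟨_, t, hP.head, ht, ?_, ?_⟩ <;>
  · simp only [Polynomial.eval_add, Polynomial.eval_comp, Polynomial.eval_ofNat]; omega

theorem FP.pair {f : α → β} {g : α → γ} (hf : FP f) (hg : FP g) :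
    FP (fun x => (f x, g x)) := by
  obtain ⟨mg, cg, pg, hg⟩ := hg
  obtain ⟨mf, cf, pf, hf⟩ := hf
  refine ⟨mf + mg + 1, fun o => .cons (.call (o + 1) (.var 0)) (.call (o + 1 + mf) (.var 0)) ::
    (cf (o + 1) ++ cg (o + 1 + mf)), pf + pg + 5,
    fun o => ⟨by simp [hf, hg], fun P hP x => ?_⟩⟩
  have h1 := (hf (o + 1)).2 P hP.tail.left
  have h2 := (hg (o + 1 + mf)).2 P (by simpa [(hf (o + 1)).1] using hP.tail.right)
  obtain ⟨s, hs, hsb⟩ := h1.call (.arg (x := x))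
  obtain ⟨t, ht, htb⟩ := h2.call (.arg (x := x))
  obtain ⟨-, -, -, -, -, h3⟩ := h1 x
  obtain ⟨-, -, -, -, -, h4⟩ := h2 x
  refine ⟨_, _, hP.head, .cons hs ht, ?_, ?_⟩ <;>
  · simp only [Polynomial.eval_add, Polynomial.eval_ofNat, esize_mk]; omega

theorem FP.sel : FP (fun x : Bool × β × β => if x.1 then x.2.1 else x.2.2) := by
  refine .of_term (.ite (.head (.var 0)) (.head (.tail (.var 0))) (.tail (.tail (.var 0)))) 6
    (fun P x => ?_) fun x => ?_
  · obtain ⟨b, y, z⟩ := x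
    cases b
    · exact ⟨_, le_rfl, .iteFalse (.head (.arg (x := (false, y, z)))) (.tail (.tail (.arg (x := (false, y, z)))))⟩
    · exact ⟨_, le_rfl, .iteTrue (x := .nil) (y := .nil) (.head (.arg (x := (true, y, z))))
        (.head (.tail (.arg (x := (true, y, z)))))⟩
  · obtain ⟨b, y, z⟩ := x
    cases b <;> simp only [esize_mk] <;> simp <;> omega

theorem FP.ite {c : α → Bool} {f g : α → β} (hc : FP c) (hf : FP f) (hg : FP g) :
    FP (fun x => if c x then f x else g x) :=
  FP.sel.comp (hc.pair (hf.pair hg))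

/-- Folding over a list is polynomial if the accumulators have polynomial size. -/
theorem FP.foldr {l : α → List β} {i : α → σ} {s : α → β → σ → σ} (hl : FP l) (hi : FP i)
    (hs : FP fun z : α × β × σ => s z.1 z.2.1 z.2.2) (q : Polynomial ℕ)
    (hq : ∀ x l', l' <:+ l x → esize (l'.foldr (s x) (i x)) ≤ q.eval (esize x)) :
    FP (fun x => (l x).foldr (s x) (i x)) := by
  obtain ⟨mg, cg, pg, hg⟩ := hl.pair hi
  obtain ⟨ms, cs, ps, hs⟩ := hs
  -- the loop has the argument `(x, l', i)`
  let loop : ℕ → Term := fun o =>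
    .ite (.head (.tail (.var 0)))
      (.call (o + 2 + mg) (.cons (.head (.var 0)) (.cons (.head (.head (.tail (.var 0))))
        (.call (o + 1) (.cons (.head (.var 0)) (.cons (.tail (.head (.tail (.var 0))))
          (.tail (.tail (.var 0)))))))))
      (.tail (.tail (.var 0)))
  -- Cost per list element: the step function applied to `x`, an element (bounded by `pg`) and an
  -- accumulator (bounded by `q`), plus bookkeeping.
  let B : Polynomial ℕ := ps.comp (.X + pg + q + 2) + 40
  refine ⟨mg + ms + 2, fun o => .call (o + 1) (.cons (.var 0) (.call (o + 2) (.var 0))) ::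
    loop o :: (cg (o + 2) ++ cs (o + 2 + mg)), pg + (pg + 1) * B + 40 + q,
    fun o => ⟨by simp [hg, hs], fun P hP x => ?_⟩⟩
  have h1 := (hg (o + 2)).2 P hP.tail.tail.left
  have h2 := (hs (o + 2 + mg)).2 P (by simpa [(hg (o + 2)).1] using hP.tail.tail.right)
  obtain ⟨-, -, -, -, -, h3⟩ := h1 x
  rw [esize_mk] at h3
  have key : ∀ l', l' <:+ l x → ∃ t, Eval P [enc (x, (l', i x))] (loop o)
      (enc (l'.foldr (s x) (i x))) t ∧ t ≤ (esize l') * B.eval (esize x) + 30 := by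
    intro l'
    induction l' with
    | nil =>
      intro _
      have e0 : Eval P [enc (x, (([] : List β), i x))] (.var 0) (enc (x, (([] : List β), i x))) 1 :=
        .arg
      exact ⟨_, .iteFalse (.head (.tail e0)) (.tail (.tail e0)), by omega⟩
    | cons b l' ih =>
      intro hsuf
      have hsuf' : l' <:+ l x := (List.suffix_cons b l').trans hsuf
      obtain ⟨t, ht, htb⟩ := ih hsuf'
      have e0 : Eval P [enc (x, (b :: l', i x))] (.var 0) (enc (x, (b :: l', i x))) 1 := .var rfl
      have e1 : Eval P [enc (x, (b :: l', i x))] (.call (o + 1) (.cons (.head (.var 0))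
          (.cons (.tail (.head (.tail (.var 0)))) (.tail (.tail (.var 0))))))
          (enc (l'.foldr (s x) (i x))) _ :=
        .call (.cons (.head e0) (.cons (.tail (.head (.tail e0))) (.tail (.tail e0))))
          hP.tail.head ht
      have e2 : Eval P [enc (x, (b :: l', i x))] (.cons (.head (.var 0))
          (.cons (.head (.head (.tail (.var 0)))) (.call (o + 1) (.cons (.head (.var 0))
          (.cons (.tail (.head (.tail (.var 0)))) (.tail (.tail (.var 0))))))))
          (enc (x, b, l'.foldr (s x) (i x))) _ :=
        .cons (.head e0) (.cons (.head (.head (.tail e0))) e1)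
      obtain ⟨t', ht', htb'⟩ := h2.call e2
      refine ⟨_, .iteTrue (x := enc b) (y := enc l') (.head (.tail e0)) ht', ?_⟩
      have hb : esize b ≤ esize (l x) := by
        obtain ⟨l0, hl0⟩ := hsuf
        rw [← hl0]
        clear hl0
        induction l0 with
        | nil => simp; omega
        | cons c l0 ih => simp only [List.cons_append, esize_cons]; omega
      have hsz : esize (x, b, l'.foldr (s x) (i x)) ≤ (.X + pg + q + 2 : Polynomial ℕ).eval (esize x) := by
        have := hq x l' hsuf'
        simp only [esize_mk, Polynomial.eval_add, Polynomial.eval_X, Polynomial.eval_ofNat]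
        omega
      have hm := poly_mono ps hsz
      have hB : B.eval (esize x) = ps.eval ((.X + pg + q + 2 : Polynomial ℕ).eval (esize x)) + 40 := by
        simp [B, Polynomial.eval_comp]
      have : (esize l' + 1) * B.eval (esize x) ≤ esize (b :: l') * B.eval (esize x) :=
        Nat.mul_le_mul_right _ (by simp)
      rw [Nat.add_mul] at this
      omega
  obtain ⟨t, ht, htb⟩ := key (l x) (List.suffix_refl _)
  obtain ⟨s', hs', hsb'⟩ := h1.call (.arg (x := x))
  refine ⟨_, _, hP.head, .call (.cons .arg hs') hP.tail.head ht, ?_, ?_⟩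
  · have : esize (l x) * B.eval (esize x) ≤ (pg.eval (esize x) + 1) * B.eval (esize x) :=
      Nat.mul_le_mul_right _ (by omega)
    simp only [Polynomial.eval_add, Polynomial.eval_mul, Polynomial.eval_one, Polynomial.eval_ofNat]
    omega
  · have := hq x (l x) (List.suffix_refl _)
    simp only [Polynomial.eval_add, Polynomial.eval_mul, Polynomial.eval_one, Polynomial.eval_ofNat]
    omega

end

/-! ### Polynomial-time operations on Booleans, options and lists -/

open Enc (enc)

instance : Enc Unit := ⟨fun _ => .nil⟩

section
variable {α β γ σ : Type} [Enc α] [Enc β] [Enc γ] [Enc σ]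

theorem FP.congr {f g : α → β} (hf : FP f) (h : ∀ x, f x = g x) : FP g := by
  rwa [← funext h]

theorem FP.size {f : α → β} (hf : FP f) :
    ∃ p : Polynomial ℕ, ∀ x, esize (f x) ≤ p.eval (esize x) := by
  obtain ⟨m, code, p, h⟩ := hf
  refine ⟨p, fun x => ?_⟩
  -- The fragment placed at position 0 is itself a program in which it is linked.
  obtain ⟨-, -, -, -, -, h⟩ := (h 0).2 (code 0) (fun i _ => by simp) x
  exact h

/-- A change of type that does not change the representation. -/
theorem FP.retype {f : α → β} (h : ∀ x, enc (f x) = enc x) : FP f :=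
  .of_term (.var 0) 1 (fun _ x => ⟨1, le_rfl, by rw [h x]; exact .arg⟩) fun x => by
    rw [esize, h x]; exact Nat.le_succ _

theorem esize_le_of_mem {b : β} {l : List β} (h : b ∈ l) : esize b + 1 < esize l := by
  induction l with
  | nil => simp at h
  | cons c l ih =>
    have := esize_pos l
    have := esize_pos c
    rcases List.mem_cons.1 h with rfl | h
    · simp; omega
    · have := ih h
      simp; omega

theorem length_lt_esize (l : List β) : 2 * l.length < esize l := by
  induction l with
  | nil => simp
  | cons b l ih => have := esize_pos b; simp; omega

theorem esize_list_le {l : List β} {c : ℕ} (h : ∀ b ∈ l, esize b ≤ c) :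
    esize l ≤ l.length * (c + 1) + 1 := by
  induction l with
  | nil => simp
  | cons b l ih =>
    have h1 := ih fun b hb => h b (List.mem_cons_of_mem _ hb)
    have h2 := h b List.mem_cons_self
    simp only [esize_cons, List.length_cons, Nat.add_mul]
    omega

theorem esize_append (l m : List β) : esize (l ++ m) + 1 = esize l + esize m := by
  induction l with
  | nil => simp; omega
  | cons b l ih => simp only [List.cons_append, esize_cons]; omega

theorem esize_sublist {l m : List β} (h : l.Sublist m) : esize l ≤ esize m := by
  induction h with
  | slnil => simp
  | cons b _ ih => simp only [esize_cons]; omega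
  | cons_cons b _ ih => simp only [esize_cons]; omega

theorem FP.cons {f : α → β} {l : α → List β} (hf : FP f) (hl : FP l) :
    FP (fun x => f x :: l x) :=
  FP.comp (g := fun z : β × List β => z.1 :: z.2) (.retype fun _ => rfl) (hf.pair hl)

/-- A conditional only distinguishes the empty tree from all others. This one test serves for
nonempty lists, present options and positive numbers. -/
theorem FP.test {f : α → Bool} (h : ∀ x, f x = true ↔ enc x ≠ .nil) : FP f := by
  refine .of_term (.ite (.var 0) (.cons .nil .nil) .nil) 5 (fun P x => ?_)
    fun x => (esize_bool _).trans (by omega)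
  cases hx : enc x with
  | nil =>
    have : f x = false := by simpa [hx] using h x
    rw [this]
    refine ⟨_, ?_, .iteFalse (.var rfl) .nil⟩
    omega
  | cons a b =>
    have : f x = true := by simpa [hx] using h x
    rw [this]
    refine ⟨_, ?_, .iteTrue (x := a) (y := b) (.var rfl) (.cons .nil .nil)⟩
    omega

theorem FP.isEmpty_not {l : α → List β} (hl : FP l) : FP (fun x => !(l x).isEmpty) :=
  FP.comp (g := fun l : List β => !l.isEmpty) (.test fun l => by cases l <;> simp) hl

theorem FP.isSome {o : α → Option β} (ho : FP o) : FP (fun x => (o x).isSome) :=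
  FP.comp (g := fun o : Option β => o.isSome) (.test fun l => by cases l <;> simp) ho

theorem FP.not {c : α → Bool} (hc : FP c) : FP (fun x => !c x) :=
  (hc.ite (.const false) (.const true)).congr fun x => by cases c x <;> rfl

theorem FP.and {c d : α → Bool} (hc : FP c) (hd : FP d) : FP (fun x => c x && d x) :=
  (hc.ite hd (.const false)).congr fun x => by cases c x <;> rfl

theorem FP.or {c d : α → Bool} (hc : FP c) (hd : FP d) : FP (fun x => c x || d x) :=
  (hc.ite (.const true) hd).congr fun x => by cases c x <;> rfl

theorem FP.isEmpty {l : α → List β} (hl : FP l) : FP (fun x => (l x).isEmpty) :=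
  hl.isEmpty_not.not.congr fun x => by simp

theorem FP.optionSome {f : α → β} (hf : FP f) : FP (fun x => some (f x)) :=
  (FP.comp (g := fun l : β × List β => some l.1)
    (f := fun x => (f x, ([] : List β)))
    (.of_term (.cons (.head (.var 0)) .nil) 4 (fun P x => ⟨_, le_rfl, .cons (.head (.arg (x := x))) .nil⟩)
      fun x => by
        have := esize_pos x.2
        rw [esize_prod, esize_some]; omega) (hf.pair (.const [])))

theorem FP.head? {l : α → List β} (hl : FP l) : FP (fun x => (l x).head?) := by
  refine FP.comp (g := fun l : List β => l.head?) ?_ hl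
  refine .of_term (.ite (.var 0) (.cons (.head (.var 0)) .nil) .nil) 6 (fun P x => ?_) fun x => ?_
  · cases x with
    | nil =>
      refine ⟨_, ?_, .iteFalse (.arg (x := ([] : List β))) .nil⟩
      omega
    | cons b l =>
      have e : Eval P [enc (b :: l)] (.var 0) (enc (b :: l)) 1 := .arg
      exact ⟨_, le_rfl, .iteTrue e (.cons (.head e) .nil)⟩
  · cases x with
    | nil => simp
    | cons b l => simp; omega

theorem FP.tail {l : α → List β} (hl : FP l) : FP (fun x => (l x).tail) := by
  refine FP.comp (g := fun l : List β => l.tail) ?_ hl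
  refine .of_term (.tail (.var 0)) 2 (fun P x => ⟨_, le_rfl, ?_⟩) fun x => ?_
  · cases x with
    | nil => exact .tail (.arg (x := ([] : List β)))
    | cons b l => exact .tail (.arg (x := b :: l))
  · cases x with
    | nil => simp
    | cons b l => simp; omega

theorem FP.toList {o : α → Option β} (ho : FP o) : FP (fun x => (o x).toList) :=
  FP.comp (g := fun o : Option β => o.toList) (.retype fun o => by cases o <;> rfl) ho

theorem esize_suffix {l m : List β} (h : l <:+ m) : esize l ≤ esize m :=
  esize_sublist h.sublist

/-- Folding with a function that does not look at the accumulator too closely. -/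
theorem FP.foldr_bound {l : α → List β} {i : α → σ} {s : α → β → σ → σ} (hl : FP l) (hi : FP i)
    (hs : FP fun z : α × β × σ => s z.1 z.2.1 z.2.2) (q : Polynomial ℕ)
    (hq : ∀ x (l' : List β), esize (l'.foldr (s x) (i x)) ≤ q.eval (esize x + esize l')) :
    FP (fun x => (l x).foldr (s x) (i x)) := by
  obtain ⟨p, hp⟩ := hl.size
  refine hl.foldr hi hs (q.comp (.X + p)) fun x l' hl' => (hq x l').trans ?_
  simp only [Polynomial.eval_comp, Polynomial.eval_add, Polynomial.eval_X]
  exact poly_mono q (Nat.add_le_add_left ((esize_suffix hl').trans (hp x)) _)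

/-- An option has the same representation as a list of length at most one, so the case distinction
is a fold. -/
theorem FP.elim {o : α → Option β} {g : α → γ} {f : α → β → γ} (ho : FP o) (hg : FP g)
    (hf : FP fun z : α × β => f z.1 z.2) : FP (fun x => (o x).elim (g x) (f x)) := by
  obtain ⟨q, hq⟩ := hg.size
  obtain ⟨p, hp⟩ := hf.size
  have : FP fun x => (o x).toList.foldr (fun b _ => f x b) (g x) := by
    refine FP.foldr_bound (s := fun x b _ => f x b) ho.toList hg
      (hf.comp (FP.fst.pair (FP.fst.comp FP.snd))) (p + q) fun x l' => ?_
    rw [Polynomial.eval_add]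
    cases l' with
    | nil =>
      have := (hq x).trans (poly_mono q (Nat.le_add_right (esize x) (esize ([] : List β))))
      simp only [List.foldr_nil]; omega
    | cons b l =>
      have h1 := hp (x, b)
      have h2 : esize (x, b) ≤ esize x + esize (b :: l) := by
        simp only [esize_mk, esize_cons]; omega
      have h3 := poly_mono p h2
      simp only [List.foldr_cons]; simp only at h1; omega
  exact this.congr fun x => by cases o x <;> rfl

theorem FP.map {l : α → List β} {f : α → β → γ} (hl : FP l) (hf : FP fun z : α × β => f z.1 z.2) :
    FP (fun x => (l x).map (f x)) := by
  obtain ⟨p, hp⟩ := hf.size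
  have : FP fun x => (l x).foldr (fun b acc => f x b :: acc) [] := by
    refine FP.foldr_bound (s := fun x b acc => f x b :: acc) hl (.const [])
      (FP.cons (hf.comp (FP.fst.pair (FP.fst.comp FP.snd))) (FP.snd.comp FP.snd))
      (.X * (p + 1) + 1) fun x l' => ?_
    have h1 : l'.foldr (fun b acc => f x b :: acc) [] = l'.map (f x) :=
      List.map_eq_foldr.symm
    rw [h1]
    refine (esize_list_le (c := p.eval (esize x + esize l')) fun c hc => ?_).trans ?_
    · obtain ⟨b, hb, rfl⟩ := List.mem_map.1 hc
      refine (hp (x, b)).trans (poly_mono p ?_)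
      have := esize_le_of_mem hb
      simp only [esize_mk]; omega
    · simp only [Polynomial.eval_add, Polynomial.eval_mul, Polynomial.eval_X, Polynomial.eval_one]
      have := length_lt_esize l'
      exact Nat.add_le_add_right (Nat.mul_le_mul_right _ (by simp; omega)) _
  exact this.congr fun x => List.map_eq_foldr.symm

theorem FP.append {l m : α → List β} (hl : FP l) (hm : FP m) : FP (fun x => l x ++ m x) := by
  obtain ⟨p, hp⟩ := hm.size
  have : FP fun x => (l x).foldr (fun b acc => b :: acc) (m x) := by
    refine FP.foldr_bound (s := fun x b acc => b :: acc) hl hm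
      (FP.cons (FP.fst.comp FP.snd) (FP.snd.comp FP.snd)) (.X + p) fun x l' => ?_
    rw [List.foldr_cons_eq_append, List.map_id']
    have h1 := esize_append l' (m x)
    have h2 := hp x
    have h3 := poly_mono p (Nat.le_add_right (esize x) (esize l'))
    simp only [Polynomial.eval_add, Polynomial.eval_X]
    omega
  exact this.congr fun x => by rw [List.foldr_cons_eq_append, List.map_id']

theorem esize_flatten (l : List (List β)) : esize l.flatten ≤ esize l := by
  induction l with
  | nil => simp
  | cons a l ih =>
    have := esize_append a l.flatten
    simp only [List.flatten_cons, esize_cons]; omega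

theorem FP.flatMap {l : α → List β} {f : α → β → List γ} (hl : FP l)
    (hf : FP fun z : α × β => f z.1 z.2) : FP (fun x => (l x).flatMap (f x)) := by
  have h1 : FP fun m : List (List γ) => m.foldr (fun b acc => b ++ acc) [] := by
    refine FP.foldr_bound (s := fun _ b acc => b ++ acc) .id (.const [])
      (FP.append (FP.fst.comp FP.snd) (FP.snd.comp FP.snd)) .X fun x l' => ?_
    have := esize_flatten l'
    have h : ∀ l' : List (List γ), l'.foldr (fun b acc => b ++ acc) [] = l'.flatten := by
      intro l'; induction l' with
      | nil => rfl
      | cons a l ih => rw [List.foldr_cons, ih, List.flatten_cons]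
    rw [h]
    simp; omega
  refine (h1.comp (hl.map hf)).congr fun x => ?_
  induction l x with
  | nil => rfl
  | cons a l ih => rw [List.map_cons, List.foldr_cons, ih, List.flatMap_cons]

theorem FP.filter {l : α → List β} {p : α → β → Bool} (hl : FP l)
    (hp : FP fun z : α × β => p z.1 z.2) : FP (fun x => (l x).filter (p x)) := by
  refine (hl.flatMap (f := fun x b => if p x b then [b] else [])
    (hp.ite (FP.snd.cons (.const [])) (.const []))).congr fun x => ?_
  induction l x with
  | nil => rfl
  | cons a l ih => by_cases h : p x a <;> simp_all

theorem FP.find? {l : α → List β} {p : α → β → Bool} (hl : FP l)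
    (hp : FP fun z : α × β => p z.1 z.2) : FP (fun x => (l x).find? (p x)) :=
  (hl.filter hp).head?.congr fun x => by simp

theorem FP.any {l : α → List β} {p : α → β → Bool} (hl : FP l)
    (hp : FP fun z : α × β => p z.1 z.2) : FP (fun x => (l x).any (p x)) :=
  (hl.filter hp).isEmpty_not.congr fun x => by
    induction l x with
    | nil => rfl
    | cons a l ih => by_cases h : p x a <;> simp_all

/-! ### Unary arithmetic -/

/-- Unary numbers and lists of units are the same trees, so arithmetic reduces to list operations.
-/
theorem enc_replicate (n : ℕ) : enc (List.replicate n ()) = enc n := by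
  induction n with
  | zero => rfl
  | succ n ih => rw [List.replicate_succ, enc_cons, ih]; rfl

theorem FP.replicate {f : α → ℕ} (hf : FP f) : FP (fun x => List.replicate (f x) ()) :=
  FP.comp (g := fun n : ℕ => List.replicate n ()) (.retype enc_replicate) hf

theorem FP.length {l : α → List β} (hl : FP l) : FP (fun x => (l x).length) := by
  have h : FP fun l : List Unit => l.length := .retype fun l => by
    rw [← enc_replicate]; congr 1; exact (List.eq_replicate_iff.2 ⟨rfl, fun _ _ => rfl⟩).symm
  exact (h.comp (hl.map (f := fun _ _ => ()) (.const ()))).congr fun x => by simp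

theorem FP.add {f g : α → ℕ} (hf : FP f) (hg : FP g) : FP (fun x => f x + g x) :=
  (hf.replicate.append hg.replicate).length.congr fun x => by simp

theorem FP.sub {f g : α → ℕ} (hf : FP f) (hg : FP g) : FP (fun x => f x - g x) := by
  have e : ∀ m (l : List Unit), l.foldr (fun _ acc => acc - 1) m = m - l.length := by
    intro m l; induction l with
    | nil => rfl
    | cons a l ih => simp [ih]; omega
  have hpred : FP fun n : ℕ => n - 1 :=
    (FP.replicate .id).tail.length.congr fun n => by simp
  obtain ⟨p, hp⟩ := hf.size
  have : FP fun x => (List.replicate (g x) ()).foldr (fun _ acc => acc - 1) (f x) := by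
    refine FP.foldr_bound (s := fun _ _ acc => acc - 1) hg.replicate hf
      (hpred.comp (FP.snd.comp FP.snd)) p fun x l' => ?_
    rw [e]
    have h2 := hp x
    have h3 := poly_mono p (Nat.le_add_right (esize x) (esize l'))
    simp only [esize_nat] at h2 ⊢
    omega
  exact this.congr fun x => by simp [e]

theorem FP.pos {f : α → ℕ} (hf : FP f) : FP (fun x => decide (0 < f x)) :=
  FP.comp (g := fun n : ℕ => decide (0 < n)) (.test fun n => by cases n <;> simp) hf

theorem FP.le {f g : α → ℕ} (hf : FP f) (hg : FP g) : FP (fun x => decide (f x ≤ g x)) :=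
  (hf.sub hg).pos.not.congr fun x => by simp [← decide_not]

theorem FP.eq {f g : α → ℕ} (hf : FP f) (hg : FP g) : FP (fun x => decide (f x = g x)) :=
  ((hf.le hg).and (hg.le hf)).congr fun x => by
    rw [← Bool.decide_and]; exact decide_eq_decide.2 le_antisymm_iff.symm

theorem FP.mem {f : α → ℕ} {l : α → List ℕ} (hf : FP f) (hl : FP l) :
    FP (fun x => decide (f x ∈ l x)) :=
  FP.congr (hl.any (p := fun x b => decide (f x = b)) ((hf.comp FP.fst).eq FP.snd))
    (g := fun x => decide (f x ∈ l x)) fun x => by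
    rw [Bool.eq_iff_iff, List.any_eq_true]; simp

/-- Iteration is a fold over a list of `n x` units that ignores the elements. The size bound is
needed only for the iterates that actually occur. -/
theorem FP.iterate {n : α → ℕ} {i : α → σ} {s : α → σ → σ} (hn : FP n) (hi : FP i)
    (hs : FP fun z : α × σ => s z.1 z.2) (q : Polynomial ℕ)
    (hq : ∀ x m, m ≤ n x → esize ((s x)^[m] (i x)) ≤ q.eval (esize x)) :
    FP (fun x => (s x)^[n x] (i x)) := by
  have e : ∀ x (l : List Unit), l.foldr (fun _ acc => s x acc) (i x) = (s x)^[l.length] (i x) := by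
    intro x l; induction l with
    | nil => rfl
    | cons a l ih => rw [List.foldr_cons, ih, List.length_cons, Function.iterate_succ_apply']
  refine (FP.foldr (s := fun x _ acc => s x acc) hn.replicate hi
    (hs.comp (FP.fst.pair (FP.snd.comp FP.snd))) q fun x l' hl' => ?_).congr fun x => ?_
  · rw [e]
    exact hq x _ (by simpa using hl'.length_le)
  · rw [e, List.length_replicate]

end

end TreeLang

/-! ### Surplus of independent sets and vertex covers -/

namespace VC

section
variable {A : ℕ → ℕ → Prop} {V : Finset ℕ}

open Classical in
/-- Open neighbourhood of `I` inside `V`. -/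
noncomputable def nb (A : ℕ → ℕ → Prop) (V I : Finset ℕ) : Finset ℕ :=
  V.filter fun w => ∃ i ∈ I, A i w

def Indep (A : ℕ → ℕ → Prop) (I : Finset ℕ) : Prop := ∀ a ∈ I, ∀ b ∈ I, ¬ A a b

def Cover (A : ℕ → ℕ → Prop) (V C : Finset ℕ) : Prop :=
  C ⊆ V ∧ ∀ a ∈ V, ∀ b ∈ V, A a b → a ∈ C ∨ b ∈ C

/-- Every nonempty independent set has at least `t` more neighbours than elements. -/
def Good (A : ℕ → ℕ → Prop) (V : Finset ℕ) (t : ℤ) : Prop :=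
  ∀ I ⊆ V, I.Nonempty → Indep A I → (I.card : ℤ) + t ≤ (nb A V I).card

/-- The bound is an integer so that an overdrawn budget is a negative bound, which no cover meets.
-/
def Sol (A : ℕ → ℕ → Prop) (V : Finset ℕ) (k : ℤ) : Prop :=
  ∃ C, Cover A V C ∧ (C.card : ℤ) ≤ k

/-- `I` is an independent set of maximum deficiency. -/
def IsCrit (A : ℕ → ℕ → Prop) (V I : Finset ℕ) : Prop :=
  I ⊆ V ∧ Indep A I ∧ ∀ X ⊆ V, Indep A X → X.card + (nb A V I).card ≤ (nb A V X).card + I.card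

theorem mem_nb {I : Finset ℕ} {w : ℕ} : w ∈ nb A V I ↔ w ∈ V ∧ ∃ i ∈ I, A i w := by
  simp [nb]

theorem nb_subset {I : Finset ℕ} : nb A V I ⊆ V := fun _ h => (mem_nb.1 h).1

theorem nb_mono {I J : Finset ℕ} (h : I ⊆ J) : nb A V I ⊆ nb A V J := fun w hw => by
  obtain ⟨h1, i, h2, h3⟩ := mem_nb.1 hw
  exact mem_nb.2 ⟨h1, i, h h2, h3⟩

@[simp] theorem nb_empty : nb A V ∅ = ∅ := by ext; simp [mem_nb]

theorem mem_nb_singleton {v w : ℕ} : w ∈ nb A V {v} ↔ w ∈ V ∧ A v w := by simp [mem_nb]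

theorem Indep.mono {I J : Finset ℕ} (h : Indep A J) (hIJ : I ⊆ J) : Indep A I :=
  fun a ha b hb => h a (hIJ ha) b (hIJ hb)

theorem Indep.disjoint {I : Finset ℕ} (h : Indep A I) : Disjoint I (nb A V I) := by
  rw [Finset.disjoint_left]
  intro w hw hw'
  obtain ⟨-, i, hi, hA⟩ := mem_nb.1 hw'
  exact h i hi w hw hA

theorem Good.mono {s t : ℤ} (h : Good A V t) (hst : s ≤ t) : Good A V s :=
  fun I hI h0 h1 => by have := h I hI h0 h1; omega

theorem indep_empty : Indep A ∅ := fun a ha => by simp at ha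

theorem indep_singleton {v : ℕ} (h : ¬ A v v) : Indep A {v} := by simpa [Indep] using h

theorem card_rem {J : Finset ℕ} (hJ : J ⊆ V) (hi : Indep A J) :
    (V \ (J ∪ nb A V J)).card + J.card + (nb A V J).card = V.card := by
  have h := Finset.card_sdiff_add_card_eq_card (Finset.union_subset hJ (nb_subset (A := A) (I := J)))
  rw [Finset.card_union_of_disjoint hi.disjoint] at h
  omega

/-! ### Exchange arguments for vertex covers -/

/-- Exchange of `J` for its neighbourhood in a vertex cover. -/
theorem Cover.swap {C J : Finset ℕ} (hs : ∀ a b, A a b → A b a) (hC : Cover A V C)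
    (hi : Indep A J) (h : (nb A V J \ C).card ≤ (J ∩ C).card) :
    ∃ C', Cover A V C' ∧ C'.card ≤ C.card ∧ nb A V J ⊆ C' ∧ Disjoint C' J := by
  refine ⟨(C \ J) ∪ nb A V J, ⟨?_, ?_⟩, ?_, Finset.subset_union_right, ?_⟩
  · exact Finset.union_subset (Finset.sdiff_subset.trans hC.1) nb_subset
  · intro a ha b hb hab
    by_cases haJ : a ∈ J
    · exact .inr (Finset.mem_union_right _ (mem_nb.2 ⟨hb, a, haJ, hab⟩))
    by_cases hbJ : b ∈ J
    · exact .inl (Finset.mem_union_right _ (mem_nb.2 ⟨ha, b, hbJ, hs _ _ hab⟩))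
    rcases hC.2 a ha b hb hab with h | h
    · exact .inl (Finset.mem_union_left _ (Finset.mem_sdiff.2 ⟨h, haJ⟩))
    · exact .inr (Finset.mem_union_left _ (Finset.mem_sdiff.2 ⟨h, hbJ⟩))
  · have h1 : (C \ J) ∪ nb A V J ⊆ (C \ J) ∪ (nb A V J \ C) := by
      intro w hw
      have hd : w ∈ J → w ∉ nb A V J := fun h => Finset.disjoint_left.1 hi.disjoint h
      simp only [Finset.mem_union, Finset.mem_sdiff] at hw ⊢
      tauto
    have h2 := (Finset.card_le_card h1).trans (Finset.card_union_le _ _)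
    have h3 := Finset.card_sdiff_add_card_inter C J
    rw [Finset.inter_comm] at h3
    omega
  · rw [Finset.disjoint_left]
    intro w hw hwJ
    rcases Finset.mem_union.1 hw with h | h
    · exact (Finset.mem_sdiff.1 h).2 hwJ
    · exact Finset.disjoint_left.1 hi.disjoint hwJ h

theorem Cover.rem {C J : Finset ℕ} (hC : Cover A V C) (hd : Disjoint C J) :
    Cover A (V \ (J ∪ nb A V J)) (C \ nb A V J) := by
  constructor
  · intro w hw
    have h1 := hC.1 (Finset.mem_sdiff.1 hw).1
    have h2 := Finset.disjoint_left.1 hd (Finset.mem_sdiff.1 hw).1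
    simp only [Finset.mem_sdiff, Finset.mem_union] at hw ⊢
    tauto
  · intro a ha b hb hab
    simp only [Finset.mem_sdiff, Finset.mem_union] at ha hb ⊢
    rcases hC.2 a ha.1 b hb.1 hab with h | h
    · exact .inl ⟨h, fun h => ha.2 (.inr h)⟩
    · exact .inr ⟨h, fun h => hb.2 (.inr h)⟩

theorem Sol.of_rem {J : Finset ℕ} {k : ℤ} (hs : ∀ a b, A a b → A b a)
    (h : Sol A (V \ (J ∪ nb A V J)) (k - (nb A V J).card)) : Sol A V k := by
  obtain ⟨C, hC, hk⟩ := h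
  refine ⟨C ∪ nb A V J, ⟨Finset.union_subset (hC.1.trans Finset.sdiff_subset) nb_subset, ?_⟩, ?_⟩
  · intro a ha b hb hab
    by_cases ha' : a ∈ nb A V J
    · exact .inl (Finset.mem_union_right _ ha')
    by_cases hb' : b ∈ nb A V J
    · exact .inr (Finset.mem_union_right _ hb')
    have haJ : a ∉ J := fun h => hb' (mem_nb.2 ⟨hb, a, h, hab⟩)
    have hbJ : b ∉ J := fun h => ha' (mem_nb.2 ⟨ha, b, h, hs _ _ hab⟩)
    rcases hC.2 a (by simp [*]) b (by simp [*]) hab with h | h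
    · exact .inl (Finset.mem_union_left _ h)
    · exact .inr (Finset.mem_union_left _ h)
  · have := Finset.card_union_le C (nb A V J)
    omega

theorem Sol.of_put {J : Finset ℕ} {k : ℤ} (hJ : J ⊆ V)
    (h : Sol A (V \ J) (k - J.card)) : Sol A V k := by
  obtain ⟨C, hC, hk⟩ := h
  refine ⟨C ∪ J, ⟨Finset.union_subset (hC.1.trans Finset.sdiff_subset) hJ, ?_⟩, ?_⟩
  · intro a ha b hb hab
    by_cases ha' : a ∈ J
    · exact .inl (Finset.mem_union_right _ ha')
    by_cases hb' : b ∈ J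
    · exact .inr (Finset.mem_union_right _ hb')
    rcases hC.2 a (by simp [*]) b (by simp [*]) hab with h | h
    · exact .inl (Finset.mem_union_left _ h)
    · exact .inr (Finset.mem_union_left _ h)
  · have := Finset.card_union_le C J
    omega

theorem Cover.sol_rem {C J : Finset ℕ} {k : ℤ} (hs : ∀ a b, A a b → A b a) (hC : Cover A V C)
    (hk : (C.card : ℤ) ≤ k) (hi : Indep A J)
    (h : (nb A V J \ C).card ≤ (J ∩ C).card) :
    Sol A (V \ (J ∪ nb A V J)) (k - (nb A V J).card) := by
  obtain ⟨C', h1, h2, h3, h4⟩ := hC.swap hs hi h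
  refine ⟨_, h1.rem h4, ?_⟩
  have := Finset.card_sdiff_add_card_eq_card h3
  omega

theorem Cover.sol_put {C J : Finset ℕ} {k : ℤ} (hC : Cover A V C)
    (hk : (C.card : ℤ) ≤ k) (h : J ⊆ C) : Sol A (V \ J) (k - J.card) := by
  refine ⟨C \ J, ⟨Finset.sdiff_subset_sdiff hC.1 subset_rfl, ?_⟩, ?_⟩
  · intro a ha b hb hab
    simp only [Finset.mem_sdiff] at ha hb ⊢
    rcases hC.2 a ha.1 b hb.1 hab with h | h
    · exact .inl ⟨h, ha.2⟩
    · exact .inr ⟨h, hb.2⟩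
  · have := Finset.card_sdiff_add_card_eq_card h
    omega

/-- The condition for exchanging, in terms of the surplus of the part of `J` outside the cover. -/
theorem Cover.swap_card {C J : Finset ℕ} (hC : Cover A V C)
    (hJ : J ⊆ V)
    (h : (nb A V J).card + (J \ C).card ≤ (nb A V (J \ C)).card + J.card) :
    (nb A V J \ C).card ≤ (J ∩ C).card := by
  -- A vertex outside the cover forces all its neighbours into it.
  have h1 : nb A V (J \ C) ⊆ nb A V J ∩ C := by
    intro w hw
    obtain ⟨hwV, i, hi, hA⟩ := mem_nb.1 hw
    refine Finset.mem_inter.2 ⟨nb_mono Finset.sdiff_subset hw, ?_⟩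
    rw [Finset.mem_sdiff] at hi
    exact (hC.2 i (hJ hi.1) w hwV hA).resolve_left hi.2
  have h2 := Finset.card_le_card h1
  have h3 := Finset.card_sdiff_add_card_inter (nb A V J) C
  have h4 := Finset.card_sdiff_add_card_inter J C
  omega

/-- If no subset of J has smaller surplus than J, the part of J outside a cover already forces
enough of N(J) into it that exchanging J for N(J) costs nothing. Taking X empty shows that J has
surplus at most 0. -/
theorem sol_rem_iff {J : Finset ℕ} {k : ℤ} (hs : ∀ a b, A a b → A b a) (hJ : J ⊆ V)
    (hi : Indep A J)
    (h : ∀ X ⊆ J, (nb A V J).card + X.card ≤ (nb A V X).card + J.card) :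
    Sol A V k ↔ Sol A (V \ (J ∪ nb A V J)) (k - (nb A V J).card) := by
  refine ⟨fun ⟨C, hC, hk⟩ => ?_, Sol.of_rem hs⟩
  exact hC.sol_rem hs hk hi (hC.swap_card hJ (h _ Finset.sdiff_subset))

/-- Only nonempty subsets are compared with J here. The remaining possibility, that no vertex of J
is outside the cover, is the second branch. -/
theorem sol_branch_iff {J : Finset ℕ} {k : ℤ} (hs : ∀ a b, A a b → A b a) (hJ : J ⊆ V)
    (hi : Indep A J)
    (h : ∀ X ⊆ J, X.Nonempty → (nb A V J).card + X.card ≤ (nb A V X).card + J.card) :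
    Sol A V k ↔ Sol A (V \ (J ∪ nb A V J)) (k - (nb A V J).card) ∨
      Sol A (V \ J) (k - J.card) := by
  refine ⟨fun ⟨C, hC, hk⟩ => ?_, fun h => h.elim (Sol.of_rem hs) (Sol.of_put hJ)⟩
  rcases (J \ C).eq_empty_or_nonempty with h0 | h0
  · exact .inr (hC.sol_put hk (Finset.sdiff_eq_empty_iff_subset.1 h0))
  · exact .inl (hC.sol_rem hs hk hi (hC.swap_card hJ (h _ Finset.sdiff_subset h0)))

/-- If the cover contains J, the edge inside N(J) puts at least one neighbour into it as well. At
most |J| neighbours are then missing, and the exchange is free. -/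
theorem sol_rem_of_edge {J : Finset ℕ} {k : ℤ} (hs : ∀ a b, A a b → A b a) (hg : Good A V 1)
    (hJ : J ⊆ V) (hi : Indep A J) (h1 : (nb A V J).card ≤ J.card + 1)
    (h2 : ¬ Indep A (nb A V J)) :
    Sol A V k ↔ Sol A (V \ (J ∪ nb A V J)) (k - (nb A V J).card) := by
  refine ⟨fun ⟨C, hC, hk⟩ => hC.sol_rem hs hk hi ?_, Sol.of_rem hs⟩
  rcases (J \ C).eq_empty_or_nonempty with h0 | h0
  · rw [Finset.inter_eq_left.2 (Finset.sdiff_eq_empty_iff_subset.1 h0)]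
    simp only [Indep, not_forall, not_not] at h2
    obtain ⟨a, ha, b, hb, hab⟩ := h2
    have : (nb A V J ∩ C).Nonempty := by
      rcases hC.2 a (nb_subset ha) b (nb_subset hb) hab with h | h
      · exact ⟨a, Finset.mem_inter.2 ⟨ha, h⟩⟩
      · exact ⟨b, Finset.mem_inter.2 ⟨hb, h⟩⟩
    have h3 := this.card_pos
    have h4 := Finset.card_sdiff_add_card_inter (nb A V J) C
    omega
  · refine hC.swap_card hJ ?_
    have := hg (J \ C) (Finset.sdiff_subset.trans hJ) h0 (hi.mono Finset.sdiff_subset)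
    omega

/-! ### Deletion of vertices -/

theorem indep_union {I J : Finset ℕ} (hs : ∀ a b, A a b → A b a) (hI : Indep A I)
    (hJ : Indep A J) (hIJ : I ⊆ V \ (J ∪ nb A V J)) : Indep A (I ∪ J) := by
  have key : ∀ a ∈ I, ∀ b ∈ J, ¬ A b a := fun a ha b hb h => by
    have := Finset.mem_sdiff.1 (hIJ ha)
    exact this.2 (Finset.mem_union_right _ (mem_nb.2 ⟨this.1, b, hb, h⟩))
  intro a ha b hb hab
  rcases Finset.mem_union.1 ha with h | h <;> rcases Finset.mem_union.1 hb with h' | h'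
  · exact hI a h b h' hab
  · exact key a h b h' (hs _ _ hab)
  · exact key b h' a h hab
  · exact hJ a h b h' hab

theorem card_union_rem {I J : Finset ℕ} (hIJ : I ⊆ V \ (J ∪ nb A V J)) :
    (I ∪ J).card = I.card + J.card := by
  refine Finset.card_union_of_disjoint (Finset.disjoint_left.2 fun a ha hb => ?_)
  exact (Finset.mem_sdiff.1 (hIJ ha)).2 (Finset.mem_union_left _ hb)

/-- Together with `card_union_rem`, surplus is additive: that of I ∪ J is that of J plus that of I
in the graph without J and N(J). All estimates after deletions rest on this. -/
theorem card_nb_union_rem {I J : Finset ℕ} (hs : ∀ a b, A a b → A b a)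
    (hIJ : I ⊆ V \ (J ∪ nb A V J)) :
    (nb A V (I ∪ J)).card = (nb A (V \ (J ∪ nb A V J)) I).card + (nb A V J).card := by
  rw [← Finset.card_union_of_disjoint]
  · congr 1
    ext w
    simp only [mem_nb, Finset.mem_union, Finset.mem_sdiff]
    constructor
    · rintro ⟨hw, i, hi, hA⟩
      by_cases h : ∃ i ∈ J, A i w
      · exact .inr ⟨hw, h⟩
      · have hiI : i ∈ I := hi.resolve_right fun hi => h ⟨i, hi, hA⟩
        refine .inl ⟨⟨hw, ?_⟩, i, hiI, hA⟩
        rintro (hwJ | hwN)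
        · have := Finset.mem_sdiff.1 (hIJ hiI)
          exact this.2 (Finset.mem_union_right _ (mem_nb.2 ⟨this.1, w, hwJ, hs _ _ hA⟩))
        · exact h hwN.2
    · rintro (⟨⟨hw, -⟩, i, hi, hA⟩ | ⟨hw, i, hi, hA⟩)
      · exact ⟨hw, i, .inl hi, hA⟩
      · exact ⟨hw, i, .inr hi, hA⟩
  · rw [Finset.disjoint_left]
    intro w hw hw'
    exact (Finset.mem_sdiff.1 (nb_subset hw)).2 (Finset.mem_union_right _ hw')

theorem nb_put {I J : Finset ℕ} : nb A (V \ J) I = nb A V I \ J := by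
  ext w; simp only [mem_nb, Finset.mem_sdiff]; tauto

theorem card_nb_put {I J : Finset ℕ} : (nb A V I).card ≤ (nb A (V \ J) I).card + J.card := by
  have h1 := Finset.card_sdiff_add_card_inter (nb A V I) J
  have h2 := Finset.card_le_card (Finset.inter_subset_right (s₁ := nb A V I) (s₂ := J))
  rw [nb_put]
  omega

theorem Good.put {t : ℤ} {J : Finset ℕ} (h : Good A V t) : Good A (V \ J) (t - J.card) :=
  fun I hI h0 hi => by
    have h1 := h I (hI.trans Finset.sdiff_subset) h0 hi
    have h2 := card_nb_put (A := A) (V := V) (I := I) (J := J)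
    omega

/-- Surplus after the deletion of `J` and its neighbours, from the surplus of the sets that
properly contain `J`. -/
theorem good_rem {t : ℤ} {J : Finset ℕ} (hs : ∀ a b, A a b → A b a) (hJ : J ⊆ V)
    (hi : Indep A J)
    (h : ∀ K ⊆ V, Indep A K → J ⊆ K → J.card < K.card → (K.card : ℤ) + t ≤ (nb A V K).card) :
    Good A (V \ (J ∪ nb A V J)) (t + J.card - (nb A V J).card) := by
  intro I hI h0 hI'
  have h1 := h (I ∪ J) (Finset.union_subset (hI.trans Finset.sdiff_subset) hJ)
    (indep_union hs hI' hi hI) Finset.subset_union_right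
    (by rw [card_union_rem hI]; have := h0.card_pos; omega)
  rw [card_union_rem hI, card_nb_union_rem hs hI] at h1
  push_cast at h1
  omega

/-- A set of negative surplus in the remaining graph could be added to I and would increase its
deficiency. -/
theorem IsCrit.good {I : Finset ℕ} (hs : ∀ a b, A a b → A b a) (h : IsCrit A V I) :
    Good A (V \ (I ∪ nb A V I)) 0 := by
  refine (good_rem (t := (nb A V I).card - I.card) hs h.1 h.2.1 fun K hK hi _ _ => ?_).mono
    (by omega)
  have := h.2.2 K hK hi
  omega

/-- By additivity, a set of maximum deficiency outside S and N(S), together with S, has minimum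
surplus among the independent sets that contain S. -/
theorem IsCrit.extend {I S K : Finset ℕ} (hs : ∀ a b, A a b → A b a)
    (h : IsCrit A (V \ (S ∪ nb A V S)) I) (hK : K ⊆ V) (hi : Indep A K) (hSK : S ⊆ K) :
    K.card + (nb A V (I ∪ S)).card ≤ (nb A V K).card + (I ∪ S).card := by
  have hsub : K \ S ⊆ V \ (S ∪ nb A V S) := by
    intro w hw
    rw [Finset.mem_sdiff] at hw
    rw [Finset.mem_sdiff, Finset.mem_union, not_or]
    refine ⟨hK hw.1, hw.2, fun hw' => ?_⟩
    obtain ⟨-, i, hiS, hA⟩ := mem_nb.1 hw'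
    exact hi i (hSK hiS) w hw.1 hA
  have h1 := h.2.2 (K \ S) hsub (hi.mono Finset.sdiff_subset)
  have h2 := card_nb_union_rem hs hsub
  have h3 := card_union_rem hsub
  rw [Finset.sdiff_union_of_subset hSK] at h2 h3
  rw [card_nb_union_rem hs h.1, card_union_rem h.1]
  omega

/-- The complement of a cover is independent with its neighbourhood inside the cover, so nonnegative
surplus makes the cover at least as large as its complement. -/
theorem Good.card_le {C : Finset ℕ} (h : Good A V 0) (hC : Cover A V C) : V.card ≤ 2 * C.card := by
  have hi : Indep A (V \ C) := fun a ha b hb hab => by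
    rw [Finset.mem_sdiff] at ha hb
    exact (hC.2 a ha.1 b hb.1 hab).elim ha.2 hb.2
  have h1 : nb A V (V \ C) ⊆ C := fun w hw => by
    obtain ⟨hw', i, hi', hA⟩ := mem_nb.1 hw
    rw [Finset.mem_sdiff] at hi'
    exact (hC.2 i hi'.1 w hw' hA).resolve_left hi'.2
  have h2 := Finset.card_le_card h1
  have h3 := Finset.card_sdiff_add_card_eq_card hC.1
  rcases (V \ C).eq_empty_or_nonempty with h0 | h0
  · rw [h0] at h3; simp at h3; omega
  · have := h _ Finset.sdiff_subset h0 hi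
    omega

/-! ### Folding -/

open Classical in
/-- Renaming the elements of `N` to `z`. -/
noncomputable def ren (N : Finset ℕ) (z x : ℕ) : ℕ := if x ∈ N then z else x

/-- An edge inside `N` would become a loop at `z`; folding is used only when `N` is independent. -/
def foldAdj (A : ℕ → ℕ → Prop) (N : Finset ℕ) (z a b : ℕ) : Prop :=
  ∃ x y, A x y ∧ ren N z x = a ∧ ren N z y = b

theorem foldAdj_symm {N : Finset ℕ} {z : ℕ} (hs : ∀ a b, A a b → A b a) (a b : ℕ)
    (h : foldAdj A N z a b) : foldAdj A N z b a := by
  obtain ⟨x, y, h, rfl, rfl⟩ := h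
  exact ⟨y, x, hs _ _ h, rfl, rfl⟩

theorem foldAdj_of {N : Finset ℕ} {z a b : ℕ} (ha : a ∉ N) (hb : b ∉ N) :
    A a b → foldAdj A N z a b := fun h => ⟨a, b, h, by simp [ren, ha], by simp [ren, hb]⟩

theorem foldAdj_of_left {N : Finset ℕ} {z a b : ℕ} (ha : a ∈ N) (hb : b ∉ N) :
    A a b → foldAdj A N z z b := fun h => ⟨a, b, h, by simp [ren, ha], by simp [ren, hb]⟩

theorem ren_eq {N : Finset ℕ} {z x a : ℕ} (h : ren N z x = a) (ha : a ≠ z) : x = a ∧ a ∉ N := by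
  unfold ren at h
  split_ifs at h with hx
  · exact absurd h.symm ha
  · exact ⟨h, h ▸ hx⟩

theorem ren_eq_self {N : Finset ℕ} {z x : ℕ} (hz : z ∈ N) (h : ren N z x = z) : x ∈ N := by
  unfold ren at h
  split_ifs at h with hx
  · exact hx
  · exact h ▸ hz

section fold
variable {J : Finset ℕ} {z : ℕ}

/-- Vertices of the folded graph. -/
noncomputable def foldV (A : ℕ → ℕ → Prop) (V J : Finset ℕ) (z : ℕ) : Finset ℕ :=
  V \ (J ∪ (nb A V J).erase z)

theorem mem_foldV {w : ℕ} (hz : z ∈ nb A V J) :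
    w ∈ foldV A V J z ↔ (w = z ∧ z ∉ J) ∨ (w ∈ V ∧ w ∉ J ∧ w ∉ nb A V J) := by
  have := nb_subset hz
  simp only [foldV, Finset.mem_sdiff, Finset.mem_union, Finset.mem_erase]
  by_cases h : w = z
  · subst h; tauto
  · tauto

theorem card_foldV (hJ : J ⊆ V) (hi : Indep A J) (hz : z ∈ nb A V J) :
    (foldV A V J z).card + J.card + (nb A V J).card = V.card + 1 := by
  have h := Finset.card_sdiff_add_card_eq_card
    (Finset.union_subset hJ ((Finset.erase_subset z _).trans (nb_subset (A := A) (I := J))))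
  rw [Finset.card_union_of_disjoint
    (hi.disjoint.mono_right (Finset.erase_subset z _)), Finset.card_erase_of_mem hz] at h
  have := Finset.card_pos.2 ⟨z, hz⟩
  unfold foldV
  omega

theorem foldAdj_loopless (hi : Indep A (nb A V J)) (hz : z ∈ nb A V J)
    (hl : ∀ a ∈ V, ¬ A a a) : ∀ a ∈ foldV A V J z, ¬ foldAdj A (nb A V J) z a a := by
  rintro a ha ⟨x, y, h, hx, hy⟩
  rcases eq_or_ne a z with rfl | haz
  · exact hi x (ren_eq_self hz hx) y (ren_eq_self hz hy) h
  · obtain ⟨rfl, -⟩ := ren_eq hx haz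
    obtain ⟨rfl, -⟩ := ren_eq hy haz
    rcases (mem_foldV hz).1 ha with h' | h'
    · exact haz h'.1
    · exact hl _ h'.1 h

/-- With minimum surplus 1 attained by J, a cover may be assumed to contain either N(J) and nothing
of J, or J and nothing of N(J). The vertex z of the folded graph records the choice: it is in the
cover in the first case and not in the second. The costs are |J| + 1 and |J|, hence the budget drops
by |J|. -/
theorem sol_fold_iff {k : ℤ} (hs : ∀ a b, A a b → A b a) (hg : Good A V 1)
    (hJ : J ⊆ V) (hi : Indep A J) (h1 : (nb A V J).card = J.card + 1)
    (h2 : Indep A (nb A V J)) (hz : z ∈ nb A V J) :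
    Sol A V k ↔ Sol (foldAdj A (nb A V J) z) (foldV A V J z) (k - J.card) := by
  have hzJ : z ∉ J := fun h => Finset.disjoint_left.1 hi.disjoint h hz
  constructor
  · rintro ⟨C, hC, hk⟩
    by_cases hsw : (nb A V J \ C).card ≤ (J ∩ C).card
    · obtain ⟨C', hC', hk', h3, h4⟩ := hC.swap hs hi hsw
      refine ⟨insert z (C' \ nb A V J), ⟨?_, ?_⟩, ?_⟩
      · intro w hw
        rw [mem_foldV hz]
        rcases Finset.mem_insert.1 hw with rfl | hw
        · exact .inl ⟨rfl, hzJ⟩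
        · rw [Finset.mem_sdiff] at hw
          exact .inr ⟨hC'.1 hw.1, Finset.disjoint_left.1 h4 hw.1, hw.2⟩
      · rintro a ha b hb ⟨x, y, h, hx, hy⟩
        rcases eq_or_ne a z with rfl | haz
        · exact .inl (Finset.mem_insert_self _ _)
        rcases eq_or_ne b z with rfl | hbz
        · exact .inr (Finset.mem_insert_self _ _)
        obtain ⟨rfl, hxN⟩ := ren_eq hx haz
        obtain ⟨rfl, hyN⟩ := ren_eq hy hbz
        have hxV := ((mem_foldV hz).1 ha).resolve_left fun h => haz h.1
        have hyV := ((mem_foldV hz).1 hb).resolve_left fun h => hbz h.1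
        simp only [Finset.mem_insert, Finset.mem_sdiff]
        have := hC'.2 x hxV.1 y hyV.1 h
        tauto
      · have h5 := Finset.card_sdiff_add_card_eq_card h3
        have h6 := Finset.card_insert_le z (C' \ nb A V J)
        omega
    -- When the exchange is not free, all of J is in the cover: a nonempty part of J outside has
    -- surplus at least 1, that of J, and would make the exchange free. Then N(J) must be disjoint
    -- from the cover, since one neighbour in it would suffice.
    · have hJC : J ⊆ C := by
        rw [← Finset.sdiff_eq_empty_iff_subset]
        by_contra h0
        refine hsw (hC.swap_card hJ ?_)
        have := hg (J \ C) (Finset.sdiff_subset.trans hJ) (Finset.nonempty_iff_ne_empty.2 h0)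
          (hi.mono Finset.sdiff_subset)
        omega
      have hNC : Disjoint (nb A V J) C := by
        rw [Finset.inter_eq_left.2 hJC] at hsw
        have := Finset.card_sdiff_add_card_inter (nb A V J) C
        rw [Finset.disjoint_iff_inter_eq_empty, ← Finset.card_eq_zero]
        omega
      refine ⟨C \ J, ⟨?_, ?_⟩, ?_⟩
      · intro w hw
        rw [Finset.mem_sdiff] at hw
        exact (mem_foldV hz).2
          (.inr ⟨hC.1 hw.1, hw.2, fun h => Finset.disjoint_left.1 hNC h hw.1⟩)
      · have key : ∀ x y b, A x y → ren (nb A V J) z x = z → ren (nb A V J) z y = b →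
            b ∈ foldV A V J z → b ∈ C \ J := by
          intro x y b h hx hy hb
          have hxN := ren_eq_self hz hx
          rcases eq_or_ne b z with rfl | hbz
          · exact absurd h (h2 x hxN y (ren_eq_self hz hy))
          obtain ⟨rfl, hyN⟩ := ren_eq hy hbz
          have hyV := ((mem_foldV hz).1 hb).resolve_left fun h => hbz h.1
          exact Finset.mem_sdiff.2 ⟨(hC.2 x (nb_subset hxN) y hyV.1 h).resolve_left
            (Finset.disjoint_left.1 hNC hxN), hyV.2.1⟩
        rintro a ha b hb ⟨x, y, h, hx, hy⟩
        rcases eq_or_ne a z with rfl | haz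
        · exact .inr (key x y b h hx hy hb)
        rcases eq_or_ne b z with rfl | hbz
        · exact .inl (key y x a (hs _ _ h) hy hx ha)
        obtain ⟨rfl, hxN⟩ := ren_eq hx haz
        obtain ⟨rfl, hyN⟩ := ren_eq hy hbz
        have hxV := ((mem_foldV hz).1 ha).resolve_left fun h => haz h.1
        have hyV := ((mem_foldV hz).1 hb).resolve_left fun h => hbz h.1
        simp only [Finset.mem_sdiff]
        have := hC.2 x hxV.1 y hyV.1 h
        tauto
      · have := Finset.card_sdiff_add_card_eq_card hJC
        omega
  · rintro ⟨C, hC, hk⟩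
    have hCJ : ∀ w ∈ C, w ∈ V ∧ w ∉ J := fun w hw => by
      rcases (mem_foldV hz).1 (hC.1 hw) with ⟨rfl, h⟩ | h
      · exact ⟨nb_subset hz, h⟩
      · exact ⟨h.1, h.2.1⟩
    by_cases hzC : z ∈ C
    · refine ⟨C ∪ nb A V J, ⟨?_, ?_⟩, ?_⟩
      · exact Finset.union_subset (fun w hw => (hCJ w hw).1) nb_subset
      · intro a ha b hb hab
        simp only [Finset.mem_union]
        by_cases ha' : a ∈ nb A V J
        · exact .inl (.inr ha')
        by_cases hb' : b ∈ nb A V J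
        · exact .inr (.inr hb')
        have haJ : a ∉ J := fun h => hb' (mem_nb.2 ⟨hb, a, h, hab⟩)
        have hbJ : b ∉ J := fun h => ha' (mem_nb.2 ⟨ha, b, h, hs _ _ hab⟩)
        have := hC.2 a ((mem_foldV hz).2 (.inr ⟨ha, haJ, ha'⟩)) b
          ((mem_foldV hz).2 (.inr ⟨hb, hbJ, hb'⟩)) (foldAdj_of ha' hb' hab)
        tauto
      · have h3 : C ∪ nb A V J = C ∪ (nb A V J).erase z := by
          ext w
          simp only [Finset.mem_union, Finset.mem_erase]
          by_cases h : w = z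
          · subst h; tauto
          · tauto
        have h4 := Finset.card_union_le C ((nb A V J).erase z)
        rw [Finset.card_erase_of_mem hz] at h4
        rw [h3]
        omega
    · refine ⟨C ∪ J, ⟨?_, ?_⟩, ?_⟩
      · exact Finset.union_subset (fun w hw => (hCJ w hw).1) hJ
      · have hzV : z ∈ foldV A V J z := (mem_foldV hz).2 (.inl ⟨rfl, hzJ⟩)
        have key : ∀ a b, a ∈ nb A V J → b ∈ V → b ∉ J → A a b → b ∈ C := by
          intro a b ha hb hbJ hab
          have hbN : b ∉ nb A V J := fun hb' => h2 a ha b hb' hab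
          exact (hC.2 z hzV b ((mem_foldV hz).2 (.inr ⟨hb, hbJ, hbN⟩))
            (foldAdj_of_left ha hbN hab)).resolve_left hzC
        intro a ha b hb hab
        simp only [Finset.mem_union]
        by_cases haJ : a ∈ J
        · exact .inl (.inr haJ)
        by_cases hbJ : b ∈ J
        · exact .inr (.inr hbJ)
        by_cases ha' : a ∈ nb A V J
        · exact .inr (.inl (key a b ha' hb hbJ hab))
        by_cases hb' : b ∈ nb A V J
        · exact .inl (.inl (key b a hb' ha haJ (hs _ _ hab)))
        have := hC.2 a ((mem_foldV hz).2 (.inr ⟨ha, haJ, ha'⟩)) b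
          ((mem_foldV hz).2 (.inr ⟨hb, hbJ, hb'⟩)) (foldAdj_of ha' hb' hab)
        tauto
      · have := Finset.card_union_le C J
        omega

/-- Each independent set of the folded graph is compared with one of the original graph. If it
contains z, replace z by N(J), which adds |J| elements and at most the |J| neighbours in J. If z is
a neighbour of it, add J. Otherwise keep it. -/
theorem Good.fold (hs : ∀ a b, A a b → A b a) (hg : Good A V 1)
    (hJ : J ⊆ V) (hi : Indep A J) (h1 : (nb A V J).card = J.card + 1)
    (h2 : Indep A (nb A V J)) (hz : z ∈ nb A V J) :
    Good (foldAdj A (nb A V J) z) (foldV A V J z) 1 := by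
  have hzJ : z ∉ J := fun h => Finset.disjoint_left.1 hi.disjoint h hz
  have hzV : z ∈ foldV A V J z := (mem_foldV hz).2 (.inl ⟨rfl, hzJ⟩)
  intro I hI h0 hII
  -- elements of `I` other than `z` survive unchanged
  have hI' : ∀ w ∈ I, w ≠ z → w ∈ V ∧ w ∉ J ∧ w ∉ nb A V J := fun w hw hwz =>
    ((mem_foldV hz).1 (hI hw)).resolve_left fun h => hwz h.1
  by_cases hzI : z ∈ I
  · -- `I` with `z` replaced by the neighbours of `J`
    have hK : Indep A (I.erase z ∪ nb A V J) := by
      have key : ∀ a ∈ I.erase z, ∀ b ∈ nb A V J, ¬ A b a := fun a ha b hb hab => by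
        rw [Finset.mem_erase] at ha
        exact hII z hzI a ha.2 (foldAdj_of_left hb (hI' a ha.2 ha.1).2.2 hab)
      intro a ha b hb hab
      rcases Finset.mem_union.1 ha with h | h <;> rcases Finset.mem_union.1 hb with h' | h'
      · rw [Finset.mem_erase] at h h'
        exact hII a h.2 b h'.2 (foldAdj_of (hI' a h.2 h.1).2.2 (hI' b h'.2 h'.1).2.2 hab)
      · exact key a h b h' (hs _ _ hab)
      · exact key b h' a h hab
      · exact h2 a h b h' hab
    have hKV : I.erase z ∪ nb A V J ⊆ V := by
      refine Finset.union_subset (fun w hw => ?_) nb_subset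
      rw [Finset.mem_erase] at hw
      exact (hI' w hw.2 hw.1).1
    have h3 := hg _ hKV ⟨z, Finset.mem_union_right _ hz⟩ hK
    rw [Finset.card_union_of_disjoint, Finset.card_erase_of_mem hzI] at h3
    · have h4 : nb A V (I.erase z ∪ nb A V J) ⊆
          nb (foldAdj A (nb A V J) z) (foldV A V J z) I ∪ J := by
        intro w hw
        have hwK := Finset.disjoint_right.1 hK.disjoint hw
        obtain ⟨hwV, i, hi', hA⟩ := mem_nb.1 hw
        rw [Finset.mem_union, or_iff_not_imp_right]
        intro hwJ
        have hwN : w ∉ nb A V J := fun h => hwK (Finset.mem_union_right _ h)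
        refine mem_nb.2 ⟨(mem_foldV hz).2 (.inr ⟨hwV, hwJ, hwN⟩), ?_⟩
        rcases Finset.mem_union.1 hi' with h | h
        · rw [Finset.mem_erase] at h
          exact ⟨i, h.2, foldAdj_of (hI' i h.2 h.1).2.2 hwN hA⟩
        · exact ⟨z, hzI, foldAdj_of_left h hwN hA⟩
      have h5 := (Finset.card_le_card h4).trans (Finset.card_union_le _ _)
      have h6 := h0.card_pos
      omega
    · rw [Finset.disjoint_left]
      intro w hw
      rw [Finset.mem_erase] at hw
      exact (hI' w hw.2 hw.1).2.2
  · have hne : ∀ w ∈ I, w ≠ z := fun w hw h => hzI (h ▸ hw)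
    have hIA : Indep A I := fun a ha b hb hab =>
      hII a ha b hb (foldAdj_of (hI' a ha (hne a ha)).2.2 (hI' b hb (hne b hb)).2.2 hab)
    have hIV : I ⊆ V \ (J ∪ nb A V J) := fun w hw => by
      have := hI' w hw (hne w hw)
      simp only [Finset.mem_sdiff, Finset.mem_union]
      tauto
    by_cases hadj : ∃ i ∈ I, ∃ w ∈ nb A V J, A i w
    -- Surplus 1 of I ∪ J gives I at least |I| neighbours outside J and N(J); the vertex z is one
    -- more.
    · obtain ⟨i, hiI, x, hx, hix⟩ := hadj
      have h3 := hg (I ∪ J) (Finset.union_subset (hIV.trans Finset.sdiff_subset) hJ)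
        (h0.mono Finset.subset_union_left) (indep_union hs hIA hi hIV)
      rw [card_union_rem hIV, card_nb_union_rem hs hIV] at h3
      have h4 : insert z (nb A (V \ (J ∪ nb A V J)) I) ⊆
          nb (foldAdj A (nb A V J) z) (foldV A V J z) I := by
        intro w hw
        rcases Finset.mem_insert.1 hw with rfl | hw
        · exact mem_nb.2 ⟨hzV, i, hiI, foldAdj_symm hs _ _
            (foldAdj_of_left hx (hI' i hiI (hne i hiI)).2.2 (hs _ _ hix))⟩
        · obtain ⟨hw', j, hj, hA⟩ := mem_nb.1 hw
          simp only [Finset.mem_sdiff, Finset.mem_union, not_or] at hw'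
          exact mem_nb.2 ⟨(mem_foldV hz).2 (.inr ⟨hw'.1, hw'.2⟩), j, hj,
            foldAdj_of (hI' j hj (hne j hj)).2.2 hw'.2.2 hA⟩
      have h5 := Finset.card_le_card h4
      rw [Finset.card_insert_of_notMem] at h5
      · omega
      · intro h
        exact (Finset.mem_sdiff.1 (nb_subset h)).2 (Finset.mem_union_right _ hz)
    · have h3 := hg I (hIV.trans Finset.sdiff_subset) h0 hIA
      have h4 : nb A V I ⊆ nb (foldAdj A (nb A V J) z) (foldV A V J z) I := by
        intro w hw
        obtain ⟨hw', j, hj, hA⟩ := mem_nb.1 hw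
        have hwN : w ∉ nb A V J := fun h => hadj ⟨j, hj, w, h, hA⟩
        have hwJ : w ∉ J := fun h => (hI' j hj (hne j hj)).2.2
          (mem_nb.2 ⟨(hI' j hj (hne j hj)).1, w, h, hs _ _ hA⟩)
        exact mem_nb.2 ⟨(mem_foldV hz).2 (.inr ⟨hw', hwJ, hwN⟩), j, hj,
          foldAdj_of (hI' j hj (hne j hj)).2.2 hwN hA⟩
      have := Finset.card_le_card h4
      omega

end fold

end

end VC

/-! ### Critical independent sets by bipartite matching -/

namespace VC

/-- Edges at deleted vertices stay in the edge list; the vertex list decides what is still present.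
-/
def adj (E : List (ℕ × ℕ)) (a b : ℕ) : Bool :=
  E.any fun e => (decide (e.1 = a) && decide (e.2 = b)) || (decide (e.1 = b) && decide (e.2 = a))

abbrev Adj (E : List (ℕ × ℕ)) (a b : ℕ) : Prop := adj E a b = true

theorem adj_iff {E : List (ℕ × ℕ)} {a b : ℕ} : Adj E a b ↔ (a, b) ∈ E ∨ (b, a) ∈ E := by
  simp only [Adj, adj, List.any_eq_true, Prod.exists]
  constructor
  · rintro ⟨x, y, h, h'⟩
    simp at h'
    rcases h' with ⟨rfl, rfl⟩ | ⟨rfl, rfl⟩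
    · exact .inl h
    · exact .inr h
  · rintro (h | h)
    · exact ⟨a, b, h, by simp⟩
    · exact ⟨b, a, h, by simp⟩

theorem Adj.symm {E : List (ℕ × ℕ)} (a b : ℕ) (h : Adj E a b) : Adj E b a := by
  rw [adj_iff] at *; exact h.symm

/-- Neighbours of `I` in the vertex list `V`. -/
def nbr (E : List (ℕ × ℕ)) (V I : List ℕ) : List ℕ := V.filter fun w => I.any fun i => adj E i w

/-- The partner of the right vertex `y` in a matching; earlier entries override later ones. -/
def partner (M : List (ℕ × ℕ)) (y : ℕ) : Option ℕ :=
  (M.find? fun e => decide (e.1 = y)).elim none fun e => some e.2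

/-- The left vertex where an alternating path from `x₀` ends. -/
def pathEnd (x₀ : ℕ) (p : List (ℕ × ℕ)) : ℕ := p.head?.elim x₀ fun e => e.1

/-- Shift the matching along an alternating path; the end of the path becomes unmatched. -/
def shift (M : List (ℕ × ℕ)) (x₀ : ℕ) (p : List (ℕ × ℕ)) : List (ℕ × ℕ) × ℕ :=
  p.foldr (fun e acc => ((e.2, acc.2) :: acc.1, e.1)) (M, x₀)

/-- A reached left vertex (with its path) and an unvisited neighbour of it. -/
def frontier (E : List (ℕ × ℕ)) (V : List ℕ) (x₀ : ℕ) (R : List (List (ℕ × ℕ))) (Y : List ℕ) :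
    Option (List (ℕ × ℕ) × ℕ) :=
  (R.flatMap fun p => (V.filter fun y => adj E (pathEnd x₀ p) y && !decide (y ∈ Y)).map
    fun y => (p, y)).head?

/-- Paths to the reached left vertices, visited right vertices, and the augmented matching once it
is found. -/
abbrev Search : Type := List (List (ℕ × ℕ)) × List ℕ × Option (List (ℕ × ℕ))

def searchStep (E : List (ℕ × ℕ)) (V : List ℕ) (M : List (ℕ × ℕ)) (x₀ : ℕ) (s : Search) : Search :=
  if s.2.2.isSome then s else (frontier E V x₀ s.1 s.2.1).elim s fun c =>
    (partner M c.2).elim (s.1, s.2.1, some ((c.2, (shift M x₀ c.1).2) :: (shift M x₀ c.1).1))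
      fun x => (((x, c.2) :: c.1) :: s.1, c.2 :: s.2.1, none)

/-- The number of rounds suffices because every round that neither stops nor augments visits a new
right vertex. The search starts from the empty path at `x₀` and avoids the right vertices seen in
earlier failed searches. -/
def search (E : List (ℕ × ℕ)) (V : List ℕ) (M : List (ℕ × ℕ)) (Y : List ℕ) (x₀ : ℕ) : Search :=
  (searchStep E V M x₀)^[V.length] ([[]], Y, none)

/-- Try to match `x₀`. The state consists of the matching, the left vertices reached in failed
searches and their neighbours. -/
def matchStep (E : List (ℕ × ℕ)) (V : List ℕ) (x₀ : ℕ)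
    (s : List (ℕ × ℕ) × List ℕ × List ℕ) : List (ℕ × ℕ) × List ℕ × List ℕ :=
  (search E V s.1 s.2.2 x₀).2.2.elim
    (s.1, ((search E V s.1 s.2.2 x₀).1.map (pathEnd x₀)) ++ s.2.1, (search E V s.1 s.2.2 x₀).2.1)
    fun M => (M, s.2)

def matchAll (E : List (ℕ × ℕ)) (V : List ℕ) : List (ℕ × ℕ) × List ℕ × List ℕ :=
  V.foldr (matchStep E V) ([], [], [])

/-- An independent set of maximum deficiency. -/
def crit (E : List (ℕ × ℕ)) (V : List ℕ) : List ℕ :=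
  V.filter fun x => decide (x ∈ (matchAll E V).2.1) && !decide (x ∈ (matchAll E V).2.2)

/-! ### Correctness of the matching procedure -/

section
variable {E : List (ℕ × ℕ)} {V : List ℕ} {M : List (ℕ × ℕ)} {x₀ : ℕ} {Y₀ : List ℕ}

theorem partner_cons {M : List (ℕ × ℕ)} {x y w : ℕ} :
    partner ((y, x) :: M) w = if y = w then some x else partner M w := by
  unfold partner
  by_cases h : y = w <;> simp [h]

/-- `partner` is a function of the right vertex, so only injectivity is required for a matching.
Outdated pairs may remain in the list, as they are overridden. -/
structure Matching (E : List (ℕ × ℕ)) (V : List ℕ) (M : List (ℕ × ℕ)) : Prop where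
  inj : ∀ {y y' x}, partner M y = some x → partner M y' = some x → y = y'
  edge : ∀ {y x}, partner M y = some x → Adj E x y
  mem : ∀ {y x}, partner M y = some x → y ∈ V

theorem Matching.cons {x y : ℕ} (h : Matching E V M) (hx : ∀ w, partner M w ≠ some x)
    (he : Adj E x y) (hy : y ∈ V) : Matching E V ((y, x) :: M) := by
  constructor
  · intro w w' z h1 h2
    rw [partner_cons] at h1 h2
    split_ifs at h1 h2 with h3 h4 h4
    · exact h3.symm.trans h4
    · cases h1; exact absurd h2 (hx _)
    · cases h2; exact absurd h1 (hx _)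
    · exact h.inj h1 h2
  · intro w z h1
    rw [partner_cons] at h1
    split_ifs at h1 with h3
    · cases h1; exact h3 ▸ he
    · exact h.edge h1
  · intro w z h1
    rw [partner_cons] at h1
    split_ifs at h1 with h3
    · exact h3 ▸ hy
    · exact h.mem h1

/-- Alternating paths from `x₀` that avoid `Y₀`. -/
def IsPath (E : List (ℕ × ℕ)) (V : List ℕ) (M : List (ℕ × ℕ)) (x₀ : ℕ) (Y₀ : List ℕ) :
    List (ℕ × ℕ) → Prop
  | [] => True
  | e :: p => IsPath E V M x₀ Y₀ p ∧ partner M e.2 = some e.1 ∧ Adj E (pathEnd x₀ p) e.2 ∧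
      e.2 ∈ V ∧ e.2 ∉ Y₀ ∧ ∀ f ∈ p, f.2 ≠ e.2

/-- Shifting along the path makes `x₀` matched and frees the left end of the path instead; all other
left vertices keep their status. Right vertices off the path keep their partner. -/
theorem shift_spec (hM : Matching E V M) (hx₀ : ∀ y, partner M y ≠ some x₀) :
    ∀ p, IsPath E V M x₀ Y₀ p → (shift M x₀ p).2 = pathEnd x₀ p ∧ Matching E V (shift M x₀ p).1 ∧
      (∀ y, partner (shift M x₀ p).1 y ≠ some (pathEnd x₀ p)) ∧
      (∀ x, (∃ y, partner (shift M x₀ p).1 y = some x) ∨ x = pathEnd x₀ p ↔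
        (∃ y, partner M y = some x) ∨ x = x₀) ∧
      (∀ y, (∀ f ∈ p, f.2 ≠ y) → partner (shift M x₀ p).1 y = partner M y) := by
  intro p
  induction p with
  | nil => exact fun _ => ⟨rfl, hM, hx₀, fun x => Iff.rfl, fun y _ => rfl⟩
  | cons e p ih =>
    rintro ⟨hp, he, hadj, hV, -, hne⟩
    obtain ⟨x, y⟩ := e
    obtain ⟨h1, h2, h3, h4, h5⟩ := ih hp
    simp only at he hadj hV hne
    have h6 : partner (shift M x₀ p).1 y = some x := by rw [h5 y hne, he]
    have hs : shift M x₀ ((x, y) :: p) = ((y, pathEnd x₀ p) :: (shift M x₀ p).1, x) := by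
      rw [← h1]; rfl
    have hxe : x ≠ pathEnd x₀ p := fun h => h3 y (h ▸ h6)
    rw [hs]
    refine ⟨rfl, h2.cons h3 hadj hV, ?_, fun w => ?_, fun w hw => ?_⟩
    · intro w
      change _ ≠ some x
      rw [partner_cons]
      split_ifs with h
      · simpa using hxe.symm
      · exact fun h' => h (h2.inj h6 h')
    · rw [← h4 w]
      change (∃ y', partner _ y' = some w) ∨ w = x ↔ _
      constructor
      · rintro (⟨y', hy'⟩ | rfl)
        · rw [partner_cons] at hy'
          split_ifs at hy' with h
          · cases hy'; exact .inr rfl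
          · exact .inl ⟨y', hy'⟩
        · exact .inl ⟨y, h6⟩
      · rintro (⟨y', hy'⟩ | rfl)
        · by_cases h : y = y'
          · subst h; rw [h6] at hy'; cases hy'; exact .inr rfl
          · exact .inl ⟨y', by rw [partner_cons, if_neg h, hy']⟩
        · exact .inl ⟨y, by rw [partner_cons, if_pos rfl]⟩
    · rw [partner_cons, if_neg (by simpa using hw (x, y) List.mem_cons_self)]
      exact h5 w fun f hf => hw f (List.mem_cons_of_mem _ hf)

/-- What the search guarantees while it has not found an augmenting path. -/
structure SearchInv (E : List (ℕ × ℕ)) (V : List ℕ) (M : List (ℕ × ℕ)) (x₀ : ℕ) (Y₀ : List ℕ)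
    (R : List (List (ℕ × ℕ))) (Y : List ℕ) : Prop where
  path : ∀ p ∈ R, IsPath E V M x₀ Y₀ p
  root : [] ∈ R
  nodup : Y.Nodup
  subset : Y ⊆ V
  sub : Y₀ ⊆ Y
  back : ∀ y ∈ Y, y ∈ Y₀ ∨ ∃ p ∈ R, partner M y = some (pathEnd x₀ p)
  keys : ∀ p ∈ R, ∀ e ∈ p, e.2 ∈ Y

/-- The matching `M'` covers the same left vertices as `M`, and `x₀`. -/
structure Augments (E : List (ℕ × ℕ)) (V : List ℕ) (M : List (ℕ × ℕ)) (x₀ : ℕ) (Y₀ : List ℕ)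
    (M' : List (ℕ × ℕ)) : Prop where
  matching : Matching E V M'
  covers : ∀ x, (∃ y, partner M' y = some x) ↔ (∃ y, partner M y = some x) ∨ x = x₀
  same : ∀ y ∈ Y₀, partner M' y = partner M y

theorem mem_frontier {R : List (List (ℕ × ℕ))} {Y : List ℕ} {c : List (ℕ × ℕ) × ℕ}
    (h : frontier E V x₀ R Y = some c) :
    c.1 ∈ R ∧ c.2 ∈ V ∧ Adj E (pathEnd x₀ c.1) c.2 ∧ c.2 ∉ Y := by
  have := List.mem_of_mem_head? (Option.mem_def.2 h)
  simp only [List.mem_flatMap, List.mem_map, List.mem_filter] at this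
  obtain ⟨p, hp, y, ⟨hy, h2⟩, rfl⟩ := this
  simp at h2
  exact ⟨hp, hy, h2⟩

theorem frontier_none {R : List (List (ℕ × ℕ))} {Y : List ℕ} (h : frontier E V x₀ R Y = none)
    {p : List (ℕ × ℕ)} (hp : p ∈ R) {y : ℕ} (hy : y ∈ V) (ha : Adj E (pathEnd x₀ p) y) :
    y ∈ Y := by
  by_contra hyY
  rw [frontier, List.head?_eq_none_iff] at h
  have : (p, y) ∈ ([] : List (List (ℕ × ℕ) × ℕ)) := by
    rw [← h]
    simp only [List.mem_flatMap, List.mem_map, List.mem_filter]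
    exact ⟨p, hp, y, ⟨hy, by simp [ha, hyY]⟩, rfl⟩
  simp at this

theorem searchStep_spec (hM : Matching E V M) (hx₀ : ∀ y, partner M y ≠ some x₀)
    {s : Search} (h : SearchInv E V M x₀ Y₀ s.1 s.2.1) (h0 : s.2.2 = none) :
    (frontier E V x₀ s.1 s.2.1 = none ∧ searchStep E V M x₀ s = s) ∨
    (∃ M', (searchStep E V M x₀ s).2.2 = some M' ∧ Augments E V M x₀ Y₀ M') ∨
    ((searchStep E V M x₀ s).2.2 = none ∧
      SearchInv E V M x₀ Y₀ (searchStep E V M x₀ s).1 (searchStep E V M x₀ s).2.1 ∧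
      (searchStep E V M x₀ s).2.1.length = s.2.1.length + 1) := by
  obtain ⟨R, Y, o⟩ := s
  simp only at h h0
  subst h0
  cases hf : frontier E V x₀ R Y with
  | none => left; simp [searchStep, hf]
  | some c =>
    right
    obtain ⟨p, y⟩ := c
    obtain ⟨hp, hy, ha, hyY⟩ := mem_frontier hf
    simp only at hp hy ha hyY
    have hne : ∀ f ∈ p, f.2 ≠ y := fun f hf h' => hyY (h' ▸ h.keys p hp f hf)
    have hy0 : y ∉ Y₀ := fun h' => hyY (h.sub h')
    obtain ⟨h1, h2, h3, h4, h5⟩ := shift_spec hM hx₀ p (h.path p hp)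
    cases hpar : partner M y with
    | none =>
      left
      refine ⟨(y, (shift M x₀ p).2) :: (shift M x₀ p).1, ?_, ?_, fun x => ?_, fun w hw => ?_⟩
      · rw [searchStep, if_neg (by simp), hf]
        simp only [Option.elim_some, hpar, Option.elim_none]
      · rw [h1]; exact h2.cons h3 ha hy
      · rw [← h4 x, h1]
        constructor
        · rintro ⟨w, hw⟩
          rw [partner_cons] at hw
          split_ifs at hw with h'
          · cases hw; exact .inr rfl
          · exact .inl ⟨w, hw⟩
        · rintro (⟨w, hw⟩ | rfl)
          · refine ⟨w, ?_⟩
            rw [partner_cons, if_neg, hw]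
            rintro rfl
            rw [h5 y hne, hpar] at hw
            cases hw
          · exact ⟨y, by rw [partner_cons, if_pos rfl]⟩
      · have hwy : y ≠ w := fun h' => hy0 (h' ▸ hw)
        rw [partner_cons, if_neg hwy]
        -- the keys of the path are not in `Y₀`
        have key : ∀ q, IsPath E V M x₀ Y₀ q → ∀ f ∈ q, f.2 ∉ Y₀ := by
          intro q
          induction q with
          | nil => simp
          | cons e q ih =>
            rintro ⟨hq, -, -, -, hq', -⟩ f hf
            rcases List.mem_cons.1 hf with rfl | hf
            · exact hq'
            · exact ih hq f hf
        exact h5 w fun f hf h' => key p (h.path p hp) f hf (h' ▸ hw)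
    | some x =>
      right
      have hst : searchStep E V M x₀ (R, Y, none) = (((x, y) :: p) :: R, y :: Y, none) := by
        rw [searchStep, if_neg (by simp), hf]
        simp only [Option.elim_some, hpar]
      rw [hst]
      refine ⟨rfl, ?_, rfl⟩
      constructor
      · intro q hq
        rcases List.mem_cons.1 hq with rfl | hq
        · exact ⟨h.path p hp, hpar, ha, hy, hy0, hne⟩
        · exact h.path q hq
      · exact List.mem_cons_of_mem _ h.root
      · exact List.nodup_cons.2 ⟨hyY, h.nodup⟩
      · exact List.cons_subset.2 ⟨hy, h.subset⟩
      · exact List.subset_cons_of_subset _ h.sub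
      · intro w hw
        rcases List.mem_cons.1 hw with rfl | hw
        · exact .inr ⟨_, List.mem_cons_self, hpar⟩
        · refine (h.back w hw).imp_right ?_
          rintro ⟨q, hq, h'⟩
          exact ⟨q, List.mem_cons_of_mem _ hq, h'⟩
      · intro q hq e he
        rcases List.mem_cons.1 hq with rfl | hq
        · rcases List.mem_cons.1 he with rfl | he
          · exact List.mem_cons_self
          · exact List.mem_cons_of_mem _ (h.keys p hp e he)
        · exact List.mem_cons_of_mem _ (h.keys q hq e he)

theorem search_spec (hM : Matching E V M) (hx₀ : ∀ y, partner M y ≠ some x₀)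
    (hY : Y₀.Nodup) (hYV : Y₀ ⊆ V) :
    (∃ M', (search E V M Y₀ x₀).2.2 = some M' ∧ Augments E V M x₀ Y₀ M') ∨
    ((search E V M Y₀ x₀).2.2 = none ∧
      SearchInv E V M x₀ Y₀ (search E V M Y₀ x₀).1 (search E V M Y₀ x₀).2.1 ∧
      frontier E V x₀ (search E V M Y₀ x₀).1 (search E V M Y₀ x₀).2.1 = none) := by
  have key : ∀ m, (∃ M', ((searchStep E V M x₀)^[m] ([[]], Y₀, none)).2.2 = some M' ∧
      Augments E V M x₀ Y₀ M') ∨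
      ∃ s, (searchStep E V M x₀)^[m] ([[]], Y₀, none) = s ∧ s.2.2 = none ∧
        SearchInv E V M x₀ Y₀ s.1 s.2.1 ∧
        (frontier E V x₀ s.1 s.2.1 = none ∨ m ≤ s.2.1.length) := by
    intro m
    induction m with
    | zero =>
      right
      refine ⟨_, rfl, rfl, ⟨?_, ?_, hY, hYV, fun _ h => h, fun _ h => .inl h, ?_⟩, .inr (Nat.zero_le _)⟩
      · intro p hp
        obtain rfl : p = [] := by simpa using hp
        trivial
      · simp
      · intro p hp
        obtain rfl : p = [] := by simpa using hp
        simp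
    | succ m ih =>
      rw [Function.iterate_succ_apply']
      rcases ih with ⟨M', h1, h2⟩ | ⟨s, h1, h2, h3, h4⟩
      · left
        refine ⟨M', ?_, h2⟩
        rw [searchStep, if_pos (by rw [h1]; rfl), h1]
      · rw [h1]
        rcases searchStep_spec hM hx₀ h3 h2 with ⟨h5, h6⟩ | h5 | ⟨h5, h6, h7⟩
        · rw [h6]; exact .inr ⟨s, rfl, h2, h3, .inl h5⟩
        · exact .inl h5
        · right
          refine ⟨_, rfl, h5, h6, ?_⟩
          rcases h4 with h4 | h4
          · left
            have : searchStep E V M x₀ s = s := by simp [searchStep, h2, h4]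
            rwa [this]
          · right; omega
  rcases key V.length with h | ⟨s, h1, h2, h3, h4⟩
  · exact .inl h
  · right
    rw [search, h1]
    refine ⟨h2, h3, ?_⟩
    rcases h4 with h4 | h4
    · exact h4
    · cases hf : frontier E V x₀ s.1 s.2.1 with
      | none => rfl
      | some c =>
        obtain ⟨-, hy, -, hyY⟩ := mem_frontier hf
        -- The visited vertices, at least |V| in number, and an unvisited one would be too many
        -- distinct elements of V.
        have := (List.nodup_cons.2 ⟨hyY, h3.nodup⟩).subperm
          (List.cons_subset.2 ⟨hy, h3.subset⟩)
        have := this.length_le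
        simp at this
        omega

/-- Invariant of the matching procedure, after the vertices in `D` have been tried. -/
structure MatchInv (E : List (ℕ × ℕ)) (V D : List ℕ) (s : List (ℕ × ℕ) × List ℕ × List ℕ) :
    Prop where
  matching : Matching E V s.1
  left : ∀ {x y}, partner s.1 y = some x → x ∈ D
  failed : ∀ x ∈ D, (∃ y, partner s.1 y = some x) ∨ x ∈ s.2.1
  nodup : s.2.2.Nodup
  subset : s.2.2 ⊆ V
  back : ∀ y ∈ s.2.2, ∃ x ∈ s.2.1, partner s.1 y = some x
  closed : ∀ x ∈ s.2.1, ∀ y ∈ V, Adj E x y → y ∈ s.2.2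
  mem : s.2.1 ⊆ D

/-- The left vertices reached in failed searches have all their neighbours among the visited right
vertices, and these are matched back to reached ones. Later searches avoid the visited vertices and
leave their partners unchanged, so this structure survives augmentation. -/
theorem matchStep_spec {D : List ℕ} {s : List (ℕ × ℕ) × List ℕ × List ℕ} (h : MatchInv E V D s)
    (hx₀ : x₀ ∉ D) : MatchInv E V (x₀ :: D) (matchStep E V x₀ s) := by
  have hx : ∀ y, partner s.1 y ≠ some x₀ := fun y hy => hx₀ (h.left hy)
  rcases search_spec h.matching hx h.nodup h.subset with ⟨M', h1, h2⟩ | ⟨h1, h2, h3⟩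
  · have : matchStep E V x₀ s = (M', s.2) := by rw [matchStep, h1]; rfl
    rw [this]
    constructor
    · exact h2.matching
    · intro x y hy
      rcases (h2.covers x).1 ⟨y, hy⟩ with ⟨w, hw⟩ | rfl
      · exact List.mem_cons_of_mem _ (h.left hw)
      · exact List.mem_cons_self
    · intro x hx
      change (∃ y, partner M' y = some x) ∨ _
      rw [h2.covers]
      rcases List.mem_cons.1 hx with rfl | hx
      · exact .inl (.inr rfl)
      · exact (h.failed x hx).imp_left .inl
    · exact h.nodup
    · exact h.subset
    · intro y hy
      change ∃ x ∈ s.2.1, partner M' y = some x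
      rw [h2.same y hy]
      exact h.back y hy
    · exact h.closed
    · exact List.subset_cons_of_subset _ h.mem
  · have hst : matchStep E V x₀ s = (s.1, (search E V s.1 s.2.2 x₀).1.map (pathEnd x₀) ++ s.2.1,
        (search E V s.1 s.2.2 x₀).2.1) := by
      rw [matchStep, h1]; rfl
    rw [hst]
    generalize search E V s.1 s.2.2 x₀ = r at h1 h2 h3
    constructor
    · exact h.matching
    · exact fun hy => List.mem_cons_of_mem _ (h.left hy)
    · intro x hx
      rcases List.mem_cons.1 hx with rfl | hx
      · exact .inr (List.mem_append_left _ (List.mem_map.2 ⟨[], h2.root, rfl⟩))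
      · exact (h.failed x hx).imp_right (List.mem_append_right _)
    · exact h2.nodup
    · exact h2.subset
    · intro y hy
      rcases h2.back y hy with hy | ⟨p, hp, h'⟩
      · obtain ⟨x, hx, h'⟩ := h.back y hy
        exact ⟨x, List.mem_append_right _ hx, h'⟩
      · exact ⟨_, List.mem_append_left _ (List.mem_map.2 ⟨p, hp, rfl⟩), h'⟩
    · intro x hx y hy ha
      rcases List.mem_append.1 hx with hx | hx
      · obtain ⟨p, hp, rfl⟩ := List.mem_map.1 hx
        exact frontier_none h3 hp hy ha
      · exact h2.sub (h.closed x hx y hy ha)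
    · intro x hx
      rcases List.mem_append.1 hx with hx | hx
      · obtain ⟨p, hp, rfl⟩ := List.mem_map.1 hx
        have := h2.path p hp
        cases p with
        | nil => exact List.mem_cons_self
        | cons e p => exact List.mem_cons_of_mem _ (h.left this.2.1)
      · exact List.mem_cons_of_mem _ (h.mem hx)

theorem matchAll_spec (hV : V.Nodup) : MatchInv E V V (matchAll E V) := by
  have key : ∀ D : List ℕ, D.Nodup → MatchInv E V D (D.foldr (matchStep E V) ([], [], [])) := by
    intro D
    induction D with
    | nil =>
      intro _
      constructor <;> simp [partner]
      constructor <;> simp [partner]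
    | cons x D ih =>
      intro hD
      rw [List.nodup_cons] at hD
      exact matchStep_spec (ih hD.2) hD.1
  exact key V hV

theorem crit_sublist : (crit E V).Sublist V := List.filter_sublist

/-- König's theorem for the bipartite double cover. Let F be the unmatched left vertices, Z the
reached left vertices and Y their neighbours. Every independent X has deficiency at most |X ∩ F| ≤
|F|. For I = Z \ Y closure gives N(I) ⊆ Y \ Z, so its deficiency is at least |Z| − |Y| ≥ |F|. -/
theorem isCrit_crit (hV : V.Nodup) : IsCrit (Adj E) V.toFinset (crit E V).toFinset := by
  have h := matchAll_spec (E := E) hV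
  unfold crit
  generalize matchAll E V = s at h
  obtain ⟨M, Z, Y⟩ := s
  have hback := h.back
  have hclosed := h.closed
  have hfailed := h.failed
  have hmatch := h.matching
  simp only at hback hclosed hfailed hmatch
  have memI : ∀ x, x ∈ (V.filter fun x => decide (x ∈ Z) && !decide (x ∈ Y)).toFinset ↔
      x ∈ Z ∧ x ∉ Y := by
    intro x
    have hZ : x ∈ Z → x ∈ V := fun hx => h.mem hx
    simp; tauto
  generalize (V.filter fun x => decide (x ∈ Z) && !decide (x ∈ Y)).toFinset = I at memI
  have hi : Indep (Adj E) I := by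
    intro a ha b hb hab
    rw [memI] at ha hb
    exact hb.2 (hclosed a ha.1 b (h.mem hb.1) hab)
  have hIV : I ⊆ V.toFinset := fun x hx => List.mem_toFinset.2 (h.mem ((memI x).1 hx).1)
  refine ⟨hIV, hi, fun X hX hXi => ?_⟩
  classical
  let F := V.toFinset.filter fun x => ∀ y, partner M y ≠ some x
  have hF : ∀ x, x ∈ F ↔ x ∈ V ∧ ∀ y, partner M y ≠ some x := by simp [F]
  have hFZ : F ⊆ Z.toFinset := fun x hx => by
    rw [hF] at hx
    exact List.mem_toFinset.2 ((hfailed x hx.1).resolve_left fun ⟨y, hy⟩ => hx.2 y hy)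
  -- the vertices of `X` that are matched inject into the neighbourhood of `X`
  have hX1 : (X \ F).card ≤ (nb (Adj E) V.toFinset X).card := by
    have hp : ∀ x ∈ X \ F, ∃ y, partner M y = some x := fun x hx => by
      rw [Finset.mem_sdiff, hF] at hx
      have := hx.2
      push Not at this
      exact this (List.mem_toFinset.1 (hX hx.1))
    choose! f hf using hp
    refine Finset.card_le_card_of_injOn f (fun x hx => ?_) fun x hx x' hx' hxx' => ?_
    · have := hf x hx
      exact mem_nb.2 ⟨List.mem_toFinset.2 (hmatch.mem this), x, (Finset.mem_sdiff.1 hx).1,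
        hmatch.edge this⟩
    · have h1 := hf x hx
      have h2 := hf x' hx'
      rw [hxx', h2] at h1
      exact (Option.some.inj h1).symm
  -- the neighbours of `Z` inject into the matched vertices of `Z`
  have hY1 : Y.toFinset.card ≤ (Z.toFinset \ F).card := by
    have hp : ∀ y ∈ Y.toFinset, ∃ x, x ∈ Z ∧ partner M y = some x := fun y hy =>
      hback y (List.mem_toFinset.1 hy)
    choose! f hf using hp
    refine Finset.card_le_card_of_injOn f (fun y hy => ?_) fun y hy y' hy' hyy' => ?_
    · rw [Finset.mem_coe, Finset.mem_sdiff, List.mem_toFinset, hF]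
      exact ⟨(hf y hy).1, fun h' => h'.2 y (hf y hy).2⟩
    · have h1 := (hf y hy).2
      have h2 := (hf y' hy').2
      rw [hyy'] at h1
      exact hmatch.inj h1 h2
  have h1 : nb (Adj E) V.toFinset I ⊆ Y.toFinset \ Z.toFinset := by
    intro w hw
    obtain ⟨hwV, i, hiI, hA⟩ := mem_nb.1 hw
    rw [List.mem_toFinset] at hwV
    rw [memI] at hiI
    rw [Finset.mem_sdiff, List.mem_toFinset, List.mem_toFinset]
    exact ⟨hclosed i hiI.1 w hwV hA,
      fun hwZ => hiI.2 (hclosed w hwZ i (h.mem hiI.1) (Adj.symm _ _ hA))⟩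
  have h2 : I = Z.toFinset \ Y.toFinset := by
    ext x; simp [memI]
  have h3 := Finset.card_le_card h1
  have h4 := Finset.card_sdiff_add_card_inter Y.toFinset Z.toFinset
  have h5 := Finset.card_sdiff_add_card_inter Z.toFinset Y.toFinset
  have h6 := Finset.card_sdiff_add_card_eq_card hFZ
  have h7 := Finset.card_sdiff_add_card_inter X F
  have h8 := Finset.card_le_card (Finset.inter_subset_right (s₁ := X) (s₂ := F))
  rw [Finset.inter_comm] at h4
  rw [h2] at h3 ⊢
  omega

end

end VC

/-! ### The branching algorithm -/

namespace VC

/-- Edges, remaining vertices, number of vertices put into the cover, bound for the cover. -/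
abbrev St : Type := List (ℕ × ℕ) × List ℕ × ℕ × ℕ

/-- Remove `J` and put its neighbours into the cover. -/
def remSt (s : St) (J : List ℕ) : St :=
  (s.1, s.2.1.filter (fun w => !decide (w ∈ J) && !decide (w ∈ nbr s.1 s.2.1 J)),
    s.2.2.1 + (nbr s.1 s.2.1 J).length, s.2.2.2)

/-- Put `J` into the cover. -/
def putSt (s : St) (J : List ℕ) : St :=
  (s.1, s.2.1.filter (fun w => !decide (w ∈ J)), s.2.2.1 + J.length, s.2.2.2)

/-- The folded vertex reuses the name of a neighbour, so no fresh names arise. The default is taken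
only if `J` has no neighbours. -/
def foldVertex (s : St) (J : List ℕ) : ℕ := (nbr s.1 s.2.1 J).head?.elim 0 fun z => z

def rename (N : List ℕ) (z x : ℕ) : ℕ := if decide (x ∈ N) then z else x

/-- Contract `J` and its neighbours to one vertex. -/
def foldSt (s : St) (J : List ℕ) : St :=
  (s.1.map fun e => (rename (nbr s.1 s.2.1 J) (foldVertex s J) e.1,
      rename (nbr s.1 s.2.1 J) (foldVertex s J) e.2),
    s.2.1.filter (fun w => !decide (w ∈ J) &&
      (decide (w = foldVertex s J) || !decide (w ∈ nbr s.1 s.2.1 J))),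
    s.2.2.1 + J.length, s.2.2.2)

/-- An independent set of minimum surplus among those that contain `S`. -/
def extend (E : List (ℕ × ℕ)) (V S : List ℕ) : List ℕ :=
  crit E (V.filter fun w => !decide (w ∈ S) && !decide (w ∈ nbr E V S)) ++ S

/-- Among the sets `Js`, one of surplus at most `t`. -/
def lowSurplus (E : List (ℕ × ℕ)) (V : List ℕ) (Js : List (List ℕ)) (t : ℕ) : Option (List ℕ) :=
  Js.find? fun J => decide ((nbr E V J).length ≤ J.length + t)

def singles (E : List (ℕ × ℕ)) (V : List ℕ) : List (List ℕ) := V.map fun v => extend E V [v]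

def pairs (E : List (ℕ × ℕ)) (V : List ℕ) : List (List ℕ) :=
  V.flatMap fun a => (V.filter fun b => !decide (a = b) && !adj E a b).map
    fun b => extend E V [a, b]

def hasEdge (E : List (ℕ × ℕ)) (N : List ℕ) : Bool := N.any fun a => N.any fun b => adj E a b

/-- One reduction step. -/
def red (s : St) : Option St :=
  -- The order matters: the rule for surplus 0 is justified when no surplus is negative, and the two
  -- rules for surplus 1 when every surplus is at least 1.
  if (crit s.1 s.2.1).isEmpty then
    (lowSurplus s.1 s.2.1 (singles s.1 s.2.1) 0).elim
      ((lowSurplus s.1 s.2.1 (singles s.1 s.2.1) 1).elim none fun J =>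
        some (if hasEdge s.1 (nbr s.1 s.2.1 J) then remSt s J else foldSt s J))
      fun J => some (remSt s J)
  else some (remSt s (crit s.1 s.2.1))

def redOrSelf (s : St) : St := (red s).elim s fun t => t

/-- Every effective reduction removes a vertex, so as many rounds as there are vertices reach a
fixed point. -/
def norm (s : St) : St := redOrSelf^[s.2.1.length] s

def deg (E : List (ℕ × ℕ)) (V : List ℕ) (v : ℕ) : ℕ := (nbr E V [v]).length

/-- The vertex to branch on. -/
def pick (E : List (ℕ × ℕ)) (V : List ℕ) : Option ℕ :=
  (V.find? fun v => decide (5 ≤ deg E V v)).elim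
    ((V.find? fun v => decide (4 ≤ deg E V v) &&
        (nbr E V [v]).any fun w => decide (deg E V w ≤ 3)).elim
      ((V.find? fun v => decide (deg E V v ≤ 3)).elim V.head? some) some) some

def branch (s : St) : Option (St × St) :=
  (lowSurplus s.1 s.2.1 (pairs s.1 s.2.1) 2).elim
    ((pick s.1 s.2.1).elim none fun v => some (remSt s [v], putSt s [v]))
    fun J => some (remSt s J, putSt s J)

/-- Subinstances of a reduced instance, or its answer. -/
def decideOrBranch (t : St) : Option (St × St) × Bool :=
  if decide (t.2.1.length + (t.2.2.1 + t.2.2.1) ≤ t.2.2.2 + t.2.2.2) then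
    (if t.2.1.isEmpty then (none, true) else (branch t, false))
  else (none, false)

def step (s : St) : Option (St × St) × Bool := decideOrBranch (norm s)

/-! ### Properties of the operations on states -/

/-- A vertex put into the cover lowers the measure by 3 − 1 = 2, and a vertex discarded outside the
cover raises it by 1. -/
def psi (s : St) : ℤ := 3 * ((s.2.2.2 : ℤ) - s.2.2.1) - s.2.1.length

def sol (s : St) : Prop := Sol (Adj s.1) s.2.1.toFinset ((s.2.2.2 : ℤ) - s.2.2.1)

def good (s : St) (t : ℤ) : Prop := Good (Adj s.1) s.2.1.toFinset t

structure WF (s : St) : Prop where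
  nodup : s.2.1.Nodup
  loopless : ∀ a ∈ s.2.1, ¬ Adj s.1 a a

section
variable {s : St} {E : List (ℕ × ℕ)} {V J : List ℕ}

theorem nbr_toFinset : (nbr E V J).toFinset = nb (Adj E) V.toFinset J.toFinset := by
  ext w; simp [nbr, mem_nb]

theorem nbr_length (hV : V.Nodup) :
    (nbr E V J).length = (nb (Adj E) V.toFinset J.toFinset).card := by
  rw [← nbr_toFinset, List.toFinset_card_of_nodup (l := nbr E V J) (hV.filter _)]

theorem remSt_toFinset : (remSt s J).2.1.toFinset =
    s.2.1.toFinset \ (J.toFinset ∪ nb (Adj s.1) s.2.1.toFinset J.toFinset) := by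
  rw [← nbr_toFinset]
  ext w; simp [remSt]

theorem putSt_toFinset : (putSt s J).2.1.toFinset = s.2.1.toFinset \ J.toFinset := by
  ext w; simp [putSt]

theorem WF.filter {p : ℕ → Bool} {u k : ℕ} (h : WF s) : WF (s.1, s.2.1.filter p, u, k) :=
  ⟨h.nodup.filter _, fun a ha => h.loopless a (List.mem_filter.1 ha).1⟩

theorem WF.rem (h : WF s) : WF (remSt s J) := h.filter

theorem WF.put (h : WF s) : WF (putSt s J) := h.filter

theorem WF.loopless' (h : WF s) : ∀ a ∈ s.2.1.toFinset, ¬ Adj s.1 a a :=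
  fun a ha => h.loopless a (List.mem_toFinset.1 ha)

theorem length_rem (h : WF s) (hJ : J.toFinset ⊆ s.2.1.toFinset) (hi : Indep (Adj s.1) J.toFinset) :
    (remSt s J).2.1.length + J.toFinset.card + (nb (Adj s.1) s.2.1.toFinset J.toFinset).card =
      s.2.1.length := by
  rw [← List.toFinset_card_of_nodup h.nodup, ← List.toFinset_card_of_nodup h.rem.nodup,
    remSt_toFinset, card_rem hJ hi]

theorem psi_rem (h : WF s) (hJ : J.toFinset ⊆ s.2.1.toFinset) (hi : Indep (Adj s.1) J.toFinset) :
    psi (remSt s J) = psi s - 2 * (nb (Adj s.1) s.2.1.toFinset J.toFinset).card +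
      J.toFinset.card := by
  have h1 := length_rem h hJ hi
  have h2 : (remSt s J).2.2 = (s.2.2.1 + (nb (Adj s.1) s.2.1.toFinset J.toFinset).card, s.2.2.2) := by
    rw [← nbr_length h.nodup]; rfl
  unfold psi
  rw [h2]
  push_cast
  omega

theorem sol_rem (h : WF s) : sol (remSt s J) ↔
    Sol (Adj s.1) (s.2.1.toFinset \ (J.toFinset ∪ nb (Adj s.1) s.2.1.toFinset J.toFinset))
      ((s.2.2.2 : ℤ) - s.2.2.1 - (nb (Adj s.1) s.2.1.toFinset J.toFinset).card) := by
  rw [sol, remSt_toFinset, ← nbr_length h.nodup]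
  unfold remSt
  push_cast
  rw [sub_sub]

theorem length_put (h : WF s) (hJ : J.toFinset ⊆ s.2.1.toFinset) (hJn : J.Nodup) :
    (putSt s J).2.1.length + J.length = s.2.1.length := by
  rw [← List.toFinset_card_of_nodup h.nodup, ← List.toFinset_card_of_nodup h.put.nodup,
    putSt_toFinset, ← List.toFinset_card_of_nodup hJn, Finset.card_sdiff_add_card_eq_card hJ]

theorem psi_put (h : WF s) (hJ : J.toFinset ⊆ s.2.1.toFinset) (hJn : J.Nodup) :
    psi (putSt s J) = psi s - 2 * J.length := by
  have h1 := length_put h hJ hJn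
  have h2 : (putSt s J).2.2 = (s.2.2.1 + J.length, s.2.2.2) := rfl
  unfold psi
  rw [h2]
  push_cast
  omega

theorem sol_put (hJn : J.Nodup) : sol (putSt s J) ↔
    Sol (Adj s.1) (s.2.1.toFinset \ J.toFinset) ((s.2.2.2 : ℤ) - s.2.2.1 - J.toFinset.card) := by
  rw [sol, putSt_toFinset, List.toFinset_card_of_nodup hJn]
  unfold putSt
  push_cast
  rw [sub_sub]

theorem foldVertex_mem (h : (nb (Adj s.1) s.2.1.toFinset J.toFinset).Nonempty) :
    foldVertex s J ∈ nb (Adj s.1) s.2.1.toFinset J.toFinset := by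
  rw [← nbr_toFinset, List.mem_toFinset] at *
  unfold foldVertex
  cases hN : nbr s.1 s.2.1 J with
  | nil => simp [hN] at h
  | cons z l => simp

theorem rename_eq {N : List ℕ} {z x : ℕ} : rename N z x = ren N.toFinset z x := by
  simp [rename, ren]

theorem foldSt_adj : Adj (foldSt s J).1 =
    foldAdj (Adj s.1) (nb (Adj s.1) s.2.1.toFinset J.toFinset) (foldVertex s J) := by
  funext a b
  rw [← nbr_toFinset, eq_iff_iff, adj_iff]
  simp only [foldSt, foldAdj, List.mem_map, rename_eq, Prod.mk.injEq, adj_iff, Prod.exists]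
  constructor
  · rintro (⟨x, y, h, h1, h2⟩ | ⟨x, y, h, h1, h2⟩)
    · exact ⟨x, y, .inl h, h1, h2⟩
    · exact ⟨y, x, .inr h, h2, h1⟩
  · rintro ⟨x, y, h | h, h1, h2⟩
    · exact .inl ⟨x, y, h, h1, h2⟩
    · exact .inr ⟨y, x, h, h2, h1⟩

theorem foldSt_toFinset : (foldSt s J).2.1.toFinset =
    foldV (Adj s.1) s.2.1.toFinset J.toFinset (foldVertex s J) := by
  ext w
  simp only [foldV, ← nbr_toFinset]
  simp [foldSt]
  tauto

theorem WF.fold (h : WF s) (hN : (nb (Adj s.1) s.2.1.toFinset J.toFinset).Nonempty)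
    (hi : Indep (Adj s.1) (nb (Adj s.1) s.2.1.toFinset J.toFinset)) : WF (foldSt s J) := by
  refine ⟨h.nodup.filter _, fun a ha => ?_⟩
  rw [foldSt_adj]
  refine foldAdj_loopless hi (foldVertex_mem hN) h.loopless' a ?_
  rw [← foldSt_toFinset]
  exact List.mem_toFinset.2 ha

/-! ### Reductions -/

theorem extend_spec (hV : V.Nodup) {S : List ℕ} (hS : S ⊆ V)
    (hSn : S.Nodup) (hi : Indep (Adj E) S.toFinset) :
    (extend E V S).Nodup ∧ (extend E V S).toFinset ⊆ V.toFinset ∧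
      S.toFinset ⊆ (extend E V S).toFinset ∧ Indep (Adj E) (extend E V S).toFinset ∧
      ∀ K ⊆ V.toFinset, Indep (Adj E) K → S.toFinset ⊆ K →
        K.card + (nbr E V (extend E V S)).length ≤
          (nb (Adj E) V.toFinset K).card + (extend E V S).length := by
  let W := V.filter fun w => !decide (w ∈ S) && !decide (w ∈ nbr E V S)
  have hW : W.toFinset = V.toFinset \ (S.toFinset ∪ nb (Adj E) V.toFinset S.toFinset) := by
    rw [← nbr_toFinset]; ext w; simp [W]
  have hc : IsCrit (Adj E) (V.toFinset \ (S.toFinset ∪ nb (Adj E) V.toFinset S.toFinset))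
      (crit E W).toFinset := hW ▸ isCrit_crit (hV.filter _)
  have hn : (extend E V S).Nodup := by
    refine List.Nodup.append ((hV.filter _).sublist crit_sublist) hSn fun a ha ha' => ?_
    have := crit_sublist.subset ha
    simp [ha'] at this
  have hJ : (extend E V S).toFinset = (crit E W).toFinset ∪ S.toFinset := List.toFinset_append
  refine ⟨hn, ?_, ?_, ?_, fun K hK hKi hSK => ?_⟩
  · rw [hJ]
    refine Finset.union_subset (hc.1.trans Finset.sdiff_subset) fun a ha => ?_
    exact List.mem_toFinset.2 (hS (List.mem_toFinset.1 ha))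
  · rw [hJ]; exact Finset.subset_union_right
  · rw [hJ]; exact indep_union Adj.symm hc.2.1 hi hc.1
  · rw [nbr_length hV, ← List.toFinset_card_of_nodup hn, hJ]
    exact hc.extend Adj.symm hK hKi hSK

theorem lowSurplus_some {Js : List (List ℕ)} {t : ℕ} (h : lowSurplus E V Js t = some J) :
    J ∈ Js ∧ (nbr E V J).length ≤ J.length + t :=
  ⟨List.mem_of_find?_eq_some h, by simpa using List.find?_some h⟩

theorem lowSurplus_none {Js : List (List ℕ)} {t : ℕ} (h : lowSurplus E V Js t = none)
    (hJ : J ∈ Js) : J.length + t < (nbr E V J).length := by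
  simpa using List.find?_eq_none.1 h J hJ

/-- A nonempty independent set contains some v, and `extend` at v has minimum surplus among all sets
that contain v. -/
theorem good_of_singles (hV : V.Nodup) (hl : ∀ a ∈ V, ¬ Adj E a a) {t : ℕ}
    (h : lowSurplus E V (singles E V) t = none) : Good (Adj E) V.toFinset (t + 1) := by
  rintro K hK ⟨v, hv⟩ hi
  have hvV := List.mem_toFinset.1 (hK hv)
  obtain ⟨-, -, -, -, h5⟩ := extend_spec (E := E) hV (S := [v]) (by simpa using hvV) (by simp)
    (by simpa using indep_singleton (hl v hvV))
  have h6 := h5 K hK hi (by simpa using hv)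
  have h7 := lowSurplus_none h (List.mem_map.2 ⟨v, hvV, rfl⟩)
  omega

theorem mem_singles (hV : V.Nodup) (hl : ∀ a ∈ V, ¬ Adj E a a) (hJ : J ∈ singles E V) :
    J.Nodup ∧ J.toFinset ⊆ V.toFinset ∧ J.toFinset.Nonempty ∧ Indep (Adj E) J.toFinset := by
  obtain ⟨v, hv, rfl⟩ := List.mem_map.1 hJ
  obtain ⟨h1, h2, h3, h4, -⟩ := extend_spec (E := E) hV (S := [v]) (by simpa using hv) (by simp)
    (by simpa using indep_singleton (hl v hv))
  exact ⟨h1, h2, ⟨v, h3 (by simp)⟩, h4⟩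

theorem hasEdge_iff {N : List ℕ} : hasEdge E N = true ↔ ¬ Indep (Adj E) N.toFinset := by
  simp [hasEdge, Indep]

theorem red_none (h : WF s) (hr : red s = none) : good s 2 := by
  unfold red at hr
  split_ifs at hr with h1
  cases h2 : lowSurplus s.1 s.2.1 (singles s.1 s.2.1) 0 with
  | some J => simp [h2] at hr
  | none =>
    cases h3 : lowSurplus s.1 s.2.1 (singles s.1 s.2.1) 1 with
    | some J => simp [h2, h3] at hr
    | none => exact good_of_singles h.nodup h.loopless h3

/-- The effect of one reduction step. -/
structure RedSpec (s s' : St) : Prop where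
  wf : WF s'
  iff : sol s ↔ sol s'
  lt : s'.2.1.length < s.2.1.length
  good_zero : good s' 0
  not_good : ¬ good s 2
  le : ∀ d : ℕ, good s (-d) → psi s' ≤ psi s + d
  lt_psi : good s 0 → psi s' + 1 ≤ psi s
  of_edge : good s 1 → (∀ J ⊆ s.2.1.toFinset, J.Nonempty → Indep (Adj s.1) J →
    (nb (Adj s.1) s.2.1.toFinset J).card ≤ J.card + 1 →
    ¬ Indep (Adj s.1) (nb (Adj s.1) s.2.1.toFinset J)) → psi s' + 3 ≤ psi s
  root : (∀ I ⊆ s.2.1.toFinset, Indep (Adj s.1) I →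
    I.card ≤ 2 * (nb (Adj s.1) s.2.1.toFinset I).card) → psi s' ≤ psi s

/-- The measure changes by |I| − 2|N(I)|. This is at most d if the surplus is at least −d, and at
most 0 under the edge-counting bound |I| ≤ 2|N(I)| at the root. -/
theorem redSpec_crit (h : WF s) (h1 : (crit s.1 s.2.1).isEmpty = false) :
    RedSpec s (remSt s (crit s.1 s.2.1)) := by
  have hc := isCrit_crit (E := s.1) h.nodup
  have hn : (crit s.1 s.2.1).toFinset.Nonempty := by
    rw [List.toFinset_nonempty_iff]; simpa using h1
  generalize crit s.1 s.2.1 = I at *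
  have hpsi := psi_rem h hc.1 hc.2.1
  have hlen := length_rem h hc.1 hc.2.1
  have hpos := hn.card_pos
  have hle := hc.2.2 ∅ (by simp) indep_empty
  simp only [Finset.card_empty, nb_empty] at hle
  refine ⟨h.rem, ?_, by omega, ?_, ?_, ?_, ?_, ?_, ?_⟩
  · rw [sol_rem h]
    exact sol_rem_iff Adj.symm hc.1 hc.2.1 fun X hX => by
      have := hc.2.2 X (hX.trans hc.1) (hc.2.1.mono hX); omega
  · rw [good, remSt_toFinset]; exact hc.good Adj.symm
  · intro hg
    have := hg _ hc.1 hn hc.2.1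
    omega
  · intro d hd
    have := hd _ hc.1 hn hc.2.1
    omega
  · intro hg
    have := hg _ hc.1 hn hc.2.1
    omega
  · intro hg
    have := hg _ hc.1 hn hc.2.1
    omega
  · intro hr
    have := hr _ hc.1 hc.2.1
    omega

theorem good_zero_of_crit (h : WF s) (h1 : (crit s.1 s.2.1).isEmpty = true) : good s 0 := by
  have hc := isCrit_crit (E := s.1) h.nodup
  rw [List.isEmpty_iff] at h1
  rw [h1] at hc
  intro X hX _ hXi
  have := hc.2.2 X hX hXi
  simp at this
  omega

theorem redSpec_zero (h : WF s) (hg : good s 0) (hJV : J.toFinset ⊆ s.2.1.toFinset)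
    (hn : J.toFinset.Nonempty) (hi : Indep (Adj s.1) J.toFinset)
    (hle : (nb (Adj s.1) s.2.1.toFinset J.toFinset).card ≤ J.toFinset.card) :
    RedSpec s (remSt s J) := by
  have hpsi := psi_rem h hJV hi
  have hlen := length_rem h hJV hi
  have hpos := hn.card_pos
  have h0 := hg _ hJV hn hi
  have hp : psi (remSt s J) + 1 ≤ psi s := by omega
  refine ⟨h.rem, ?_, by omega, ?_, ?_, fun d _ => by omega, fun _ => hp, ?_, fun _ => by omega⟩
  · rw [sol_rem h]
    refine sol_rem_iff Adj.symm hJV hi fun X hX => ?_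
    rcases X.eq_empty_or_nonempty with rfl | hX0
    · simp; omega
    · have := hg X (hX.trans hJV) hX0 (hi.mono hX)
      omega
  · rw [good, remSt_toFinset]
    exact (good_rem (t := 0) Adj.symm hJV hi fun K hK hKi _ hlt =>
      hg K hK (Finset.card_pos.1 (by omega)) hKi).mono (by omega)
  · intro hg
    have := hg _ hJV hn hi
    omega
  · intro hg
    have := hg _ hJV hn hi
    omega

/-- The surplus is exactly 1, so the measure drops by 2(|J| + 1) − |J| = |J| + 2, at least 3. -/
theorem redSpec_edge (h : WF s) (hg : good s 1) (hJV : J.toFinset ⊆ s.2.1.toFinset)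
    (hn : J.toFinset.Nonempty) (hi : Indep (Adj s.1) J.toFinset)
    (hle : (nb (Adj s.1) s.2.1.toFinset J.toFinset).card ≤ J.toFinset.card + 1)
    (he : ¬ Indep (Adj s.1) (nb (Adj s.1) s.2.1.toFinset J.toFinset)) :
    RedSpec s (remSt s J) := by
  have hpsi := psi_rem h hJV hi
  have hlen := length_rem h hJV hi
  have hpos := hn.card_pos
  have h0 := hg _ hJV hn hi
  have hp : psi (remSt s J) + 3 ≤ psi s := by omega
  refine ⟨h.rem, ?_, by omega, ?_, ?_, fun d _ => by omega, fun _ => by omega, fun _ _ => hp,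
    fun _ => by omega⟩
  · rw [sol_rem h]
    exact sol_rem_of_edge Adj.symm hg hJV hi hle he
  · rw [good, remSt_toFinset]
    exact (good_rem (t := 1) Adj.symm hJV hi fun K hK hKi _ hlt =>
      hg K hK (Finset.card_pos.1 (by omega)) hKi).mono (by omega)
  · intro hg
    have := hg _ hJV hn hi
    omega

/-- The budget drops by |J| and the number of vertices by 2|J|, so the measure drops by |J|, at
least 1. -/
theorem redSpec_fold (h : WF s) (hg : good s 1) (hJn : J.Nodup) (hJV : J.toFinset ⊆ s.2.1.toFinset)
    (hn : J.toFinset.Nonempty) (hi : Indep (Adj s.1) J.toFinset)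
    (hle : (nb (Adj s.1) s.2.1.toFinset J.toFinset).card ≤ J.toFinset.card + 1)
    (he : Indep (Adj s.1) (nb (Adj s.1) s.2.1.toFinset J.toFinset)) :
    RedSpec s (foldSt s J) := by
  have hpos := hn.card_pos
  have h0 := hg _ hJV hn hi
  have h1 : (nb (Adj s.1) s.2.1.toFinset J.toFinset).card = J.toFinset.card + 1 := by omega
  have hN : (nb (Adj s.1) s.2.1.toFinset J.toFinset).Nonempty := Finset.card_pos.1 (by omega)
  have hz := foldVertex_mem hN
  have hwf := h.fold hN he
  have hlen := card_foldV hJV hi hz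
  rw [← foldSt_toFinset, List.toFinset_card_of_nodup h.nodup,
    List.toFinset_card_of_nodup hwf.nodup] at hlen
  have hJl := List.toFinset_card_of_nodup hJn
  have hp : psi (foldSt s J) + 1 ≤ psi s := by
    have h2 : (foldSt s J).2.2 = (s.2.2.1 + J.length, s.2.2.2) := rfl
    unfold psi
    rw [h2]
    push_cast
    omega
  refine ⟨hwf, ?_, by omega, ?_, ?_, fun d _ => by omega, fun _ => hp, fun _ hno => ?_,
    fun _ => by omega⟩
  · rw [sol, sol_fold_iff Adj.symm hg hJV hi h1 he hz, sol, foldSt_adj, foldSt_toFinset, hJl]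
    have h2 : (foldSt s J).2.2 = (s.2.2.1 + J.length, s.2.2.2) := rfl
    rw [h2]
    push_cast
    rw [sub_sub]
  · rw [good, foldSt_adj, foldSt_toFinset]
    exact (hg.fold Adj.symm hJV hi h1 he hz).mono (by omega)
  · intro hg
    have := hg _ hJV hn hi
    omega
  · exact absurd he (hno _ hJV hn hi hle)

theorem red_some (h : WF s) {s' : St} (hr : red s = some s') : RedSpec s s' := by
  unfold red at hr
  split_ifs at hr with h1
  · have hg0 := good_zero_of_crit h h1
    cases h2 : lowSurplus s.1 s.2.1 (singles s.1 s.2.1) 0 with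
    | some J =>
      simp only [h2, Option.elim_some, Option.some.injEq] at hr
      subst hr
      obtain ⟨hJ, hle⟩ := lowSurplus_some h2
      obtain ⟨hJn, hJV, hJ0, hi⟩ := mem_singles h.nodup h.loopless hJ
      rw [nbr_length h.nodup, ← List.toFinset_card_of_nodup hJn] at hle
      exact redSpec_zero h hg0 hJV hJ0 hi hle
    | none =>
      cases h3 : lowSurplus s.1 s.2.1 (singles s.1 s.2.1) 1 with
      | none => simp [h2, h3] at hr
      | some J =>
        simp only [h2, h3, Option.elim_some, Option.elim_none, Option.some.injEq] at hr
        obtain ⟨hJ, hle⟩ := lowSurplus_some h3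
        obtain ⟨hJn, hJV, hJ0, hi⟩ := mem_singles h.nodup h.loopless hJ
        rw [nbr_length h.nodup, ← List.toFinset_card_of_nodup hJn] at hle
        have hg1 : good s 1 := by
          have : good s ((0 : ℕ) + 1) := good_of_singles h.nodup h.loopless h2
          simpa only [Nat.cast_zero, zero_add] using this
        split_ifs at hr with h4 <;> subst hr <;> rw [hasEdge_iff, nbr_toFinset] at h4
        · exact redSpec_edge h hg1 hJV hJ0 hi hle h4
        · exact redSpec_fold h hg1 hJn hJV hJ0 hi hle (not_not.1 h4)
  · simp only [Option.some.injEq] at hr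
    subst hr
    exact redSpec_crit h (by simpa using h1)

/-- The effect of exhaustive reduction. -/
structure NormSpec (s t : St) : Prop where
  wf : WF t
  iff : sol s ↔ sol t
  length_le : t.2.1.length ≤ s.2.1.length
  good : good t 2
  eq : VC.good s 2 → t = s
  le : ∀ d : ℕ, VC.good s (-d) → psi t ≤ psi s + d
  lt_psi : VC.good s 0 → ¬ VC.good s 2 → psi t + 1 ≤ psi s
  of_edge : VC.good s 1 → ¬ VC.good s 2 → (∀ J ⊆ s.2.1.toFinset, J.Nonempty → Indep (Adj s.1) J →
    (nb (Adj s.1) s.2.1.toFinset J).card ≤ J.card + 1 →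
    ¬ Indep (Adj s.1) (nb (Adj s.1) s.2.1.toFinset J)) → psi t + 3 ≤ psi s
  root : (∀ I ⊆ s.2.1.toFinset, Indep (Adj s.1) I →
    I.card ≤ 2 * (nb (Adj s.1) s.2.1.toFinset I).card) → psi t ≤ psi s

theorem norm_spec (h : WF s) : NormSpec s (norm s) := by
  have key : ∀ m, ∀ s : St, WF s → s.2.1.length ≤ m → NormSpec s (redOrSelf^[m] s) := by
    intro m
    induction m with
    | zero =>
      intro s h hm
      have hV : s.2.1 = [] := List.length_eq_zero_iff.1 (Nat.le_zero.1 hm)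
      have hg : ∀ t, good s t := fun t I hI h0 _ => by
        rw [hV] at hI
        exact absurd (Finset.subset_empty.1 hI) h0.ne_empty
      exact ⟨h, Iff.rfl, le_rfl, hg 2, fun _ => rfl, fun d _ => by simp,
        fun _ h' => absurd (hg 2) h', fun _ h' => absurd (hg 2) h', fun _ => le_rfl⟩
    | succ m ih =>
      intro s h hm
      rw [Function.iterate_succ_apply]
      cases hr : red s with
      | none =>
        have hs : redOrSelf s = s := by simp [redOrSelf, hr]
        have hg := red_none h hr
        have : redOrSelf^[m] (redOrSelf s) = s := by
          rw [hs]; exact Function.iterate_fixed hs m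
        rw [this]
        exact ⟨h, Iff.rfl, le_rfl, hg, fun _ => rfl, fun d _ => by simp,
          fun _ h' => absurd hg h', fun _ h' => absurd hg h', fun _ => le_rfl⟩
      | some s' =>
        have hs : redOrSelf s = s' := by simp [redOrSelf, hr]
        have h1 := red_some h hr
        have h2 := ih s' h1.wf (by have := h1.lt; omega)
        rw [hs]
        -- After one reduction no surplus is negative, so the later ones cannot raise the measure
        -- and all the loss is decided by the first.
        have h3 := h2.le 0 (by simpa using h1.good_zero)
        have h4 := h1.lt
        have h5 := h2.length_le
        simp only [Nat.cast_zero, add_zero] at h3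
        refine ⟨h2.wf, h1.iff.trans h2.iff, by omega, h2.good,
          fun h' => absurd h' h1.not_good, fun d hd => ?_, fun h0 _ => ?_, fun h0 _ h6 => ?_,
          fun h0 => ?_⟩
        · have := h1.le d hd; omega
        · have := h1.lt_psi h0; omega
        · have := h1.of_edge h0 h6; omega
        · have := h1.root h0; omega
  exact key _ s h le_rfl

end

/-! ### Branching -/

/-- The children `a` and `b` of the reduced instance `t`. -/
structure Splits (t a b : St) : Prop where
  wf_left : WF a
  wf_right : WF b
  iff : sol t ↔ sol a ∨ sol b
  left_lt : a.2.1.length < t.2.1.length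
  right_lt : b.2.1.length < t.2.1.length

/-- The measure of the reduced children is smaller by at least `p` and `q`. -/
def Drop (t a b : St) (p q : ℤ) : Prop := psi (norm a) + p ≤ psi t ∧ psi (norm b) + q ≤ psi t

section
variable {t : St} {v : ℕ}

theorem deg_eq (h : WF t) :
    deg t.1 t.2.1 v = (nb (Adj t.1) t.2.1.toFinset {v}).card := by
  rw [deg, nbr_length h.nodup]; simp

theorem three_le_deg (h : WF t) (hg : good t 2) (hv : v ∈ t.2.1) : 3 ≤ deg t.1 t.2.1 v := by
  have := hg {v} (by simpa using hv) (by simp) (indep_singleton (h.loopless v hv))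
  rw [deg_eq h]
  simp at this
  omega

/-- J has surplus 2 and at least two elements. Deleting it with N(J) gains |J| + 4 ≥ 6 and leaves no
negative surplus. Putting it into the cover gains 2|J|, of which reduction gives back at most |J| −
2, so at least |J| + 2 ≥ 4 remains. -/
theorem splits_pair (h : WF t) (hg : good t 2) {J : List ℕ}
    (hJ : lowSurplus t.1 t.2.1 (pairs t.1 t.2.1) 2 = some J) :
    Splits t (remSt t J) (putSt t J) ∧ Drop t (remSt t J) (putSt t J) 6 4 := by
  obtain ⟨hJm, hle⟩ := lowSurplus_some hJ
  simp only [pairs, List.mem_flatMap, List.mem_map, List.mem_filter] at hJm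
  obtain ⟨a, ha, b, ⟨hb, hab⟩, hJe⟩ := hJm
  simp only [Bool.and_eq_true, Bool.not_eq_true', decide_eq_false_iff_not] at hab
  have hi : Indep (Adj t.1) [a, b].toFinset := by
    have h1 := h.loopless a ha
    have h2 := h.loopless b hb
    have h3 : ¬ Adj t.1 b a := fun h' => by
      have := Adj.symm _ _ h'
      simp [Adj, hab.2] at this
    intro x hx y hy
    simp only [List.mem_toFinset, List.mem_cons, List.not_mem_nil, or_false] at hx hy
    rcases hx with rfl | rfl <;> rcases hy with rfl | rfl <;> simp_all
  obtain ⟨h1, h2, h3, h4, -⟩ := extend_spec (E := t.1) h.nodup (S := [a, b])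
    (by simp [ha, hb]) (by simpa using hab.1) hi
  rw [hJe] at h1 h2 h3 h4
  have hc := List.toFinset_card_of_nodup h1
  have hc2 := Finset.card_le_card h3
  rw [List.toFinset_card_of_nodup (by simpa using hab.1)] at hc2
  simp only [List.length_cons, List.length_nil] at hc2
  rw [nbr_length h.nodup] at hle
  have hne : J.toFinset.Nonempty := Finset.card_pos.1 (by omega)
  have hge := hg _ h2 hne h4
  have hlr := length_rem h h2 h4
  have hlp := length_put h h2 h1
  have hpr := psi_rem h h2 h4
  have hpp := psi_put h h2 h1
  refine ⟨⟨h.rem, h.put, ?_, by omega, by omega⟩, ?_, ?_⟩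
  · rw [sol_rem h, sol_put h1]
    exact sol_branch_iff Adj.symm h2 h4 fun X hX hX0 => by
      have := hg X (hX.trans h2) hX0 (h4.mono hX)
      omega
  · have hgr : good (remSt t J) (-(0 : ℕ)) := by
      rw [good, remSt_toFinset]
      exact (good_rem (t := 2) Adj.symm h2 h4 fun K hK hKi _ hlt =>
        hg K hK (Finset.card_pos.1 (by omega)) hKi).mono (by push_cast; omega)
    have := (norm_spec h.rem).le 0 hgr
    push_cast at this
    omega
  · have hgp : good (putSt t J) (-((J.length - 2 : ℕ) : ℤ)) := by
      rw [good, putSt_toFinset]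
      exact (hg.put (J := J.toFinset)).mono (by omega)
    have := (norm_spec h.put).le _ hgp
    omega

/-- Independent sets with at least two elements have surplus at least three. -/
def Three (t : St) : Prop := ∀ K ⊆ t.2.1.toFinset, Indep (Adj t.1) K → 2 ≤ K.card →
  K.card + 3 ≤ (nb (Adj t.1) t.2.1.toFinset K).card

theorem three_of_none (h : WF t)
    (hJ : lowSurplus t.1 t.2.1 (pairs t.1 t.2.1) 2 = none) : Three t := by
  intro K hK hi hc
  obtain ⟨a, ha, b, hb, hab⟩ := Finset.one_lt_card.1 hc
  have haV := List.mem_toFinset.1 (hK ha)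
  have hbV := List.mem_toFinset.1 (hK hb)
  have hS : [a, b].toFinset ⊆ K := by
    intro x hx
    simp only [List.mem_toFinset, List.mem_cons, List.not_mem_nil, or_false] at hx
    rcases hx with rfl | rfl <;> assumption
  have h5 := (extend_spec (E := t.1) h.nodup (S := [a, b]) (by simp [haV, hbV])
    (by simpa using hab) (hi.mono hS)).2.2.2.2 K hK hi hS
  have h6 := lowSurplus_none hJ (J := extend t.1 t.2.1 [a, b]) (by
    simp only [pairs, List.mem_flatMap, List.mem_map, List.mem_filter]
    refine ⟨a, haV, b, ⟨hbV, ?_⟩, rfl⟩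
    have := hi a ha b hb
    simp only [Adj, Bool.not_eq_true] at this
    simp [hab, this])
  omega

theorem splits_vertex (h : WF t) (hv : v ∈ t.2.1) :
    Splits t (remSt t [v]) (putSt t [v]) := by
  have hJ : [v].toFinset ⊆ t.2.1.toFinset := by simpa using hv
  have hi : Indep (Adj t.1) [v].toFinset := by simpa using indep_singleton (h.loopless v hv)
  have hlr := length_rem h hJ hi
  have hlp := length_put h hJ (by simp)
  have h1 : [v].toFinset.card = 1 := by simp
  have h2 : [v].length = 1 := rfl
  refine ⟨h.rem, h.put, ?_, by omega, by omega⟩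
  rw [sol_rem h, sol_put (by simp)]
  exact sol_branch_iff Adj.symm hJ hi fun X hX hX0 => by
    have : X = [v].toFinset := by
      simp only [List.toFinset_cons, List.toFinset_nil, insert_empty_eq] at hX ⊢
      exact (Finset.Nonempty.subset_singleton_iff hX0).1 hX
    rw [this]

theorem psi_put_vertex (h : WF t) (hv : v ∈ t.2.1) : psi (putSt t [v]) = psi t - 2 := by
  rw [psi_put h (by simpa using hv) (by simp)]; simp

theorem good_put_vertex (hg : good t 2) : good (putSt t [v]) 1 := by
  rw [good, putSt_toFinset]
  exact (hg.put (J := [v].toFinset)).mono (by simp)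

theorem put_drop (h : WF t) (hg : good t 2) (hv : v ∈ t.2.1) :
    psi (norm (putSt t [v])) + 2 ≤ psi t := by
  have h1 := (norm_spec (h.put (J := [v]))).le 0 ((good_put_vertex hg).mono (by simp))
  have h2 := psi_put_vertex h hv
  push_cast at h1
  omega

/-- The neighbour w keeps at most two neighbours, so {w} has surplus at most 1 and some reduction
applies, which gains 1 beyond the 2 for v. -/
theorem put_drop_of_nbr (h : WF t) (hg : good t 2) (hv : v ∈ t.2.1) {w : ℕ} (hw : w ∈ t.2.1)
    (hvw : Adj t.1 v w) (hd : deg t.1 t.2.1 w ≤ 3) :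
    psi (norm (putSt t [v])) + 3 ≤ psi t := by
  have h1 := (norm_spec (h.put (J := [v]))).lt_psi ((good_put_vertex hg).mono (by simp)) fun h2 => by
    have hwv : w ≠ v := fun h' => h.loopless v hv (h' ▸ hvw)
    have h3 := h2 {w} (by simp [putSt_toFinset, hwv, hw]) (by simp)
      (indep_singleton (h.loopless w hw))
    rw [putSt_toFinset, nb_put] at h3
    change _ ≤ (((nb (Adj t.1) t.2.1.toFinset {w}) \ _).card : ℤ) at h3
    have hm : v ∈ nb (Adj t.1) t.2.1.toFinset {w} :=
      mem_nb_singleton.2 ⟨List.mem_toFinset.2 hv, Adj.symm _ _ hvw⟩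
    have h4 : [v].toFinset ⊆ nb (Adj t.1) t.2.1.toFinset {w} := by simpa using hm
    have h5 := Finset.card_sdiff_add_card_eq_card h4
    rw [deg_eq h] at hd
    have h6 : [v].toFinset.card = 1 := by simp
    simp only [Finset.card_singleton] at h3
    omega
  have h2 := psi_put_vertex h hv
  omega

theorem psi_rem_vertex (h : WF t) (hv : v ∈ t.2.1) :
    psi (remSt t [v]) = psi t - 2 * deg t.1 t.2.1 v + 1 := by
  rw [psi_rem h (by simpa using hv) (by simpa using indep_singleton (h.loopless v hv)), deg_eq h]
  simp

/-- A nonempty independent set of the remaining graph together with v has at least two elements,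
hence surplus at least 3; subtracting the surplus deg v − 1 of {v} leaves 4 − deg v. -/
theorem good_rem_vertex (h : WF t) (h3 : Three t) (hv : v ∈ t.2.1) :
    good (remSt t [v]) (4 - deg t.1 t.2.1 v) := by
  rw [good, remSt_toFinset, deg_eq h]
  change Good (Adj t.1) _ _
  refine (good_rem (t := 3) Adj.symm (by simpa using hv)
    (by simpa using indep_singleton (h.loopless v hv)) fun K hK hKi _ hlt => ?_).mono ?_
  · have := h3 K hK hKi (by simp at hlt; omega)
    omega
  · simp

/-- For d = deg v, the deletion itself gains 2d − 1 and reduction gives back at most d − 4. -/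
theorem rem_drop (h : WF t) (h3 : Three t) (hv : v ∈ t.2.1) (hd : 4 ≤ deg t.1 t.2.1 v) :
    psi (norm (remSt t [v])) + (deg t.1 t.2.1 v + 3) ≤ psi t := by
  have h1 := (norm_spec (h.rem (J := [v]))).le (deg t.1 t.2.1 v - 4)
    ((good_rem_vertex h h3 hv).mono (by omega))
  have h2 := psi_rem_vertex h hv
  omega

theorem rem_drop_three (h : WF t) (h3 : Three t) (hv : v ∈ t.2.1) (hd : deg t.1 t.2.1 v = 3) :
    psi (norm (remSt t [v])) + 5 ≤ psi t := by
  have h1 := (norm_spec (h.rem (J := [v]))).le 0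
    ((good_rem_vertex h h3 hv).mono (by rw [hd]; simp))
  have h2 := psi_rem_vertex h hv
  push_cast at h1
  omega

/-- The next vertex after `v`, at distance two, has degree at most two once `v` and its neighbours
are deleted. -/
theorem rem_drop_three_of_far (h : WF t) (h3 : Three t) (hv : v ∈ t.2.1)
    (hd : deg t.1 t.2.1 v = 3) {y w : ℕ} (hy : y ∈ t.2.1) (hvy : Adj t.1 v y)
    (hw : w ∈ t.2.1) (hyw : Adj t.1 y w) (hwv : w ≠ v) (hvw : ¬ Adj t.1 v w)
    (hdw : deg t.1 t.2.1 w ≤ 3) :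
    psi (norm (remSt t [v])) + 6 ≤ psi t := by
  have h1 := (norm_spec (h.rem (J := [v]))).lt_psi
    ((good_rem_vertex h h3 hv).mono (by rw [hd]; simp)) fun h2 => by
    have h3 := h2 {w} (by
        rw [remSt_toFinset]
        simp [mem_nb, hw, hwv]
        simpa using hvw) (by simp)
      (indep_singleton (h.loopless w hw))
    rw [remSt_toFinset, nb_put] at h3
    change _ ≤ (((nb (Adj t.1) t.2.1.toFinset {w}) \ _).card : ℤ) at h3
    have hm : y ∈ nb (Adj t.1) t.2.1.toFinset {w} :=
      mem_nb_singleton.2 ⟨List.mem_toFinset.2 hy, Adj.symm _ _ hyw⟩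
    have hm2 : y ∈ nb (Adj t.1) t.2.1.toFinset [v].toFinset :=
      mem_nb.2 ⟨List.mem_toFinset.2 hy, v, by simp, hvy⟩
    have h4 : nb (Adj t.1) t.2.1.toFinset {w} \
        ([v].toFinset ∪ nb (Adj t.1) t.2.1.toFinset [v].toFinset) ⊆
        (nb (Adj t.1) t.2.1.toFinset {w}).erase y := by
      intro x hx
      rw [Finset.mem_sdiff] at hx
      refine Finset.mem_erase.2 ⟨?_, hx.1⟩
      rintro rfl
      exact hx.2 (Finset.mem_union_right _ hm2)
    have h5 := Finset.card_le_card h4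
    rw [Finset.card_erase_of_mem hm] at h5
    rw [deg_eq h] at hdw
    simp only [Finset.card_singleton] at h3
    omega
  have h2 := psi_rem_vertex h hv
  omega

/-- If the closed neighbourhood of the vertex `v` of degree three is a component, it is complete,
and the remaining triangle is reduced at once. -/
theorem put_drop_of_closed (h : WF t) (hg : good t 2) (h3 : Three t) (hv : v ∈ t.2.1)
    (hd : deg t.1 t.2.1 v = 3)
    (hcl : ∀ y ∈ t.2.1, Adj t.1 v y → ∀ w ∈ t.2.1, Adj t.1 y w → w = v ∨ Adj t.1 v w) :
    psi (norm (putSt t [v])) + 5 ≤ psi t := by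
  classical
  have hNv := deg_eq (v := v) h
  rw [hd] at hNv
  -- the neighbours of a neighbour
  have hN : ∀ y ∈ t.2.1, Adj t.1 v y → nb (Adj t.1) (putSt t [v]).2.1.toFinset {y} =
      (nb (Adj t.1) t.2.1.toFinset {v}).erase y := by
    intro y hy hvy
    have hyN : y ∈ nb (Adj t.1) t.2.1.toFinset {v} :=
      mem_nb_singleton.2 ⟨List.mem_toFinset.2 hy, hvy⟩
    have hyd := three_le_deg h hg hy
    rw [deg_eq h] at hyd
    -- Without v, the vertex y still has at least two neighbours, and they all lie among the other
    -- two neighbours of v.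
    refine Finset.eq_of_subset_of_card_le ?_ ?_
    · intro w hw
      rw [putSt_toFinset, nb_put, Finset.mem_sdiff, mem_nb_singleton, List.mem_toFinset] at hw
      have hwv : w ≠ v := by simpa using hw.2
      refine Finset.mem_erase.2 ⟨?_, mem_nb_singleton.2 ⟨List.mem_toFinset.2 hw.1.1, ?_⟩⟩
      · rintro rfl; exact h.loopless w hy hw.1.2
      · exact (hcl y hy hvy w hw.1.1 hw.1.2).resolve_left hwv
    · have h4 := card_nb_put (A := Adj t.1) (V := t.2.1.toFinset) (I := {y}) (J := [v].toFinset)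
      have h5 : [v].toFinset.card = 1 := by simp
      rw [putSt_toFinset, Finset.card_erase_of_mem hyN]
      omega
  have hg1 := good_put_vertex (v := v) hg
  have h1 := (norm_spec (h.put (J := [v]))).of_edge hg1 ?_ ?_
  · have h2 := psi_put_vertex h hv
    omega
  · obtain ⟨y, hy⟩ : (nb (Adj t.1) t.2.1.toFinset {v}).Nonempty := Finset.card_pos.1 (by omega)
    have hy' := mem_nb_singleton.1 hy
    rw [List.mem_toFinset] at hy'
    have hyv : y ≠ v := fun h' => h.loopless v hv (h' ▸ hy'.2)
    intro h2
    have h4 := h2 {y} (by simp [putSt_toFinset, hyv, hy'.1]) (by simp)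
      (indep_singleton (h.loopless y hy'.1))
    change _ ≤ ((nb (Adj t.1) (putSt t [v]).2.1.toFinset {y}).card : ℤ) at h4
    rw [hN y hy'.1 hy'.2, Finset.card_erase_of_mem hy] at h4
    simp at h4
    omega
  · intro J hJ hJ0 hJi hle hind
    change Indep (Adj t.1) J at hJi
    change (nb (Adj t.1) (putSt t [v]).2.1.toFinset J).card ≤ J.card + 1 at hle
    change Indep (Adj t.1) (nb (Adj t.1) (putSt t [v]).2.1.toFinset J) at hind
    rw [putSt_toFinset] at hJ
    have hJV := hJ.trans Finset.sdiff_subset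
    have h4 := card_nb_put (A := Adj t.1) (V := t.2.1.toFinset) (I := J) (J := [v].toFinset)
    have h5 : [v].toFinset.card = 1 := by simp
    rw [← putSt_toFinset] at h4
    -- Two or more independent vertices have surplus at least 3, and still at least 2 after the loss
    -- of v.
    have hJ1 : J.card = 1 := by
      have h6 := hJ0.card_pos
      by_contra hne
      have := h3 J hJV hJi (by omega)
      omega
    obtain ⟨y, rfl⟩ := Finset.card_eq_one.1 hJ1
    have hyV : y ∈ t.2.1 := by simpa using hJV
    have hyd := three_le_deg h hg hyV
    rw [deg_eq h] at hyd
    have hvy : Adj t.1 v y := by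
      by_contra hvy
      have h6 : nb (Adj t.1) (putSt t [v]).2.1.toFinset {y} = nb (Adj t.1) t.2.1.toFinset {y} := by
        rw [putSt_toFinset, nb_put]
        refine Finset.sdiff_eq_self_of_disjoint (Finset.disjoint_right.2 fun x hx => ?_)
        obtain rfl : x = v := by simpa using hx
        exact fun h' => hvy (Adj.symm _ _ (mem_nb_singleton.1 h').2)
      rw [h6] at hle
      simp at hle
      omega
    have hyN : y ∈ nb (Adj t.1) t.2.1.toFinset {v} :=
      mem_nb_singleton.2 ⟨List.mem_toFinset.2 hyV, hvy⟩
    rw [hN y hyV hvy] at hind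
    have h7 : 1 < ((nb (Adj t.1) t.2.1.toFinset {v}).erase y).card := by
      rw [Finset.card_erase_of_mem hyN]; omega
    obtain ⟨a, ha, b, hb, hab⟩ := Finset.one_lt_card.1 h7
    have ha' := mem_nb_singleton.1 (Finset.mem_of_mem_erase ha)
    rw [List.mem_toFinset] at ha'
    have h8 : b ∈ nb (Adj t.1) (putSt t [v]).2.1.toFinset {a} := by
      rw [hN a ha'.1 ha'.2]
      exact Finset.mem_erase.2 ⟨hab.symm, Finset.mem_of_mem_erase hb⟩
    exact hind a ha b hb (mem_nb_singleton.1 h8).2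

/-! ### Case analysis of the branching -/

/-- A vertex of degree three whose neighbours have degree three, and another such vertex that is
not adjacent to it. -/
def FarCubic (t : St) : Prop := ∃ v ∈ t.2.1, deg t.1 t.2.1 v ≤ 3 ∧
  (∀ y ∈ t.2.1, Adj t.1 v y → deg t.1 t.2.1 y ≤ 3) ∧
  ∃ w ∈ t.2.1, w ≠ v ∧ ¬ Adj t.1 v w ∧ deg t.1 t.2.1 w ≤ 3

/-- What is gained by branching. -/
inductive Gain (t a b : St) : Prop
  | pair (h : Drop t a b 6 4)
  | four (h : Drop t a b 7 3)
  | complete (h : Drop t a b 5 5)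
  | five (h : Drop t a b 8 2) (hd : ∃ v ∈ t.2.1, 5 ≤ deg t.1 t.2.1 v)
  | cubic (h : Drop t a b 6 3) (hf : FarCubic t)
  | regular (h : Drop t a b 7 2) (h3 : Three t) (hd : ∀ v ∈ t.2.1, deg t.1 t.2.1 v = 4)
      (hb : ∃ v ∈ t.2.1, b = putSt t [v])

/-- Once the low-surplus sets, degrees above 4 and degree-4 vertices next to degree-3 vertices are
excluded, the neighbours of a cubic vertex are cubic, and so are theirs. If such a vertex has no
vertex at distance two, its component is a K₄; otherwise both branches make a further reduction
available. If no cubic vertex exists, the graph is 4-regular. -/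
theorem branch_spec (h : WF t) (hg : good t 2) (h0 : t.2.1 ≠ []) :
    ∃ a b, branch t = some (a, b) ∧ Splits t a b ∧ Gain t a b := by
  unfold branch
  cases hJ : lowSurplus t.1 t.2.1 (pairs t.1 t.2.1) 2 with
  | some J =>
    obtain ⟨h1, h2⟩ := splits_pair h hg hJ
    exact ⟨_, _, rfl, h1, .pair h2⟩
  | none =>
    have h3 := three_of_none h hJ
    suffices hs : ∃ v ∈ t.2.1, pick t.1 t.2.1 = some v ∧ Gain t (remSt t [v]) (putSt t [v]) by
      obtain ⟨v, hv, hp, hgain⟩ := hs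
      exact ⟨_, _, by rw [hp]; rfl, splits_vertex h hv, hgain⟩
    unfold pick
    cases h1 : t.2.1.find? fun v => decide (5 ≤ deg t.1 t.2.1 v) with
    | some v =>
      have hv := List.mem_of_find?_eq_some h1
      have hd : 5 ≤ deg t.1 t.2.1 v := by simpa using List.find?_some h1
      have := rem_drop h h3 hv (by omega)
      exact ⟨v, hv, rfl, .five ⟨by omega, put_drop h hg hv⟩ ⟨v, hv, hd⟩⟩
    | none =>
      have h5 : ∀ v ∈ t.2.1, deg t.1 t.2.1 v ≤ 4 := fun v hv => by
        have := List.find?_eq_none.1 h1 v hv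
        simp at this; omega
      cases h2 : t.2.1.find? fun v => decide (4 ≤ deg t.1 t.2.1 v) &&
          (nbr t.1 t.2.1 [v]).any fun w => decide (deg t.1 t.2.1 w ≤ 3) with
      | some v =>
        have hv := List.mem_of_find?_eq_some h2
        have hd := List.find?_some h2
        simp only [nbr, Bool.and_eq_true, decide_eq_true_eq, List.any_eq_true, List.mem_filter,
          List.mem_singleton, exists_eq_left] at hd
        obtain ⟨hd4, w, ⟨hw, hvw⟩, hdw⟩ := hd
        have := rem_drop h h3 hv hd4
        exact ⟨v, hv, rfl, .four ⟨by omega, put_drop_of_nbr h hg hv hw hvw hdw⟩⟩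
      | none =>
        have h4 : ∀ v ∈ t.2.1, 4 ≤ deg t.1 t.2.1 v → ∀ w ∈ t.2.1, Adj t.1 v w →
            4 ≤ deg t.1 t.2.1 w := by
          intro v hv hd w hw hvw
          have := List.find?_eq_none.1 h2 v hv
          simp only [nbr, Bool.and_eq_true, decide_eq_true_eq, List.any_eq_true, List.mem_filter,
            List.mem_singleton, exists_eq_left, not_and, not_exists] at this
          have := this hd w ⟨hw, hvw⟩
          omega
        cases h6 : t.2.1.find? fun v => decide (deg t.1 t.2.1 v ≤ 3) with
        | some v =>
          have hv := List.mem_of_find?_eq_some h6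
          have hd : deg t.1 t.2.1 v ≤ 3 := by simpa using List.find?_some h6
          have hd3 : deg t.1 t.2.1 v = 3 := le_antisymm hd (three_le_deg h hg hv)
          have hcl : ∀ x ∈ t.2.1, deg t.1 t.2.1 x ≤ 3 → ∀ y ∈ t.2.1, Adj t.1 x y →
              deg t.1 t.2.1 y ≤ 3 := fun x hx hdx y hy hxy => by
            by_contra hdy
            have := h4 y hy (by omega) x hx (Adj.symm _ _ hxy)
            omega
          refine ⟨v, hv, rfl, ?_⟩
          by_cases hc : ∀ y ∈ t.2.1, Adj t.1 v y → ∀ w ∈ t.2.1, Adj t.1 y w →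
              w = v ∨ Adj t.1 v w
          · exact .complete ⟨rem_drop_three h h3 hv hd3, put_drop_of_closed h hg h3 hv hd3 hc⟩
          · push Not at hc
            obtain ⟨y, hy, hvy, w, hw, hyw, hwv, hvw⟩ := hc
            have hdy := hcl v hv hd y hy hvy
            have hdw := hcl y hy hdy w hw hyw
            exact .cubic ⟨rem_drop_three_of_far h h3 hv hd3 hy hvy hw hyw hwv hvw hdw,
              put_drop_of_nbr h hg hv hy hvy hdy⟩ ⟨v, hv, hd, hcl v hv hd, w, hw, hwv, hvw, hdw⟩
        | none =>
          obtain ⟨v, l, hl⟩ := List.exists_cons_of_ne_nil h0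
          have hv : v ∈ t.2.1 := hl ▸ List.mem_cons_self
          have hd : ∀ v ∈ t.2.1, deg t.1 t.2.1 v = 4 := fun v hv => by
            have := List.find?_eq_none.1 h6 v hv
            simp only [decide_eq_true_eq] at this
            have := h5 v hv
            omega
          have := rem_drop h h3 hv (hd v hv).ge
          rw [hd v hv] at this
          exact ⟨v, hv, by simp [hl], .regular ⟨by simpa using this, put_drop h hg hv⟩ h3 hd
            ⟨v, hv, rfl⟩⟩

/-- After a vertex of a 4-regular graph is put into the cover, the next branching is better. -/
theorem branch_of_regular (h : WF t) (h3 : Three t)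
    (hd : ∀ v ∈ t.2.1, deg t.1 t.2.1 v = 4) (hv : v ∈ t.2.1) :
    good (putSt t [v]) 2 ∧ ((putSt t [v]).2.1 ≠ [] → ∃ a b, branch (putSt t [v]) = some (a, b) ∧
      Splits (putSt t [v]) a b ∧ (Drop (putSt t [v]) a b 6 4 ∨ Drop (putSt t [v]) a b 7 3 ∨
        Drop (putSt t [v]) a b 5 5)) := by
  have hm : ∀ w, w ∈ (putSt t [v]).2.1 ↔ w ∈ t.2.1 ∧ w ≠ v := by intro w; simp [putSt]
  have hN : ∀ w, nb (Adj t.1) (putSt t [v]).2.1.toFinset {w} =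
      nb (Adj t.1) t.2.1.toFinset {w} \ {v} := fun w => by
    rw [putSt_toFinset, nb_put]; simp
  have hd4 : ∀ w ∈ t.2.1, (nb (Adj t.1) t.2.1.toFinset {w}).card = 4 := fun w hw => by
    rw [← deg_eq h, hd w hw]
  have hd' : ∀ w ∈ (putSt t [v]).2.1, deg (putSt t [v]).1 (putSt t [v]).2.1 w =
      if Adj t.1 v w then 3 else 4 := by
    intro w hw
    rw [hm] at hw
    rw [deg_eq h.put]
    change (nb (Adj t.1) (putSt t [v]).2.1.toFinset {w}).card = _
    rw [hN]
    have hmem : v ∈ nb (Adj t.1) t.2.1.toFinset {w} ↔ Adj t.1 v w := by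
      rw [mem_nb_singleton]
      exact ⟨fun h' => Adj.symm _ _ h'.2, fun h' => ⟨List.mem_toFinset.2 hv, Adj.symm _ _ h'⟩⟩
    split_ifs with hvw
    · have := Finset.card_sdiff_add_card_eq_card (Finset.singleton_subset_iff.2 (hmem.2 hvw))
      rw [hd4 w hw.1] at this
      simpa using this
    · rw [Finset.sdiff_singleton_eq_erase, Finset.erase_eq_of_notMem (fun h' => hvw (hmem.1 h')),
        hd4 w hw.1]
  have hg2 : good (putSt t [v]) 2 := by
    intro K hK hK0 hKi
    have hK' : K ⊆ t.2.1.toFinset := fun x hx => by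
      have := hK hx
      rw [List.mem_toFinset, hm] at this
      exact List.mem_toFinset.2 this.1
    have h4 := card_nb_put (A := Adj t.1) (V := t.2.1.toFinset) (I := K) (J := [v].toFinset)
    rw [← putSt_toFinset] at h4
    have h5 : [v].toFinset.card = 1 := by simp
    change _ ≤ ((nb (Adj t.1) (putSt t [v]).2.1.toFinset K).card : ℤ)
    have h6 := hK0.card_pos
    by_cases h7 : 2 ≤ K.card
    · have := h3 K hK' hKi h7
      omega
    · obtain ⟨w, rfl⟩ := Finset.card_eq_one.1 (show K.card = 1 by omega)
      have := hd4 w (by simpa using hK')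
      simp only [Finset.card_singleton]
      omega
  refine ⟨hg2, fun hne => ?_⟩
  obtain ⟨a, b, h1, h2, hgain⟩ := branch_spec h.put hg2 hne
  refine ⟨a, b, h1, h2, ?_⟩
  cases hgain with
  | pair h => exact .inl h
  | four h => exact .inr (.inl h)
  | complete h => exact .inr (.inr h)
  -- All degrees are at most 4 after the deletion from a 4-regular graph.
  | five _ hf =>
    obtain ⟨w, hw, hf⟩ := hf
    have := hd' w hw
    split_ifs at this <;> omega
  | cubic _ hf =>
    exfalso
    obtain ⟨x, hx, hdx, hxN, w, hw, hwx, hxw, hdw⟩ := hf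
    have key : ∀ w ∈ (putSt t [v]).2.1, deg (putSt t [v]).1 (putSt t [v]).2.1 w ≤ 3 →
        Adj t.1 v w := fun w hw hdw => by
      have := hd' w hw
      split_ifs at this with h4
      · exact h4
      · omega
    have hvx := key x hx hdx
    have hvw := key w hw hdw
    have hxV := (hm x).1 hx
    have hwV := (hm w).1 hw
    -- Cubic vertices are now exactly the neighbours of v. Hence x and its three neighbours would
    -- all lie in N(v) without w, which has only three elements.
    have hsub : insert x (nb (Adj t.1) (putSt t [v]).2.1.toFinset {x}) ⊆
        (nb (Adj t.1) t.2.1.toFinset {v}).erase w := by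
      intro y hy
      rcases Finset.mem_insert.1 hy with rfl | hy
      · exact Finset.mem_erase.2 ⟨hwx.symm, mem_nb_singleton.2 ⟨List.mem_toFinset.2 hxV.1, hvx⟩⟩
      · obtain ⟨hyV, hxy⟩ := mem_nb_singleton.1 hy
        rw [List.mem_toFinset] at hyV
        refine Finset.mem_erase.2 ⟨fun h' => hxw (h' ▸ hxy), mem_nb_singleton.2
          ⟨List.mem_toFinset.2 ((hm y).1 hyV).1, key y hyV (hxN y hyV hxy)⟩⟩
    have h5 := Finset.card_le_card hsub
    rw [Finset.card_erase_of_mem (mem_nb_singleton.2 ⟨List.mem_toFinset.2 hwV.1, hvw⟩), hd4 v hv,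
      Finset.card_insert_of_notMem] at h5
    · have h6 := hd' x hx
      rw [if_pos hvx, deg_eq h.put] at h6
      change (nb (Adj t.1) (putSt t [v]).2.1.toFinset {x}).card = 3 at h6
      omega
    · exact fun h' => h.loopless x hxV.1 (mem_nb_singleton.1 h').2
  | regular _ _ hr _ =>
    -- The neighbours of v now have degree 3, so the graph is not 4-regular.
    exfalso
    obtain ⟨y, hy⟩ : (nb (Adj t.1) t.2.1.toFinset {v}).Nonempty :=
      Finset.card_pos.1 (by rw [hd4 v hv]; omega)
    obtain ⟨hyV, hvy⟩ := mem_nb_singleton.1 hy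
    rw [List.mem_toFinset] at hyV
    have hyv : y ≠ v := fun h' => h.loopless v hv (h' ▸ hvy)
    have h5 := hr y ((hm y).2 ⟨hyV, hyv⟩)
    rw [hd' y ((hm y).2 ⟨hyV, hyv⟩), if_pos hvy] at h5
    omega

end

/-! ### Number of leaves of the search tree -/

/-- Number of leaves of the search tree of `s`, cut off at depth `f`. -/
def leaves : ℕ → St → ℕ
  | 0, _ => 1
  | f + 1, s => (step s).1.elim 1 fun c => leaves f c.1 + leaves f c.2

theorem leaves_zero (s : St) : leaves 0 s = 1 := rfl

theorem leaves_some {f : ℕ} {s a b : St} (h : (step s).1 = some (a, b)) :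
    leaves (f + 1) s = leaves f a + leaves f b := by
  rw [leaves, h]; rfl

theorem leaves_none {f : ℕ} {s : St} (h : (step s).1 = none) : leaves (f + 1) s = 1 := by
  rw [leaves, h]; rfl

/-- A reduced instance is answered or branched on. -/
theorem decideOrBranch_spec {t : St} (h : WF t) (hg : good t 2) :
    ((decideOrBranch t).1 = none ∧ ((decideOrBranch t).2 = true ↔ sol t)) ∨
    ((decideOrBranch t).1 = branch t ∧ t.2.1 ≠ [] ∧ 0 ≤ psi t) := by
  unfold decideOrBranch
  by_cases h1 : t.2.1.length + (t.2.2.1 + t.2.2.1) ≤ t.2.2.2 + t.2.2.2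
  · rw [if_pos (by simpa using h1)]
    by_cases h2 : t.2.1.isEmpty
    · left
      rw [if_pos h2]
      rw [List.isEmpty_iff] at h2
      refine ⟨rfl, ?_⟩
      simp only [true_iff]
      refine ⟨∅, ⟨by simp, by simp [h2]⟩, ?_⟩
      simp only [Finset.card_empty]; omega
    · right
      rw [if_neg h2]
      refine ⟨rfl, by simpa using h2, ?_⟩
      unfold psi
      omega
  · left
    rw [if_neg (by simpa using h1)]
    refine ⟨rfl, ?_⟩
    simp only [Bool.false_eq_true, false_iff]
    rintro ⟨C, hC, hk⟩
    have := (hg.mono (s := 0) (by omega)).card_le hC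
    rw [List.toFinset_card_of_nodup h.nodup] at this
    omega

/-! ### Solving the recurrences -/

theorem branchFactors {x y : ℝ} (hy : 1 ≤ y) (hy3 : y ^ 3 = 1.6253) (hx : x = y⁻¹) :
    x ^ 6 + x ^ 4 ≤ 1 ∧ x ^ 7 + x ^ 3 ≤ 1 ∧ x ^ 5 + x ^ 5 ≤ 1 ∧ x ^ 8 + x ^ 2 ≤ 1 ∧
      x ^ 6 + x ^ 3 ≤ 1 ∧ x ^ 7 + (x ^ 8 + x ^ 6) ≤ 1 ∧ x ^ 7 + (x ^ 9 + x ^ 5) ≤ 1 ∧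
      x ^ 7 + (x ^ 7 + x ^ 7) ≤ 1 ∧ x ^ 7 + x ^ 9 ≤ 1 := by
  have hx0 : 0 ≤ x := by rw [hx]; positivity
  -- A rational upper bound for 1.6253^(−1/3), fine enough for the tightest sum x⁷ + x⁹ + x⁵, which
  -- comes from a 4-regular branching followed by a (7,3) branching.
  have hxq : x ≤ 0.85053 := by
    by_contra hlt
    push Not at hlt
    have h1 : (0.85053 : ℝ) ^ 3 < x ^ 3 := by gcongr
    have h2 : x ^ 3 = 1 / 1.6253 := by rw [hx, inv_pow, hy3]; norm_num
    rw [h2] at h1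
    norm_num at h1
  have hp : ∀ n : ℕ, x ^ n ≤ (0.85053 : ℝ) ^ n := fun n => by gcongr
  have h2 := hp 2
  have h3 := hp 3
  have h4 := hp 4
  have h5 := hp 5
  have h6 := hp 6
  have h7 := hp 7
  have h8 := hp 8
  have h9 := hp 9
  norm_num at h2 h3 h4 h5 h6 h7 h8 h9
  refine ⟨?_, ?_, ?_, ?_, ?_, ?_, ?_, ?_, ?_⟩ <;> linarith

/-- Induction over the search tree with the weights x^p of the drops p; it is strong induction
because the 4-regular case expands two levels. Branching happens only at ψ ≥ 0 and no drop used
exceeds 9 = 7 + 2, so the summand 9 keeps all exponents nonnegative. -/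
theorem leaves_le {y : ℝ} (hy : 1 ≤ y) (hy3 : y ^ 3 = 1.6253) (f : ℕ) :
    ∀ s : St, WF s → (leaves f s : ℝ) ≤ y ^ (9 + psi (norm s)).toNat := by
  obtain ⟨x, hx⟩ : ∃ x, x = y⁻¹ := ⟨_, rfl⟩
  have hy0 : 0 < y := by linarith
  have hxy : x * y = 1 := by rw [hx]; field_simp
  have hx0 : 0 ≤ x := by rw [hx]; positivity
  obtain ⟨b1, b2, b3, b4, b5, b6, b7, b8, b9⟩ := branchFactors hy hy3 hx
  induction f using Nat.strong_induction_on with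
  | _ f ih =>
    -- the bound for a descendant whose measure is smaller by at least `p`
    have desc : ∀ (g : ℕ) (t a : St) (p : ℕ), g < f → WF a → 0 ≤ psi t → p ≤ 9 →
        psi (norm a) + p ≤ psi t → (leaves g a : ℝ) ≤ y ^ (9 + psi t).toNat * x ^ p := by
      intro g t a p hg ha h0 hp hle
      obtain ⟨m, hm⟩ : ∃ m, (9 + psi t).toNat = m + p :=
        ⟨(9 + psi t).toNat - p, by omega⟩
      have h1 : y ^ (9 + psi t).toNat * x ^ p = y ^ m := by
        rw [hm, pow_add, mul_assoc, ← mul_pow, mul_comm y x, hxy, one_pow, mul_one]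
      rw [h1]
      exact (ih g hg a ha).trans (pow_le_pow_right₀ hy (by omega))
    have one : ∀ t : St, 0 ≤ psi t → (1 : ℝ) ≤ y ^ (9 + psi t).toNat * x ^ 9 := by
      intro t h0
      obtain ⟨m, hm⟩ : ∃ m, (9 + psi t).toNat = m + 9 := ⟨(psi t).toNat, by omega⟩
      rw [hm, pow_add, mul_assoc, ← mul_pow, mul_comm y x, hxy, one_pow, mul_one]
      exact one_le_pow₀ hy
    intro s hs
    cases f with
    | zero => rw [leaves_zero]; simpa using one_le_pow₀ hy
    | succ f =>
      have hn := norm_spec hs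
      rcases decideOrBranch_spec hn.wf hn.good with ⟨h1, -⟩ | ⟨h1, h2, h3⟩
      · rw [leaves_none h1]; simpa using one_le_pow₀ hy
      obtain ⟨a, b, h4, h5, hgain⟩ := branch_spec hn.wf hn.good h2
      rw [h4] at h1
      rw [leaves_some h1]
      push_cast
      generalize hW : y ^ (9 + psi (norm s)).toNat = W at *
      have hW0 : 0 ≤ W := by rw [← hW]; positivity
      have fin : ∀ p q : ℕ, p ≤ 9 → q ≤ 9 → x ^ p + x ^ q ≤ 1 → Drop (norm s) a b p q →
          (leaves f a : ℝ) + leaves f b ≤ W := by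
        intro p q hp hq hpq hd
        have e1 := desc f (norm s) a p (by omega) h5.wf_left h3 hp hd.1
        have e2 := desc f (norm s) b q (by omega) h5.wf_right h3 hq hd.2
        have e3 := mul_le_mul_of_nonneg_left hpq hW0
        rw [hW] at e1 e2
        linarith
      cases hgain with
      | pair h => exact fin 6 4 (by norm_num) (by norm_num) b1 h
      | four h => exact fin 7 3 (by norm_num) (by norm_num) b2 h
      | complete h => exact fin 5 5 (by norm_num) (by norm_num) b3 h
      | five h _ => exact fin 8 2 (by norm_num) (by norm_num) b4 h
      | cubic h _ => exact fin 6 3 (by norm_num) (by norm_num) b5 h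
      | regular h hT hd hb =>
        obtain ⟨v, hv, rfl⟩ := hb
        have e1 := desc f (norm s) a 7 (by omega) h5.wf_left h3 (by norm_num) h.1
        have e9 := one (norm s) h3
        rw [hW] at e1 e9
        -- If the second child is answered at once it is a single leaf, which is paid for by the
        -- summand 9.
        have trivial_b : ∀ c : ℕ, c = 1 → (leaves f a : ℝ) + c ≤ W := by
          rintro c rfl
          have e3 := mul_le_mul_of_nonneg_left b9 hW0
          push_cast
          linarith
        obtain ⟨hg2, hne⟩ := branch_of_regular hn.wf hT hd hv
        -- The graph without v is already reduced, so the next branching acts on it unchanged and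
        -- its drops add to the 2 gained here.
        have hnb := (norm_spec h5.wf_right).eq hg2
        have hpsi := psi_put_vertex hn.wf hv
        cases f with
        | zero => exact trivial_b _ (leaves_zero _)
        | succ f =>
          rcases decideOrBranch_spec h5.wf_right hg2 with ⟨g1, -⟩ | ⟨g1, g2, -⟩
          · exact trivial_b _ (leaves_none (by rw [step, hnb]; exact g1))
          · obtain ⟨c, d, g4, g5, hdrop⟩ := hne g2
            rw [g4] at g1
            have hlv : leaves (f + 1) (putSt (norm s) [v]) = leaves f c + leaves f d :=
              leaves_some (by rw [step, hnb]; exact g1)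
            rw [hlv]
            push_cast
            have fin2 : ∀ p q : ℕ, p ≤ 7 → q ≤ 7 → x ^ 7 + (x ^ (p + 2) + x ^ (q + 2)) ≤ 1 →
                Drop (putSt (norm s) [v]) c d p q →
                (leaves (f + 1) a : ℝ) + (leaves f c + leaves f d) ≤ W := by
              intro p q hp hq hpq hd
              have h1 := hd.1
              have h2 := hd.2
              have e2 := desc f (norm s) c (p + 2) (by omega) g5.wf_left h3 (by omega)
                (by push_cast; omega)
              have e3 := desc f (norm s) d (q + 2) (by omega) g5.wf_right h3 (by omega)
                (by push_cast; omega)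
              have e4 := mul_le_mul_of_nonneg_left hpq hW0
              rw [hW] at e2 e3
              linarith
            rcases hdrop with h | h | h
            · exact fin2 6 4 (by norm_num) (by norm_num) b6 h
            · exact fin2 7 3 (by norm_num) (by norm_num) b7 h
            · exact fin2 5 5 (by norm_num) (by norm_num) b8 h

open TreeLang

/-! ### The algorithm runs in polynomial time between branchings -/

/-- All vertex names in the list of pairs are at most `c`. -/
def PairsLe (c : ℕ) (M : List (ℕ × ℕ)) : Prop := ∀ e ∈ M, e.1 ≤ c ∧ e.2 ≤ c

theorem esize_pairs {c : ℕ} {M : List (ℕ × ℕ)} (h : PairsLe c M) :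
    esize M ≤ M.length * (4 * c + 4) + 1 := by
  refine esize_list_le fun e he => ?_
  have := h e he
  rw [esize_prod, esize_nat, esize_nat]
  omega

theorem esize_names {c : ℕ} {l : List ℕ} (h : ∀ y ∈ l, y ≤ c) :
    esize l ≤ l.length * (2 * c + 2) + 1 := by
  refine esize_list_le fun e he => ?_
  have := h e he
  rw [esize_nat]
  omega

theorem names_le {l : List ℕ} {c : ℕ} (h : esize l ≤ c) : ∀ y ∈ l, y ≤ c := fun y hy => by
  have := esize_le_of_mem hy
  rw [esize_nat] at this
  omega

theorem pairs_le {l : List (ℕ × ℕ)} {c : ℕ} (h : esize l ≤ c) : PairsLe c l := fun y hy => by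
  have := esize_le_of_mem hy
  rw [esize_prod, esize_nat, esize_nat] at this
  omega

theorem PairsLe.cons {c : ℕ} {e : ℕ × ℕ} {M : List (ℕ × ℕ)} (h : PairsLe c M) (h1 : e.1 ≤ c)
    (h2 : e.2 ≤ c) : PairsLe c (e :: M) := fun f hf => by
  rcases List.mem_cons.1 hf with rfl | hf
  · exact ⟨h1, h2⟩
  · exact h f hf

theorem partner_le {c : ℕ} {M : List (ℕ × ℕ)} {x y : ℕ} (h : PairsLe c M)
    (hp : partner M y = some x) : x ≤ c := by
  unfold partner at hp
  cases hf : M.find? fun e => decide (e.1 = y) with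
  | none => simp [hf] at hp
  | some e =>
    simp only [hf, Option.elim_some, Option.some.injEq] at hp
    exact hp ▸ (h e (List.mem_of_find?_eq_some hf)).2

theorem shift_le {c x₀ : ℕ} {M : List (ℕ × ℕ)} (hM : PairsLe c M) (hx : x₀ ≤ c) :
    ∀ p : List (ℕ × ℕ), PairsLe c p → PairsLe c (shift M x₀ p).1 ∧ (shift M x₀ p).2 ≤ c ∧
      (shift M x₀ p).1.length = M.length + p.length := by
  intro p
  induction p with
  | nil => exact fun _ => ⟨hM, hx, rfl⟩
  | cons e p ih =>
    intro hp
    obtain ⟨h1, h2, h3⟩ := ih fun f hf => hp f (List.mem_cons_of_mem _ hf)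
    have he := hp e List.mem_cons_self
    refine ⟨h1.cons he.2 h2, he.1, ?_⟩
    change ((e.2, (shift M x₀ p).2) :: (shift M x₀ p).1).length = _
    simp [h3]; omega

/-- Bounds for the state of a search after `m` steps. -/
structure SearchLe (c : ℕ) (M : List (ℕ × ℕ)) (Y₀ : List ℕ) (m : ℕ) (s : Search) : Prop where
  reached : s.1.length ≤ m + 1
  paths : ∀ p ∈ s.1, p.length ≤ m ∧ PairsLe c p
  visited : s.2.1.length ≤ Y₀.length + m
  names : ∀ y ∈ s.2.1, y ≤ c
  result : ∀ M', s.2.2 = some M' → M'.length ≤ M.length + m ∧ PairsLe c M'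

theorem search_le {E M : List (ℕ × ℕ)} {V Y₀ : List ℕ} {x₀ c : ℕ} (hV : ∀ y ∈ V, y ≤ c)
    (hM : PairsLe c M) (hx : x₀ ≤ c) (hY : ∀ y ∈ Y₀, y ≤ c) (m : ℕ) :
    SearchLe c M Y₀ m ((searchStep E V M x₀)^[m] ([[]], Y₀, none)) := by
  induction m with
  | zero => exact ⟨by simp, by simp [PairsLe], by simp, hY, by simp⟩
  | succ m ih =>
    rw [Function.iterate_succ_apply']
    generalize (searchStep E V M x₀)^[m] ([[]], Y₀, none) = s at ih
    have mono : SearchLe c M Y₀ (m + 1) s :=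
      ⟨ih.reached.trans (by omega), fun p hp => ⟨(ih.paths p hp).1.trans (by omega),
        (ih.paths p hp).2⟩, ih.visited.trans (by omega), ih.names,
        fun M' h => ⟨(ih.result M' h).1.trans (by omega), (ih.result M' h).2⟩⟩
    unfold searchStep
    split_ifs
    · exact mono
    · cases hf : frontier E V x₀ s.1 s.2.1 with
      | none => exact mono
      | some d =>
        obtain ⟨hp, hy, -, -⟩ := mem_frontier hf
        have hp' := ih.paths _ hp
        have hyc := hV _ hy
        simp only [Option.elim_some]
        cases hpar : partner M d.2 with
        | none =>
          obtain ⟨h1, h2, h3⟩ := shift_le hM hx d.1 hp'.2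
          refine ⟨mono.reached, mono.paths, mono.visited, mono.names, fun M' h => ?_⟩
          simp only [Option.elim_none, Option.some.injEq] at h
          subst h
          refine ⟨?_, h1.cons hyc h2⟩
          simp only [List.length_cons, h3]
          omega
        | some x =>
          have hxc := partner_le hM hpar
          refine ⟨?_, fun p hp => ?_, ?_, fun y hy => ?_, fun M' h => by simp at h⟩
          · have := ih.reached
            simp only [Option.elim_some, List.length_cons]
            omega
          · rcases List.mem_cons.1 hp with rfl | hp
            · exact ⟨by simp only [List.length_cons]; omega, hp'.2.cons hxc hyc⟩
            · exact mono.paths p hp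
          · have := ih.visited
            simp only [Option.elim_some, List.length_cons]
            omega
          · rcases List.mem_cons.1 hy with rfl | hy
            · exact hyc
            · exact ih.names y hy

theorem pathEnd_le {c x₀ : ℕ} {p : List (ℕ × ℕ)} (hx : x₀ ≤ c) (hp : PairsLe c p) :
    pathEnd x₀ p ≤ c := by
  cases p with
  | nil => exact hx
  | cons e p => exact (hp e List.mem_cons_self).1

/-- Bounds for the state of the matching procedure after `m` vertices have been tried. -/
structure MatchLe (c w m : ℕ) (s : List (ℕ × ℕ) × List ℕ × List ℕ) : Prop where
  len : s.1.length ≤ m * w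
  pairs : PairsLe c s.1
  len_left : s.2.1.length ≤ m * (w + 1)
  left : ∀ x ∈ s.2.1, x ≤ c
  len_right : s.2.2.length ≤ m * w
  right : ∀ x ∈ s.2.2, x ≤ c

/-- Overridden pairs are never deleted, so the matching list grows, but by at most |V| entries for
each vertex tried. All names come from the vertices and stay at most `c`. -/
theorem matchAll_le {E : List (ℕ × ℕ)} {V : List ℕ} {c : ℕ} (hV : ∀ y ∈ V, y ≤ c) (D : List ℕ)
    (hD : ∀ y ∈ D, y ≤ c) :
    MatchLe c V.length D.length (D.foldr (matchStep E V) ([], [], [])) := by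
  induction D with
  | nil => constructor <;> simp [PairsLe]
  | cons x D ih =>
    have h := ih fun y hy => hD y (List.mem_cons_of_mem _ hy)
    rw [List.foldr_cons]
    generalize D.foldr (matchStep E V) ([], [], []) = s at h
    have hx := hD x List.mem_cons_self
    have hs := search_le (E := E) hV h.pairs hx h.right V.length
    have h1 := h.len
    have h2 := h.len_left
    have h3 := h.len_right
    change SearchLe _ _ _ _ (search E V s.1 s.2.2 x) at hs
    have e1 : matchStep E V x s = (search E V s.1 s.2.2 x).2.2.elim
        (s.1, ((search E V s.1 s.2.2 x).1.map (pathEnd x)) ++ s.2.1, (search E V s.1 s.2.2 x).2.1)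
        fun M => (M, s.2) := rfl
    rw [e1]
    generalize search E V s.1 s.2.2 x = r at hs
    cases ho : r.2.2 with
    | some M' =>
      have := hs.result M' ho
      refine ⟨?_, this.2, ?_, h.left, ?_, h.right⟩ <;>
      · simp only [Option.elim_some, List.length_cons, Nat.add_mul, Nat.one_mul] at *
        omega
    | none =>
      have h4 := hs.reached
      have h5 := hs.visited
      refine ⟨?_, h.pairs, ?_, fun y hy => ?_, ?_, hs.names⟩
      · simp only [Option.elim_none, List.length_cons, Nat.add_mul, Nat.one_mul] at *
        omega
      · simp only [Option.elim_none, List.length_cons, Nat.add_mul, Nat.one_mul,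
          List.length_append, List.length_map] at *
        omega
      · rcases List.mem_append.1 hy with hy | hy
        · obtain ⟨p, hp, rfl⟩ := List.mem_map.1 hy
          exact pathEnd_le hx (hs.paths p hp).2
        · exact h.left y hy
      · simp only [Option.elim_none, List.length_cons, Nat.add_mul, Nat.one_mul] at *
        omega

/-! ### The operations of the algorithm in polynomial time -/

section
variable {α : Type} [Enc α] {e M p : α → List (ℕ × ℕ)} {V I Y : α → List ℕ} {a b x₀ : α → ℕ}

theorem fp_adj (he : FP e) (ha : FP a) (hb : FP b) : FP fun x => adj (e x) (a x) (b x) := by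
  refine FP.any (p := fun x f => (decide (f.1 = a x) && decide (f.2 = b x)) ||
    (decide (f.1 = b x) && decide (f.2 = a x))) he ?_
  have h1 := ha.comp (FP.fst (α := α) (β := ℕ × ℕ))
  have h2 := hb.comp (FP.fst (α := α) (β := ℕ × ℕ))
  have h3 : FP fun z : α × ℕ × ℕ => z.2.1 := FP.fst.comp FP.snd
  have h4 : FP fun z : α × ℕ × ℕ => z.2.2 := FP.snd.comp FP.snd
  exact ((h3.eq h1).and (h4.eq h2)).or ((h3.eq h2).and (h4.eq h1))

theorem fp_nbr (he : FP e) (hV : FP V) (hI : FP I) : FP fun x => nbr (e x) (V x) (I x) := by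
  refine FP.filter (p := fun x w => (I x).any fun i => adj (e x) i w) hV ?_
  exact FP.any (p := fun z i => adj (e z.1) i z.2) (hI.comp FP.fst)
    (fp_adj (he.comp (FP.fst.comp FP.fst)) FP.snd (FP.snd.comp FP.fst))

theorem fp_partner (hM : FP M) (ha : FP a) : FP fun x => partner (M x) (a x) := by
  refine FP.elim (o := fun x => (M x).find? fun f => decide (f.1 = a x))
    (f := fun _ f => some f.2) ?_ (.const none) (FP.snd.comp FP.snd).optionSome
  exact FP.find? (p := fun x f => decide (f.1 = a x)) hM
    ((FP.fst.comp FP.snd).eq (ha.comp FP.fst))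

theorem fp_pathEnd (hx : FP x₀) (hp : FP p) : FP fun x => pathEnd (x₀ x) (p x) :=
  FP.elim (f := fun (_ : α) (f : ℕ × ℕ) => f.1) hp.head? hx (FP.fst.comp FP.snd)

/-- Shifting only regroups the names in the path, the matching and `x₀`, so the size is additive and
accumulators in the fold stay small. -/
theorem esize_shift (M : List (ℕ × ℕ)) (x₀ : ℕ) (p : List (ℕ × ℕ)) :
    esize (shift M x₀ p) + 1 = esize (M, x₀) + esize p := by
  induction p with
  | nil => rfl
  | cons f p ih =>
    have h : shift M x₀ (f :: p) = ((f.2, (shift M x₀ p).2) :: (shift M x₀ p).1, f.1) := rfl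
    rw [esize_prod] at ih
    rw [h]
    simp only [esize_cons, esize_mk, esize_prod f] at ih ⊢
    omega

theorem fp_shift (hM : FP M) (hx : FP x₀) (hp : FP p) : FP fun x => shift (M x) (x₀ x) (p x) := by
  obtain ⟨q, hq⟩ := (hM.pair hx).size
  refine FP.foldr_bound (s := fun _ f acc => ((f.2, acc.2) :: acc.1, f.1)) hp (hM.pair hx) ?_
    (q + .X) fun x l' => ?_
  · have h1 : FP fun z : α × (ℕ × ℕ) × List (ℕ × ℕ) × ℕ => z.2.1 := FP.fst.comp FP.snd
    have h2 : FP fun z : α × (ℕ × ℕ) × List (ℕ × ℕ) × ℕ => z.2.2 := FP.snd.comp FP.snd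
    exact (((FP.snd.comp h1).pair (FP.snd.comp h2)).cons (FP.fst.comp h2)).pair (FP.fst.comp h1)
  · have h1 := esize_shift (M x) (x₀ x) l'
    have h2 := (hq x).trans (poly_mono q (Nat.le_add_right _ (esize l')))
    change esize (shift (M x) (x₀ x) l') ≤ _
    simp only [Polynomial.eval_add, Polynomial.eval_X]
    omega

theorem fp_frontier {R : α → List (List (ℕ × ℕ))} (he : FP e) (hV : FP V) (hx : FP x₀)
    (hR : FP R) (hY : FP Y) : FP fun x => frontier (e x) (V x) (x₀ x) (R x) (Y x) := by
  refine FP.head? (FP.flatMap (f := fun x p =>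
    ((V x).filter fun y => adj (e x) (pathEnd (x₀ x) p) y && !decide (y ∈ Y x)).map
      fun y => (p, y)) hR ?_)
  refine FP.map (f := fun (z : α × List (ℕ × ℕ)) (y : ℕ) => (z.2, y)) ?_
    ((FP.snd.comp FP.fst).pair FP.snd)
  refine FP.filter (p := fun (z : α × List (ℕ × ℕ)) (y : ℕ) => adj (e z.1) (pathEnd (x₀ z.1) z.2) y && !decide (y ∈ Y z.1))
    (hV.comp FP.fst) ?_
  have h1 : FP fun z : (α × List (ℕ × ℕ)) × ℕ => z.1.1 := FP.fst.comp FP.fst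
  exact (fp_adj (he.comp h1) (fp_pathEnd (hx.comp h1) (FP.snd.comp FP.fst)) FP.snd).and
    (FP.snd.mem (hY.comp h1)).not

theorem fp_searchStep {s : α → Search} (he : FP e) (hV : FP V) (hM : FP M) (hx : FP x₀)
    (hs : FP s) : FP fun x => searchStep (e x) (V x) (M x) (x₀ x) (s x) := by
  have s1 : FP fun x => (s x).1 := FP.fst.comp hs
  have s2 : FP fun x => (s x).2 := FP.snd.comp hs
  have s21 : FP fun x => (s x).2.1 := FP.fst.comp s2
  refine FP.ite (FP.snd.comp s2).isSome hs ?_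
  refine FP.elim (f := fun (x : α) (c : List (ℕ × ℕ) × ℕ) => (partner (M x) c.2).elim
    ((s x).1, (s x).2.1, some ((c.2, (shift (M x) (x₀ x) c.1).2) :: (shift (M x) (x₀ x) c.1).1))
    fun y => (((y, c.2) :: c.1) :: (s x).1, c.2 :: (s x).2.1, (none : Option (List (ℕ × ℕ)))))
    (fp_frontier he hV hx s1 s21) hs ?_
  have c1 : FP fun z : α × List (ℕ × ℕ) × ℕ => z.2.1 := FP.fst.comp FP.snd
  have c2 : FP fun z : α × List (ℕ × ℕ) × ℕ => z.2.2 := FP.snd.comp FP.snd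
  have hsh := fp_shift (hM.comp FP.fst) (hx.comp FP.fst) c1
  refine FP.elim (f := fun (z : α × List (ℕ × ℕ) × ℕ) (y : ℕ) =>
    (((y, z.2.2) :: z.2.1) :: (s z.1).1, z.2.2 :: (s z.1).2.1, (none : Option (List (ℕ × ℕ)))))
    (fp_partner (hM.comp FP.fst) c2) ?_ ?_
  · exact (s1.comp FP.fst).pair ((s21.comp FP.fst).pair
      ((c2.pair (FP.snd.comp hsh)).cons (FP.fst.comp hsh)).optionSome)
  · have z1 : FP fun z : (α × List (ℕ × ℕ) × ℕ) × ℕ => z.1.1 := FP.fst.comp FP.fst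
    exact (((FP.snd.pair (c2.comp FP.fst)).cons (c1.comp FP.fst)).cons (s1.comp z1)).pair
      (((c2.comp FP.fst).cons (s21.comp z1)).pair (.const none))

theorem mul_add_le {a b c d : ℕ} (h1 : a ≤ c) (h2 : b ≤ d) : a * b + 1 ≤ c * d + 1 :=
  Nat.add_le_add_right (Nat.mul_le_mul h1 h2) 1

theorem SearchLe.size {c m n : ℕ} {M : List (ℕ × ℕ)} {Y₀ : List ℕ} {s : Search}
    (h : SearchLe c M Y₀ m s) (hc : c ≤ n) (hm : m ≤ n) (hM : M.length ≤ n) (hY : Y₀.length ≤ n) :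
    esize s ≤ ((n + 1) * (n * (4 * n + 4) + 2) + 1) + (2 * n * (2 * n + 2) + 1) +
      (2 * n * (4 * n + 4) + 1) + 4 := by
  obtain ⟨R, Y, o⟩ := s
  have h1 : esize R ≤ (n + 1) * (n * (4 * n + 4) + 2) + 1 := by
    refine (esize_list_le (c := n * (4 * n + 4) + 1) fun p hp => ?_).trans
      (mul_add_le (h.reached.trans (by omega)) le_rfl)
    have := h.paths p hp
    exact (esize_pairs this.2).trans (mul_add_le (by omega) (by omega))
  have h2 : esize Y ≤ 2 * n * (2 * n + 2) + 1 :=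
    (esize_names h.names).trans (mul_add_le (h.visited.trans (by omega)) (by omega))
  have h3 : esize o ≤ 2 * n * (4 * n + 4) + 1 + 2 := by
    cases o with
    | none => simp
    | some M' =>
      have := h.result M' rfl
      rw [esize_some]
      exact Nat.add_le_add_right ((esize_pairs this.2).trans (mul_add_le (by omega) (by omega))) 2
  simp only [esize_mk]
  omega

theorem fp_search (he : FP e) (hV : FP V) (hM : FP M) (hY : FP Y) (hx : FP x₀) :
    FP fun x => search (e x) (V x) (M x) (Y x) (x₀ x) := by
  obtain ⟨q, hq⟩ := (hV.pair (hM.pair (hY.pair hx))).size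
  let B : Polynomial ℕ := ((.X + 1) * (.X * (4 * .X + 4) + 2) + 1) + (2 * .X * (2 * .X + 2) + 1) +
      (2 * .X * (4 * .X + 4) + 1) + 4
  refine FP.iterate (s := fun x s => searchStep (e x) (V x) (M x) (x₀ x) s) hV.length
    ((FP.const [[]]).pair (hY.pair (.const none)))
    (fp_searchStep (he.comp FP.fst) (hV.comp FP.fst) (hM.comp FP.fst) (hx.comp FP.fst) FP.snd)
    (B.comp q) fun x m hm => ?_
  have h0 := hq x
  simp only [esize_mk, esize_nat] at h0
  have hl1 := length_lt_esize (V x)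
  have hl2 := length_lt_esize (M x)
  have hl3 := length_lt_esize (Y x)
  refine ((search_le (c := q.eval (esize x)) (names_le (by omega)) (pairs_le (by omega)) (by omega)
    (names_le (by omega)) m).size le_rfl (by omega) (by omega) (by omega)).trans (le_of_eq ?_)
  simp [B]

theorem fp_matchStep {s : α → List (ℕ × ℕ) × List ℕ × List ℕ} (he : FP e) (hV : FP V) (hx : FP x₀)
    (hs : FP s) : FP fun x => matchStep (e x) (V x) (x₀ x) (s x) := by
  have s2 : FP fun x => (s x).2 := FP.snd.comp hs
  have hr := fp_search he hV (FP.fst.comp hs) (FP.snd.comp s2) hx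
  refine FP.elim (f := fun x M => (M, (s x).2)) (FP.snd.comp (FP.snd.comp hr)) ?_
    (FP.snd.pair (s2.comp FP.fst))
  refine (FP.fst.comp hs).pair (FP.pair (FP.append ?_ (FP.fst.comp s2)) (FP.fst.comp (FP.snd.comp hr)))
  exact FP.map (f := fun x p => pathEnd (x₀ x) p) (FP.fst.comp hr)
    (fp_pathEnd (hx.comp FP.fst) FP.snd)

theorem fp_matchAll (he : FP e) (hV : FP V) : FP fun x => matchAll (e x) (V x) := by
  obtain ⟨q, hq⟩ := hV.size
  refine FP.foldr (s := fun x y s => matchStep (e x) (V x) y s) hV (.const _)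
    (fp_matchStep (he.comp FP.fst) (hV.comp FP.fst) (FP.fst.comp FP.snd) (FP.snd.comp FP.snd))
    ((.X * .X * (4 * .X + 4) + 1 + (.X * (.X + 1) * (2 * .X + 2) + 1) +
      (.X * .X * (2 * .X + 2) + 1) + 2 : Polynomial ℕ).comp q) fun x l' hl' => ?_
  have h0 := hq x
  have hVl := length_lt_esize (V x)
  have hn := names_le h0
  have h := matchAll_le (E := e x) hn l' fun y hy => hn y (hl'.subset hy)
  have hD := hl'.length_le
  have h1 := (esize_pairs h.pairs).trans (mul_add_le (h.len.trans (Nat.mul_le_mul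
    (show _ ≤ q.eval (esize x) by omega) (show _ ≤ q.eval (esize x) by omega))) le_rfl)
  have h2 := (esize_names h.left).trans (mul_add_le (h.len_left.trans (Nat.mul_le_mul
    (show _ ≤ q.eval (esize x) by omega) (show _ ≤ q.eval (esize x) + 1 by omega))) le_rfl)
  have h3 := (esize_names h.right).trans (mul_add_le (h.len_right.trans (Nat.mul_le_mul
    (show _ ≤ q.eval (esize x) by omega) (show _ ≤ q.eval (esize x) by omega))) le_rfl)
  have e1 := esize_prod (l'.foldr (matchStep (e x) (V x)) ([], [], []))
  have e2 := esize_prod (l'.foldr (matchStep (e x) (V x)) ([], [], [])).2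
  change esize (l'.foldr (matchStep (e x) (V x)) ([], [], [])) ≤ _
  simp only [Polynomial.eval_comp, Polynomial.eval_add, Polynomial.eval_mul, Polynomial.eval_X,
    Polynomial.eval_ofNat, Polynomial.eval_one]
  omega

theorem fp_crit (he : FP e) (hV : FP V) : FP fun x => crit (e x) (V x) := by
  have h := fp_matchAll he hV
  refine FP.filter (p := fun x y => decide (y ∈ (matchAll (e x) (V x)).2.1) &&
    !decide (y ∈ (matchAll (e x) (V x)).2.2)) hV ?_
  exact (FP.snd.mem ((FP.fst.comp (FP.snd.comp h)).comp FP.fst)).and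
    (FP.snd.mem ((FP.snd.comp (FP.snd.comp h)).comp FP.fst)).not

theorem fp_extend {S : α → List ℕ} (he : FP e) (hV : FP V) (hS : FP S) :
    FP fun x => extend (e x) (V x) (S x) := by
  refine FP.append (fp_crit he ?_) hS
  exact FP.filter (p := fun x w => !decide (w ∈ S x) && !decide (w ∈ nbr (e x) (V x) (S x))) hV
    ((FP.snd.mem (hS.comp FP.fst)).not.and (FP.snd.mem ((fp_nbr he hV hS).comp FP.fst)).not)

theorem fp_lowSurplus {Js : α → List (List ℕ)} (he : FP e) (hV : FP V) (hJ : FP Js) (t : ℕ) :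
    FP fun x => lowSurplus (e x) (V x) (Js x) t :=
  FP.find? (p := fun x J => decide ((nbr (e x) (V x) J).length ≤ J.length + t)) hJ
    ((fp_nbr (he.comp FP.fst) (hV.comp FP.fst) FP.snd).length.le (FP.snd.length.add (.const t)))

theorem fp_singles (he : FP e) (hV : FP V) : FP fun x => singles (e x) (V x) :=
  FP.map (f := fun x v => extend (e x) (V x) [v]) hV
    (fp_extend (he.comp FP.fst) (hV.comp FP.fst) (FP.snd.cons (.const [])))

theorem fp_pairs (he : FP e) (hV : FP V) : FP fun x => pairs (e x) (V x) := by
  have h1 : FP fun z : (α × ℕ) × ℕ => z.1.1 := FP.fst.comp FP.fst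
  have h2 : FP fun z : (α × ℕ) × ℕ => z.1.2 := FP.snd.comp FP.fst
  have h3 : FP fun z : α × ℕ => (V z.1).filter fun b => !decide (z.2 = b) && !adj (e z.1) z.2 b :=
    FP.filter (p := fun (z : α × ℕ) b => !decide (z.2 = b) && !adj (e z.1) z.2 b) (hV.comp FP.fst)
      ((h2.eq FP.snd).not.and (fp_adj (he.comp h1) h2 FP.snd).not)
  have h4 : FP fun z : (α × ℕ) × ℕ => extend (e z.1.1) (V z.1.1) [z.1.2, z.2] :=
    fp_extend (he.comp h1) (hV.comp h1) (h2.cons (FP.snd.cons (.const [])))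
  have h5 := FP.map (f := fun (z : α × ℕ) b => extend (e z.1) (V z.1) [z.2, b]) h3 h4
  exact FP.flatMap (f := fun x a => ((V x).filter fun b => !decide (a = b) && !adj (e x) a b).map
    fun b => extend (e x) (V x) [a, b]) hV h5

theorem fp_hasEdge (he : FP e) (hI : FP I) : FP fun x => hasEdge (e x) (I x) := by
  refine FP.any (p := fun x a => (I x).any fun b => adj (e x) a b) hI ?_
  exact FP.any (p := fun z b => adj (e z.1) z.2 b) (hI.comp FP.fst)
    (fp_adj (he.comp (FP.fst.comp FP.fst)) (FP.snd.comp FP.fst) FP.snd)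

theorem fp_rename (hI : FP I) (ha : FP a) (hb : FP b) : FP fun x => rename (I x) (a x) (b x) :=
  (hb.mem hI).ite ha hb

theorem fp_deg (he : FP e) (hV : FP V) (ha : FP a) : FP fun x => deg (e x) (V x) (a x) :=
  (fp_nbr he hV (ha.cons (.const []))).length

theorem fp_pick (he : FP e) (hV : FP V) : FP fun x => pick (e x) (V x) := by
  have hd : FP fun z : α × ℕ => deg (e z.1) (V z.1) z.2 :=
    fp_deg (he.comp FP.fst) (hV.comp FP.fst) FP.snd
  have hs : FP fun z : α × ℕ => some z.2 := FP.snd.optionSome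
  refine FP.elim (f := fun _ v => some v)
    (FP.find? (p := fun x v => decide (5 ≤ deg (e x) (V x) v)) hV ((FP.const 5).le hd)) ?_ hs
  refine FP.elim (f := fun _ v => some v)
    (FP.find? (p := fun x v => decide (4 ≤ deg (e x) (V x) v) &&
      (nbr (e x) (V x) [v]).any fun w => decide (deg (e x) (V x) w ≤ 3)) hV ?_) ?_ hs
  · refine ((FP.const 4).le hd).and (FP.any
      (p := fun z w => decide (deg (e z.1) (V z.1) w ≤ 3))
      (fp_nbr (he.comp FP.fst) (hV.comp FP.fst) (FP.snd.cons (.const []))) ?_)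
    exact (fp_deg (he.comp (FP.fst.comp FP.fst)) (hV.comp (FP.fst.comp FP.fst)) FP.snd).le
      (.const 3)
  · exact FP.elim (f := fun _ v => some v)
      (FP.find? (p := fun x v => decide (deg (e x) (V x) v ≤ 3)) hV (hd.le (.const 3)))
      hV.head? hs

/-! ### Operations on states -/

variable {s : α → St} {J : α → List ℕ}

theorem fp_remSt (hs : FP s) (hJ : FP J) : FP fun x => remSt (s x) (J x) := by
  have s1 : FP fun x => (s x).1 := FP.fst.comp hs
  have s21 : FP fun x => (s x).2.1 := FP.fst.comp (FP.snd.comp hs)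
  have s22 : FP fun x => (s x).2.2 := FP.snd.comp (FP.snd.comp hs)
  have hN := fp_nbr s1 s21 hJ
  refine s1.pair (FP.pair ?_ (((FP.fst.comp s22).add hN.length).pair (FP.snd.comp s22)))
  exact FP.filter (p := fun x w => !decide (w ∈ J x) && !decide (w ∈ nbr (s x).1 (s x).2.1 (J x)))
    s21 ((FP.snd.mem (hJ.comp FP.fst)).not.and (FP.snd.mem (hN.comp FP.fst)).not)

theorem fp_putSt (hs : FP s) (hJ : FP J) : FP fun x => putSt (s x) (J x) := by
  have s1 : FP fun x => (s x).1 := FP.fst.comp hs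
  have s21 : FP fun x => (s x).2.1 := FP.fst.comp (FP.snd.comp hs)
  have s22 : FP fun x => (s x).2.2 := FP.snd.comp (FP.snd.comp hs)
  refine s1.pair (FP.pair ?_ (((FP.fst.comp s22).add hJ.length).pair (FP.snd.comp s22)))
  exact FP.filter (p := fun x w => !decide (w ∈ J x)) s21 (FP.snd.mem (hJ.comp FP.fst)).not

theorem fp_foldSt (hs : FP s) (hJ : FP J) : FP fun x => foldSt (s x) (J x) := by
  have s1 : FP fun x => (s x).1 := FP.fst.comp hs
  have s21 : FP fun x => (s x).2.1 := FP.fst.comp (FP.snd.comp hs)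
  have s22 : FP fun x => (s x).2.2 := FP.snd.comp (FP.snd.comp hs)
  have hN := fp_nbr s1 s21 hJ
  have hz : FP fun x => foldVertex (s x) (J x) :=
    FP.elim (f := fun _ z => z) hN.head? (.const 0) FP.snd
  refine FP.pair ?_ (FP.pair ?_ (((FP.fst.comp s22).add hJ.length).pair (FP.snd.comp s22)))
  · refine FP.map (f := fun x e => (rename (nbr (s x).1 (s x).2.1 (J x)) (foldVertex (s x) (J x)) e.1,
      rename (nbr (s x).1 (s x).2.1 (J x)) (foldVertex (s x) (J x)) e.2)) s1 ?_
    exact (fp_rename (hN.comp FP.fst) (hz.comp FP.fst) (FP.fst.comp FP.snd)).pair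
      (fp_rename (hN.comp FP.fst) (hz.comp FP.fst) (FP.snd.comp FP.snd))
  · exact FP.filter (p := fun x w => !decide (w ∈ J x) && (decide (w = foldVertex (s x) (J x)) ||
      !decide (w ∈ nbr (s x).1 (s x).2.1 (J x)))) s21
      ((FP.snd.mem (hJ.comp FP.fst)).not.and ((FP.snd.eq (hz.comp FP.fst)).or
        (FP.snd.mem (hN.comp FP.fst)).not))

theorem fp_red (hs : FP s) : FP fun x => red (s x) := by
  have s1 : FP fun x => (s x).1 := FP.fst.comp hs
  have s21 : FP fun x => (s x).2.1 := FP.fst.comp (FP.snd.comp hs)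
  have hc := fp_crit s1 s21
  have hsing := fp_singles s1 s21
  refine hc.isEmpty.ite ?_ (fp_remSt hs hc).optionSome
  refine FP.elim (f := fun x J => some (remSt (s x) J)) (fp_lowSurplus s1 s21 hsing 0) ?_
    (fp_remSt (hs.comp FP.fst) FP.snd).optionSome
  refine FP.elim (f := fun x J => some (if hasEdge (s x).1 (nbr (s x).1 (s x).2.1 J) then
    remSt (s x) J else foldSt (s x) J)) (fp_lowSurplus s1 s21 hsing 1) (.const none) ?_
  exact (FP.ite (fp_hasEdge (s1.comp FP.fst) (fp_nbr (s1.comp FP.fst) (s21.comp FP.fst) FP.snd))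
    (fp_remSt (hs.comp FP.fst) FP.snd) (fp_foldSt (hs.comp FP.fst) FP.snd)).optionSome

theorem fp_branch (hs : FP s) : FP fun x => branch (s x) := by
  have s1 : FP fun x => (s x).1 := FP.fst.comp hs
  have s21 : FP fun x => (s x).2.1 := FP.fst.comp (FP.snd.comp hs)
  refine FP.elim (f := fun x J => some (remSt (s x) J, putSt (s x) J))
    (fp_lowSurplus s1 s21 (fp_pairs s1 s21) 2) ?_
    ((fp_remSt (hs.comp FP.fst) FP.snd).pair (fp_putSt (hs.comp FP.fst) FP.snd)).optionSome
  have hv : FP fun z : α × ℕ => [z.2] := FP.snd.cons (.const [])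
  exact FP.elim (f := fun x v => some (remSt (s x) [v], putSt (s x) [v])) (fp_pick s1 s21)
    (.const none)
    ((fp_remSt (hs.comp FP.fst) hv).pair (fp_putSt (hs.comp FP.fst) hv)).optionSome

end

/-! ### Sizes of states -/

/-- Vertex names are at most `c`, there are at most `l` edges, `V.length + u` is at most `w` and
the bound is at most `k`. -/
structure Small (c l w k : ℕ) (s : St) : Prop where
  edges : PairsLe c s.1
  edges_length : s.1.length ≤ l
  names : ∀ v ∈ s.2.1, v ≤ c
  vertices : s.2.1.length + s.2.2.1 ≤ w
  bound : s.2.2.2 ≤ k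

section
variable {c l w k : ℕ} {s : St} {J : List ℕ}

theorem Small.size (h : Small c l w k s) :
    esize s ≤ l * (4 * c + 4) + 1 + (w * (2 * c + 2) + 1) + (2 * w + 1) + (2 * k + 1) + 3 := by
  have h1 := (esize_pairs h.edges).trans (mul_add_le h.edges_length le_rfl)
  have h4 := h.vertices
  have h2 := (esize_names h.names).trans (mul_add_le (show _ ≤ w by omega) le_rfl)
  have h3 := h.bound
  obtain ⟨E, V, u, K⟩ := s
  simp only [esize_mk, esize_nat] at *
  omega

theorem length_filter_disjoint {V : List ℕ} {p q : ℕ → Bool} (h : ∀ w ∈ V, p w → ¬ q w) :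
    (V.filter p).length + (V.filter q).length ≤ V.length := by
  induction V with
  | nil => simp
  | cons a V ih =>
    have h1 := ih fun w hw => h w (List.mem_cons_of_mem _ hw)
    have h2 := h a List.mem_cons_self
    rw [List.filter_cons, List.filter_cons, List.length_cons]
    split_ifs with h3 h4 h4
    · exact absurd h4 (h2 h3)
    · simp only [List.length_cons]; omega
    · simp only [List.length_cons]; omega
    · omega

theorem Small.rem (h : Small c l w k s) : Small c l w k (remSt s J) := by
  refine ⟨h.edges, h.edges_length, fun v hv => h.names v (List.mem_filter.1 hv).1, ?_, h.bound⟩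
  have h1 := h.vertices
  -- The vertices kept and those put into the cover are disjoint parts of the vertex list, so their
  -- total number does not grow.
  have h2 := length_filter_disjoint (V := s.2.1)
    (p := fun w => !decide (w ∈ J) && !decide (w ∈ nbr s.1 s.2.1 J))
    (q := fun w => J.any fun i => adj s.1 i w) fun w hw hp hq => by
      simp only [Bool.and_eq_true, Bool.not_eq_true', decide_eq_false_iff_not] at hp
      exact hp.2 (List.mem_filter.2 ⟨hw, hq⟩)
  change (s.2.1.filter _).length + (s.2.2.1 + (s.2.1.filter _).length) ≤ w
  omega

theorem length_filter_subperm {V : List ℕ} {p : ℕ → Bool} (hJ : J.Subperm V)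
    (hp : ∀ w ∈ J, p w = false) : (V.filter p).length + J.length ≤ V.length := by
  have h1 := length_filter_disjoint (V := V) (p := p) (q := fun w => !p w) (by simp)
  have h2 := (hJ.filter fun w => !p w).length_le
  rw [List.filter_eq_self.2 fun w hw => by simp [hp w hw]] at h2
  omega

theorem Small.put (h : Small c l w k s) (hJ : J.Subperm s.2.1) : Small c l w k (putSt s J) := by
  refine ⟨h.edges, h.edges_length, fun v hv => h.names v (List.mem_filter.1 hv).1, ?_, h.bound⟩
  have h1 := h.vertices
  have h2 := length_filter_subperm hJ (p := fun w => !decide (w ∈ J)) (by simp)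
  change (s.2.1.filter _).length + (s.2.2.1 + J.length) ≤ w
  omega

/-- Renaming edges neither adds entries nor introduces names, since the folded vertex is an existing
one. -/
theorem Small.fold (h : Small c l w k s) (hJ : J.Subperm s.2.1) :
    Small c l w k (foldSt s J) := by
  have hz : (∃ e ∈ s.1, (e.1 ∈ nbr s.1 s.2.1 J) ∨ (e.2 ∈ nbr s.1 s.2.1 J)) →
      foldVertex s J ≤ c := by
    rintro ⟨e, -, he⟩
    unfold foldVertex
    cases hN : nbr s.1 s.2.1 J with
    | nil => simp [hN] at he
    | cons z N =>
      have : z ∈ nbr s.1 s.2.1 J := by rw [hN]; exact List.mem_cons_self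
      exact h.names z (List.mem_filter.1 this).1
  refine ⟨fun e he => ?_, by simpa [foldSt] using h.edges_length,
    fun v hv => h.names v (List.mem_filter.1 hv).1, ?_, h.bound⟩
  · obtain ⟨f, hf, rfl⟩ := List.mem_map.1 he
    have hfc := h.edges f hf
    constructor
    · simp only [rename]
      split_ifs with h1
      · exact hz ⟨f, hf, .inl (by simpa using h1)⟩
      · exact hfc.1
    · simp only [rename]
      split_ifs with h1
      · exact hz ⟨f, hf, .inr (by simpa using h1)⟩
      · exact hfc.2
  · have h1 := h.vertices
    have h2 := length_filter_subperm hJ (p := fun w => !decide (w ∈ J) &&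
      (decide (w = foldVertex s J) || !decide (w ∈ nbr s.1 s.2.1 J))) fun w hw => by simp [hw]
    change (s.2.1.filter _).length + (s.2.2.1 + J.length) ≤ w
    omega

theorem extend_subperm {E : List (ℕ × ℕ)} {V S : List ℕ} (hS : S ⊆ V) (hn : S.Nodup) :
    (extend E V S).Subperm V := by
  let p : ℕ → Bool := fun w => !decide (w ∈ S) && !decide (w ∈ nbr E V S)
  have h1 : (crit E (V.filter p)).Subperm (V.filter p) := crit_sublist.subperm
  have h2 : S.Subperm (V.filter fun w => !p w) :=
    hn.subperm fun a ha => List.mem_filter.2 ⟨hS ha, by simp [p, ha]⟩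
  exact (h1.append h2).trans (List.filter_append_perm p V).subperm

theorem singles_subperm {E : List (ℕ × ℕ)} {V : List ℕ} (hJ : J ∈ singles E V) :
    J.Subperm V := by
  obtain ⟨v, hv, rfl⟩ := List.mem_map.1 hJ
  exact extend_subperm (by simpa using hv) (by simp)

theorem pairs_subperm {E : List (ℕ × ℕ)} {V : List ℕ} (hJ : J ∈ pairs E V) :
    J.Subperm V := by
  simp only [pairs, List.mem_flatMap, List.mem_map, List.mem_filter] at hJ
  obtain ⟨a, ha, b, ⟨hb, hab⟩, rfl⟩ := hJ
  simp only [Bool.and_eq_true, Bool.not_eq_true', decide_eq_false_iff_not] at hab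
  exact extend_subperm (by simp [ha, hb]) (by simpa using hab.1)

theorem Small.redOrSelf (h : Small c l w k s) : Small c l w k (redOrSelf s) := by
  unfold VC.redOrSelf red
  split_ifs with h1
  · cases h2 : lowSurplus s.1 s.2.1 (singles s.1 s.2.1) 0 with
    | some J => exact h.rem
    | none =>
      cases h3 : lowSurplus s.1 s.2.1 (singles s.1 s.2.1) 1 with
      | none => exact h
      | some J =>
        simp only [Option.elim_some, Option.elim_none]
        split_ifs
        · exact h.rem
        · exact h.fold (singles_subperm (lowSurplus_some h3).1)
  · exact h.rem

theorem Small.iterate (h : Small c l w k s) (m : ℕ) : Small c l w k (VC.redOrSelf^[m] s) := by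
  induction m with
  | zero => exact h
  | succ m ih => rw [Function.iterate_succ_apply']; exact ih.redOrSelf

theorem Small.branch (h : Small c l w k s) {a b : St} (hb : branch s = some (a, b)) :
    Small c l w k a ∧ Small c l w k b := by
  unfold VC.branch at hb
  cases h2 : lowSurplus s.1 s.2.1 (pairs s.1 s.2.1) 2 with
  | some J =>
    simp only [h2, Option.elim_some, Option.some.injEq, Prod.mk.injEq] at hb
    obtain ⟨rfl, rfl⟩ := hb
    exact ⟨h.rem, h.put (pairs_subperm (lowSurplus_some h2).1)⟩
  | none =>
    cases h3 : pick s.1 s.2.1 with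
    | none => simp [h2, h3] at hb
    | some v =>
      simp only [h2, h3, Option.elim_some, Option.elim_none, Option.some.injEq,
        Prod.mk.injEq] at hb
      obtain ⟨rfl, rfl⟩ := hb
      refine ⟨h.rem, h.put ?_⟩
      have hv : v ∈ s.2.1 := by
        unfold pick at h3
        revert h3
        cases h4 : s.2.1.find? fun v => decide (5 ≤ deg s.1 s.2.1 v) with
        | some w => rintro ⟨⟩; exact List.mem_of_find?_eq_some h4
        | none =>
          cases h5 : s.2.1.find? fun v => decide (4 ≤ deg s.1 s.2.1 v) &&
              (nbr s.1 s.2.1 [v]).any fun w => decide (deg s.1 s.2.1 w ≤ 3) with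
          | some w => rintro ⟨⟩; exact List.mem_of_find?_eq_some h5
          | none =>
            cases h6 : s.2.1.find? fun v => decide (deg s.1 s.2.1 v ≤ 3) with
            | some w => rintro ⟨⟩; exact List.mem_of_find?_eq_some h6
            | none => exact fun h7 => List.mem_of_mem_head? h7
      exact List.singleton_subperm_iff.2 hv

theorem small_esize (s : St) : Small (esize s) (esize s) (2 * esize s) (esize s) s := by
  obtain ⟨E, V, u, K⟩ := s
  have h1 := length_lt_esize E
  have h2 := length_lt_esize V
  have h : esize (E, V, u, K) = esize E + (esize V + (2 * u + 1 + (2 * K + 1) + 1) + 1) + 1 := by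
    simp only [esize_mk, esize_nat]
  exact ⟨pairs_le (by simp only; omega), by simp only; omega, names_le (by simp only; omega),
    by simp only; omega, by simp only; omega⟩

end

/-! ### One search step in polynomial time -/

theorem fp_norm : FP norm := by
  have hV : FP fun s : St => s.2.1.length := (FP.fst.comp FP.snd).length
  refine FP.iterate (s := fun _ s => redOrSelf s) hV .id ?_
    (.X * (4 * .X + 4) + 1 + (2 * .X * (2 * .X + 2) + 1) + (2 * (2 * .X) + 1) + (2 * .X + 1) + 3)
    fun s m _ => ?_
  · exact FP.elim (f := fun _ t => t) (fp_red FP.snd) FP.snd FP.snd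
  · refine ((small_esize s).iterate m).size.trans (le_of_eq ?_)
    simp

theorem fp_step : FP step := by
  refine FP.comp (g := decideOrBranch) ?_ fp_norm
  have s2 : FP fun s : St => s.2.1 := FP.fst.comp FP.snd
  have s3 : FP fun s : St => s.2.2.1 := FP.fst.comp (FP.snd.comp FP.snd)
  have s4 : FP fun s : St => s.2.2.2 := FP.snd.comp (FP.snd.comp FP.snd)
  exact (((s2.length.add (s3.add s3)).le (s4.add s4))).ite
    (s2.isEmpty.ite (.const _) ((fp_branch .id).pair (.const false))) (.const _)

/-- The bounds are inherited without loss at every depth, so one polynomial bounds the work at all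
nodes. -/
theorem Small.step {c l w k : ℕ} {s a b : St} (h : Small c l w k s)
    (hb : (step s).1 = some (a, b)) : Small c l w k a ∧ Small c l w k b := by
  unfold VC.step decideOrBranch at hb
  split_ifs at hb
  exact Small.branch (h.iterate _) hb

open TreeLang TreeLang.Enc

/-! ### The initial state -/

/-- Rows of the adjacency matrix, sign and binary digits of the bound. -/
abbrev Input : Type := List (List Bool) × Bool × List Bool

def nth {β : Type} (l : List β) (i : ℕ) : Option β := (List.tail^[i] l).head?

theorem nth_eq {β : Type} (l : List β) (i : ℕ) : nth l i = l[i]? := by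
  unfold nth
  induction i generalizing l with
  | zero => simp [List.head?_eq_getElem?]
  | succ i ih => rw [Function.iterate_succ_apply, ih]; simp

def entry (rows : List (List Bool)) (i j : ℕ) : Bool :=
  (nth rows i).elim false fun row => (nth row j).elim false fun b => b

/-- The numbers below the length of the list, in descending order. -/
def indices (rows : List (List Bool)) : List ℕ :=
  rows.foldr (fun _ acc => acc.length :: acc) []

def edgesOf (rows : List (List Bool)) : List (ℕ × ℕ) :=
  (indices rows).flatMap fun i =>
    ((indices rows).filter fun j => entry rows i j).map fun j => (i, j)

/-- The number with the given binary digits, cut off at `n`. -/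
def cappedValue (n : ℕ) (l : List Bool) : ℕ :=
  l.foldr (fun b acc => if decide ((if b then 1 else 0) + (acc + acc) ≤ n) then
    (if b then 1 else 0) + (acc + acc) else n) 0

/-- Budgets are unary, while the given bound is binary and may be exponentially large; hence it is
capped at the number of vertices. For a negative bound the state starts overdrawn by one. -/
def initSt (x : Input) : St :=
  (edgesOf x.1, indices x.1, if x.2.1 then cappedValue x.1.length x.2.2 + 1 else 0,
    cappedValue x.1.length x.2.2)

theorem cappedValue_le (n : ℕ) (l : List Bool) : cappedValue n l ≤ n := by
  cases l with
  | nil => exact Nat.zero_le _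
  | cons b l =>
    rw [cappedValue, List.foldr_cons]
    split_ifs <;> simp_all

-- Capping after every Horner step is harmless: min(n, b + 2a) does not change when a is replaced by
-- min(n, a).
theorem cappedValue_bits (n m : ℕ) : cappedValue n m.bits = min n m := by
  have key : ∀ l : List Bool,
      cappedValue n l = min n (Nat.ofDigits 2 (l.map fun b => cond b 1 0)) := by
    intro l
    induction l with
    | nil => simp [cappedValue]
    | cons b l ih =>
      have e : cappedValue n (b :: l) = if decide ((if b then 1 else 0) + (cappedValue n l +
        cappedValue n l) ≤ n) then (if b then 1 else 0) + (cappedValue n l + cappedValue n l)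
        else n := rfl
      rw [e, ih, List.map_cons, Nat.ofDigits_cons]
      cases b <;> simp <;> split_ifs <;> omega
  rw [key, ← Nat.digits_two_eq_bits, Nat.ofDigits_digits]

theorem indices_length (rows : List (List Bool)) : (indices rows).length = rows.length := by
  induction rows with
  | nil => rfl
  | cons r rows ih =>
    change ((indices rows).length :: indices rows).length = _
    simp [ih]

theorem mem_indices {rows : List (List Bool)} {i : ℕ} : i ∈ indices rows ↔ i < rows.length := by
  induction rows with
  | nil => simp [indices]
  | cons r rows ih =>
    change i ∈ (indices rows).length :: indices rows ↔ _
    rw [List.mem_cons, ih, indices_length, List.length_cons]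
    omega

theorem indices_nodup (rows : List (List Bool)) : (indices rows).Nodup := by
  induction rows with
  | nil => exact List.nodup_nil
  | cons r rows ih =>
    refine List.nodup_cons.2 ⟨fun h => ?_, ih⟩
    have := mem_indices.1 h
    change (indices rows).length < _ at this
    rw [indices_length] at this
    omega

/-! ### The initial state in polynomial time -/

section
variable {α : Type} [Enc α]

theorem fp_nth {β : Type} [Enc β] {l : α → List β} {i : α → ℕ} (hl : FP l) (hi : FP i) :
    FP fun x => nth (l x) (i x) := by
  obtain ⟨q, hq⟩ := hl.size
  refine FP.head? (FP.iterate (s := fun _ l => l.tail) hi hl FP.snd.tail q fun x m hm => ?_)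
  clear hm
  refine le_trans ?_ (hq x)
  generalize l x = l
  induction m with
  | zero => exact le_rfl
  | succ m ih =>
    rw [Function.iterate_succ_apply']
    refine le_trans ?_ ih
    cases (List.tail^[m] l) with
    | nil => exact le_rfl
    | cons b l => rw [List.tail_cons, esize_cons]; omega

theorem fp_entry {rows : α → List (List Bool)} {i j : α → ℕ} (hr : FP rows) (hi : FP i)
    (hj : FP j) : FP fun x => entry (rows x) (i x) (j x) := by
  have h1 : FP fun z : α × List Bool => (nth z.2 (j z.1)).elim false fun b => b :=
    FP.elim (f := fun (_ : α × List Bool) (b : Bool) => b)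
      (fp_nth FP.snd (hj.comp FP.fst)) (.const false) FP.snd
  exact FP.elim (f := fun (x : α) (row : List Bool) => (nth row (j x)).elim false fun b => b)
    (fp_nth hr hi) (.const false) h1

theorem fp_indices {rows : α → List (List Bool)} (hr : FP rows) :
    FP fun x => indices (rows x) := by
  refine FP.comp (g := indices) ?_ hr
  refine FP.foldr_bound (s := fun (_ : List (List Bool)) (_ : List Bool) (acc : List ℕ) =>
    acc.length :: acc) .id (.const []) ((FP.snd.comp FP.snd).length.cons (FP.snd.comp FP.snd))
    (.X * (2 * .X + 2) + 1) fun x l => ?_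
  change esize (indices l) ≤ _
  refine (esize_names (c := esize l) fun y hy => ?_).trans ?_
  · have := length_lt_esize l
    have := mem_indices.1 hy
    omega
  · have := length_lt_esize l
    simp only [Polynomial.eval_add, Polynomial.eval_mul, Polynomial.eval_X, Polynomial.eval_ofNat,
      Polynomial.eval_one]
    exact mul_add_le (by rw [indices_length]; omega) (by omega)

theorem fp_edgesOf {rows : α → List (List Bool)} (hr : FP rows) :
    FP fun x => edgesOf (rows x) := by
  have h1 : FP fun z : α × ℕ => (indices (rows z.1)).filter fun j => entry (rows z.1) z.2 j :=
    FP.filter (p := fun (z : α × ℕ) (j : ℕ) => entry (rows z.1) z.2 j)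
      ((fp_indices hr).comp FP.fst)
      (fp_entry (hr.comp (FP.fst.comp FP.fst)) (FP.snd.comp FP.fst) FP.snd)
  have h2 := FP.map (f := fun (z : α × ℕ) (j : ℕ) => (z.2, j)) h1
    ((FP.snd.comp FP.fst).pair FP.snd)
  exact FP.flatMap (f := fun x i => ((indices (rows x)).filter fun j => entry (rows x) i j).map
    fun j => (i, j)) (fp_indices hr) h2

theorem fp_cappedValue {n : α → ℕ} {l : α → List Bool} (hn : FP n) (hl : FP l) :
    FP fun x => cappedValue (n x) (l x) := by
  obtain ⟨q, hq⟩ := hn.size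
  have acc : FP fun z : α × Bool × ℕ => z.2.2 := FP.snd.comp FP.snd
  have val : FP fun z : α × Bool × ℕ => (if z.2.1 then 1 else 0) + (z.2.2 + z.2.2) :=
    ((FP.fst.comp FP.snd).ite (.const 1) (.const 0)).add (acc.add acc)
  refine FP.foldr (s := fun x b acc => if decide ((if b then 1 else 0) + (acc + acc) ≤ n x) then
    (if b then 1 else 0) + (acc + acc) else n x) hl (.const 0)
    ((val.le (hn.comp FP.fst)).ite val (hn.comp FP.fst)) q fun x l' _ => ?_
  change esize (cappedValue (n x) l') ≤ _
  have := cappedValue_le (n x) l'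
  have h := hq x
  rw [esize_nat] at h ⊢
  omega

theorem fp_initSt : FP initSt := by
  have h2 : FP fun x : Input => x.2 := FP.snd
  have hc : FP fun x : Input => cappedValue x.1.length x.2.2 :=
    fp_cappedValue FP.fst.length (FP.snd.comp h2)
  exact (fp_edgesOf FP.fst).pair ((fp_indices FP.fst).pair
    (((FP.fst.comp h2).ite (hc.add (.const 1)) (.const 0)).pair hc))

end

/-! ### The initial state of a graph -/

/-- The input for the instance `(G, k)`. -/
def inputOf {n : ℕ} (G : SimpleGraph (Fin n)) [DecidableRel G.Adj] (k : ℤ) : Input :=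
  ((List.finRange n).map fun u => (List.finRange n).map fun v => decide (G.Adj u v),
    decide (k < 0), k.natAbs.bits)

section
variable {n : ℕ} (G : SimpleGraph (Fin n)) [DecidableRel G.Adj] (k : ℤ)

theorem enc_inputOf : enc (inputOf G k) = Data.ofInstance G k := by
  have e : ∀ l : List Bool, enc l = Data.ofList (l.map Data.ofBool) := fun _ => rfl
  change Data.cons (Data.ofList (List.map enc (List.map _ _)))
    (.cons (Data.ofBool _) (Data.ofList (List.map Data.ofBool _))) = _
  rw [List.map_map]
  simp only [Data.ofInstance, Data.ofGraph, Data.ofInt]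
  congr 2
  refine List.map_congr_left fun u _ => ?_
  simp only [Function.comp_apply, e, List.map_map]
  rfl

theorem esize_bools (l : List Bool) : esize l ≤ l.length * 4 + 1 :=
  esize_list_le fun b _ => esize_bool b

theorem esize_inputOf : esize (inputOf G k) ≤
    (n + k.natAbs.size) * (4 * (n + k.natAbs.size) + 2) + 4 * (n + k.natAbs.size) + 7 := by
  have h1 : esize (inputOf G k).1 ≤ n * (n * 4 + 1 + 1) + 1 := by
    have : (inputOf G k).1.length = n := by simp [inputOf]
    conv_rhs => rw [← this]
    refine esize_list_le fun r hr => ?_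
    obtain ⟨u, -, rfl⟩ := List.mem_map.1 hr
    rw [this]
    exact (esize_bools _).trans (by simp)
  have h2 : esize (inputOf G k).2.2 ≤ k.natAbs.size * 4 + 1 := by
    rw [← Nat.size_eq_bits_len]
    exact esize_bools _
  have h3 := esize_bool (inputOf G k).2.1
  rw [esize_prod, esize_prod (inputOf G k).2]
  have h4 : n * (n * 4 + 1 + 1) ≤ (n + k.natAbs.size) * (4 * (n + k.natAbs.size) + 2) :=
    Nat.mul_le_mul (by omega) (by omega)
  omega

theorem length_inputOf : (inputOf G k).1.length = n := by simp [inputOf]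

theorem entry_inputOf {i j : ℕ} (hi : i < n) (hj : j < n) :
    entry (inputOf G k).1 i j = decide (G.Adj ⟨i, hi⟩ ⟨j, hj⟩) := by
  simp [entry, nth_eq, inputOf, hi, hj]

theorem mem_indices_inputOf {i : ℕ} : i ∈ indices (inputOf G k).1 ↔ i < n := by
  rw [mem_indices, length_inputOf]

theorem mem_edgesOf_inputOf {i j : ℕ} : (i, j) ∈ edgesOf (inputOf G k).1 ↔
    ∃ (hi : i < n) (hj : j < n), G.Adj ⟨i, hi⟩ ⟨j, hj⟩ := by
  simp only [edgesOf, List.mem_flatMap, List.mem_map, List.mem_filter, Prod.mk.injEq,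
    mem_indices_inputOf]
  constructor
  · rintro ⟨a, ha, b, ⟨hb, hab⟩, rfl, rfl⟩
    rw [entry_inputOf G k ha hb] at hab
    exact ⟨ha, hb, by simpa using hab⟩
  · rintro ⟨hi, hj, h⟩
    exact ⟨i, hi, j, ⟨hj, by rw [entry_inputOf G k hi hj]; simpa using h⟩, rfl, rfl⟩

theorem adj_initSt {i j : ℕ} : Adj (initSt (inputOf G k)).1 i j ↔
    ∃ (hi : i < n) (hj : j < n), G.Adj ⟨i, hi⟩ ⟨j, hj⟩ := by
  rw [adj_iff]
  change (_ ∈ edgesOf _ ∨ _ ∈ edgesOf _) ↔ _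
  rw [mem_edgesOf_inputOf, mem_edgesOf_inputOf]
  exact ⟨fun h => h.elim (fun h => h) fun ⟨hi, hj, h⟩ => ⟨hj, hi, h.symm⟩, .inl⟩

theorem adj_initSt_fin (u v : Fin n) : Adj (initSt (inputOf G k)).1 u v ↔ G.Adj u v := by
  rw [adj_initSt]
  exact ⟨fun ⟨_, _, h⟩ => h, fun h => ⟨u.2, v.2, h⟩⟩

theorem initSt_toFinset : (initSt (inputOf G k)).2.1.toFinset = Finset.range n := by
  ext i
  rw [List.mem_toFinset, Finset.mem_range]
  exact mem_indices_inputOf G k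

theorem wf_initSt : WF (initSt (inputOf G k)) := by
  refine ⟨indices_nodup _, fun a _ h => ?_⟩
  obtain ⟨_, _, h⟩ := (adj_initSt G k).1 h
  exact G.irrefl h

theorem length_initSt : (initSt (inputOf G k)).2.1.length = n :=
  (indices_length _).trans (length_inputOf G k)

theorem budget_initSt : ((initSt (inputOf G k)).2.2.2 : ℤ) - (initSt (inputOf G k)).2.2.1 =
    if k < 0 then -1 else min (n : ℤ) k := by
  have e : cappedValue (inputOf G k).1.length (inputOf G k).2.2 = min n k.natAbs := by
    rw [length_inputOf]; exact cappedValue_bits n k.natAbs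
  have e1 : (initSt (inputOf G k)).2.2.2 = min n k.natAbs := e
  have e2 : (initSt (inputOf G k)).2.2.1 = if decide (k < 0) then min n k.natAbs + 1 else 0 := by
    rw [← e]; rfl
  rw [e1, e2]
  by_cases hk : k < 0
  · rw [if_pos (decide_eq_true hk), if_pos hk]; omega
  · rw [if_neg (by simpa using hk), if_neg hk]; omega

theorem psi_initSt : psi (initSt (inputOf G k)) =
    3 * (if k < 0 then -1 else min (n : ℤ) k) - n := by
  rw [psi, budget_initSt, length_initSt]

/-- Capping the bound at n loses nothing because every set of vertices has at most n elements, and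
the budget −1 has no solution, like any negative bound. -/
theorem sol_initSt : sol (initSt (inputOf G k)) ↔ HasVertexCoverOfSizeAtMost G k := by
  unfold sol
  rw [budget_initSt, initSt_toFinset]
  constructor
  · rintro ⟨C, ⟨-, hC⟩, hk⟩
    refine ⟨Finset.univ.filter fun v : Fin n => v.1 ∈ C, ?_, ?_⟩
    · intro u v huv
      have := hC u (by simp) v (by simp) ((adj_initSt_fin G k u v).2 huv)
      simpa using this
    · have : (Finset.univ.filter fun v : Fin n => v.1 ∈ C).card ≤ C.card :=
        Finset.card_le_card_of_injOn (fun v => v.1) (fun v hv => by simpa using hv)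
          fun _ _ _ _ h => Fin.ext h
      split_ifs at hk <;> omega
  · rintro ⟨S, hS, hk⟩
    refine ⟨S.map Fin.valEmbedding, ⟨fun i hi => ?_, fun a _ b _ hab => ?_⟩, ?_⟩
    · obtain ⟨v, -, rfl⟩ := Finset.mem_map.1 hi
      simp
    · obtain ⟨ha, hb, h⟩ := (adj_initSt G k).1 hab
      simpa [ha, hb, Fin.exists_iff] using hS h
    · rw [Finset.card_map]
      have := S.card_le_univ
      rw [Fintype.card_fin] at this
      split_ifs <;> omega

/-- Double counting of the edges between I and N(I): at least 2 at each vertex of I, at most 4 at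
each vertex of N(I). -/
theorem card_le_two_mul_nb (hd : ∀ v : Fin n, 2 ≤ G.degree v ∧ G.degree v ≤ 4) {I : Finset ℕ}
    (hI : I ⊆ Finset.range n) :
    I.card ≤ 2 * (nb (Adj (initSt (inputOf G k)).1) (Finset.range n) I).card := by
  classical
  have h := Finset.card_mul_le_card_mul (s := I) (m := 2) (n := 4)
    (t := nb (Adj (initSt (inputOf G k)).1) (Finset.range n) I)
    (fun a b => Adj (initSt (inputOf G k)).1 a b) (fun a ha => ?_) fun b hb => ?_
  · omega
  · have han := Finset.mem_range.1 (hI ha)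
    refine (hd ⟨a, han⟩).1.trans ?_
    rw [← G.card_neighborFinset_eq_degree]
    refine Finset.card_le_card_of_injOn (fun v => v.1) (fun v hv => ?_) fun _ _ _ _ h => Fin.ext h
    have hv : Adj (initSt (inputOf G k)).1 a v :=
      (adj_initSt_fin G k ⟨a, han⟩ v).2 (by simpa using hv)
    exact Finset.mem_coe.2 (Finset.mem_filter.2 ⟨mem_nb.2 ⟨by simp, a, ha, hv⟩, hv⟩)
  · have hbn := Finset.mem_range.1 (mem_nb.1 hb).1
    refine le_trans ?_ (hd ⟨b, hbn⟩).2
    rw [← G.card_neighborFinset_eq_degree, ← Finset.card_map Fin.valEmbedding]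
    refine Finset.card_le_card fun a ha => ?_
    obtain ⟨h1, h2, h⟩ := (adj_initSt G k).1 (Finset.mem_filter.1 ha).2
    exact Finset.mem_map.2 ⟨⟨a, h1⟩, by simpa using h.symm, rfl⟩

/-- The summand 9 in the exponent of y contributes the constant 1.6253³ ≤ 5. -/
theorem leaves_initSt_le (hd : ∀ v : Fin n, 2 ≤ G.degree v ∧ G.degree v ≤ 4) (f : ℕ) :
    (leaves f (initSt (inputOf G k)) : ℝ) ≤ 5 * (1.6253 : ℝ) ^ max ((k : ℝ) - (n : ℝ) / 3) 0 := by
  have hy1 : (1 : ℝ) ≤ (1.6253 : ℝ) ^ (1 / 3 : ℝ) :=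
    Real.one_le_rpow (by norm_num) (by norm_num)
  have hy3 : ((1.6253 : ℝ) ^ (1 / 3 : ℝ)) ^ 3 = 1.6253 := by
    rw [← Real.rpow_natCast, ← Real.rpow_mul (by norm_num)]
    norm_num
  have h1 := leaves_le hy1 hy3 f _ (wf_initSt G k)
  have h2 := (norm_spec (wf_initSt G k)).root fun I hI _ => by
    rw [initSt_toFinset] at hI ⊢
    exact card_le_two_mul_nb G k hd hI
  rw [psi_initSt] at h2
  have h3 : psi (norm (initSt (inputOf G k))) ≤ 3 * k - n ∨
      -- Negative bounds fall under this case; otherwise the cap gives min(n, k) ≤ k.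
      psi (norm (initSt (inputOf G k))) ≤ 0 := by split_ifs at h2 <;> omega
  refine h1.trans ?_
  have h4 : (((9 + psi (norm (initSt (inputOf G k)))).toNat : ℕ) : ℝ) ≤
      9 + 3 * max ((k : ℝ) - (n : ℝ) / 3) 0 := by
    have h5 : (((9 + psi (norm (initSt (inputOf G k)))).toNat : ℤ) : ℝ) ≤
        ((9 + max (3 * k - n) 0 : ℤ) : ℝ) := by
      refine Int.cast_le.2 ?_
      rw [Int.toNat_eq_max]
      omega
    rw [Int.cast_natCast] at h5
    refine h5.trans (le_of_eq ?_)
    push_cast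
    rw [mul_max_of_nonneg _ _ (by norm_num : (0 : ℝ) ≤ 3)]
    congr 2 <;> ring
  rw [← Real.rpow_natCast, ← Real.rpow_mul (by norm_num)]
  calc (1.6253 : ℝ) ^ (1 / 3 * (((9 + psi (norm (initSt (inputOf G k)))).toNat : ℕ) : ℝ))
      ≤ (1.6253 : ℝ) ^ (3 + max ((k : ℝ) - (n : ℝ) / 3) 0) :=
        Real.rpow_le_rpow_of_exponent_le (by norm_num) (by linarith)
    _ = (1.6253 : ℝ) ^ (3 : ℝ) * (1.6253 : ℝ) ^ max ((k : ℝ) - (n : ℝ) / 3) 0 :=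
        Real.rpow_add (by norm_num) _ _
    _ ≤ _ := by
        gcongr
        have : (3 : ℝ) = ((3 : ℕ) : ℝ) := by norm_num
        rw [this, Real.rpow_natCast]
        norm_num

end

/-! ### The program -/

/-- The recursive function number `1`, calling the function number `2` for one step. -/
def searchBody : Term :=
  .letIn (.call 2 (.var 0)) (.ite (.head (.var 0))
    (.letIn (.call 1 (.head (.head (.head (.var 0)))))
      -- The second child is searched only if the first fails. Variable 0 is now the answer for the
      -- first child, so the result of the step is variable 1.
      (.ite (.var 0) (.var 0) (.call 1 (.tail (.head (.head (.var 1)))))))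
    (.tail (.var 0)))

def mainBody (o : ℕ) : Term := .call 1 (.call o (.var 0))

/-- Each node of the search tree costs at most B, and a binary tree with L leaves has 2L − 1 nodes;
the form t + B ≤ 2BL makes the induction additive. Leaving out the second child after a success only
saves time. -/
theorem eval_searchBody {P : Program} {q : Polynomial ℕ} (h1 : P[1]? = some searchBody)
    (h2 : Impl P 2 step q) {c l w k B : ℕ}
    (hB : ∀ s, Small c l w k s → q.eval (esize s) + 20 ≤ B) (f : ℕ) :
    ∀ s : St, WF s → s.2.1.length < f → Small c l w k s → ∃ (answer : Bool) (t : ℕ),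
      Eval P [enc s] searchBody (enc answer) t ∧ (answer = true ↔ sol s) ∧
      t + B ≤ 2 * B * leaves f s := by
  induction f with
  | zero => exact fun s _ h => absurd h (Nat.not_lt_zero _)
  | succ f ih =>
    intro s hs hf hm
    obtain ⟨t₀, e₀, ht₀⟩ := h2.call (env := [enc s]) (.arg (x := s))
    have hq := hB s hm
    have hn := norm_spec hs
    have hd : Eval P [enc (step s), enc s] (.var 0) (enc (step s)) 1 := .var rfl
    have he : enc (step s) = .cons (enc (step s).1) (enc (step s).2) := rfl
    have leaf : (step s).1 = none → ((step s).2 = true ↔ sol s) → ∃ (answer : Bool) (t : ℕ),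
        Eval P [enc s] searchBody (enc answer) t ∧ (answer = true ↔ sol s) ∧
        t + B ≤ 2 * B * leaves (f + 1) s := by
      intro h h'
      have hh := Eval.head hd
      have ht := Eval.tail hd
      rw [he, h] at hh ht
      refine ⟨(step s).2, _, .letIn e₀ (.iteFalse (by rw [he, h]; exact hh)
        (by rw [he, h]; exact ht)), h', ?_⟩
      rw [leaves_none h]
      omega
    rcases decideOrBranch_spec hn.wf hn.good with ⟨h, h'⟩ | ⟨h, h0, -⟩
    · exact leaf h (h'.trans hn.iff.symm)
    · obtain ⟨a, b, hb, sp, -⟩ := branch_spec hn.wf hn.good h0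
      have hab : (step s).1 = some (a, b) := h.trans hb
      obtain ⟨ma, mb⟩ := hm.step hab
      have hl := hn.length_le
      have la := sp.left_lt
      have lb := sp.right_lt
      obtain ⟨ra, ta, ea, ia, wa⟩ := ih a sp.wf_left (by omega) ma
      obtain ⟨rb, tb, eb, ib, wb⟩ := ih b sp.wf_right (by omega) mb
      have he' : enc (step s) = .cons (.cons (.cons (enc a) (enc b)) .nil) (enc (step s).2) := by
        rw [he, hab]; rfl
      rw [he'] at hd e₀
      have call_a := Eval.call (Eval.head (Eval.head (Eval.head hd))) h1 ea
      rw [leaves_some hab]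
      have hsol : sol s ↔ sol a ∨ sol b := hn.iff.trans sp.iff
      cases ra with
      | true =>
        refine ⟨true, _, .letIn e₀ (.iteTrue (Eval.head hd) (.letIn call_a
          (.iteTrue (.var rfl) (.var rfl)))), by rw [hsol, ← ia]; simp, ?_⟩
        have hpos : 2 * B * leaves f b = 2 * (B * leaves f b) := Nat.mul_assoc ..
        rw [Nat.mul_add]
        omega
      | false =>
        have hd' : Eval P [enc false, .cons (.cons (.cons (enc a) (enc b)) .nil)
            (enc (step s).2), enc s] (.var 1) _ 1 := .var rfl
        have call_b := Eval.call (Eval.tail (Eval.head (Eval.head hd'))) h1 eb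
        refine ⟨rb, _, .letIn e₀ (.iteTrue (Eval.head hd) (.letIn call_a
          (.iteFalse (.var rfl) call_b))), by rw [hsol, ← ia, ← ib]; simp, ?_⟩
        rw [Nat.mul_add]
        omega

end VC

open TreeLang in
theorem mainTheorem1 :
    ∃ (P : TreeLang.Program) (p : Polynomial ℕ),
      ∀ (n : ℕ) (G : SimpleGraph (Fin n)) [DecidableRel G.Adj] (k : ℤ),
        (∀ v : Fin n, 2 ≤ G.degree v ∧ G.degree v ≤ 4) →
        ∃ (answer : Bool) (t : ℕ),
          P.Run (TreeLang.Data.ofInstance G k) (TreeLang.Data.ofBool answer) t ∧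
          (answer = true ↔ HasVertexCoverOfSizeAtMost G k) ∧
          (t : ℝ) ≤ ((p.eval (n + k.natAbs.size) : ℕ) : ℝ) *
            (1.6253 : ℝ) ^ max ((k : ℝ) - (n : ℝ) / 3) 0 := by
  obtain ⟨ms, cs, ps, hs⟩ := VC.fp_step
  obtain ⟨mi, ci, pi, hi⟩ := VC.fp_initSt
  let P : Program := VC.mainBody (2 + ms) :: VC.searchBody :: (cs 2 ++ ci (2 + ms))
  have linked : Linked P 2 (cs 2 ++ ci (2 + ms)) := fun i _ => by
    rw [Nat.add_comm]; rfl
  have implS := (hs 2).2 P linked.left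
  have implI := (hi (2 + ms)).2 P ((hs 2).1 ▸ linked.right)
  let D : Polynomial ℕ := .X * (4 * .X + 2) + 4 * .X + 7
  let S : Polynomial ℕ := .X * (4 * .X + 4) + 1 + (2 * .X * (2 * .X + 2) + 1) +
    (2 * (2 * .X) + 1) + (2 * .X + 1) + 3
  let e : Polynomial ℕ := pi.comp D
  let B : Polynomial ℕ := ps.comp (S.comp e) + 20
  -- The factor 10 is 2 per leaf times the constant 5 in the bound for the leaves; e + 4 covers the
  -- construction of the initial state and the outer calls.
  refine ⟨P, e + 4 + 10 * B, fun n G _ k hd => ?_⟩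
  obtain ⟨N, hN⟩ : ∃ N, N = n + k.natAbs.size := ⟨_, rfl⟩
  obtain ⟨x, hx⟩ : ∃ x, x = VC.inputOf G k := ⟨_, rfl⟩
  have hxs : esize x ≤ D.eval N := by
    have := VC.esize_inputOf G k
    rw [← hx, ← hN] at this
    simpa [D] using this
  have hpi : pi.eval (esize x) ≤ e.eval N := by
    rw [Polynomial.eval_comp]; exact poly_mono pi hxs
  obtain ⟨-, -, -, -, -, hsz⟩ := implI x
  have hB : ∀ s, VC.Small (esize (VC.initSt x)) (esize (VC.initSt x)) (2 * esize (VC.initSt x))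
      (esize (VC.initSt x)) s → ps.eval (esize s) + 20 ≤ B.eval N := by
    intro s hm
    have h1 : esize s ≤ S.eval (esize (VC.initSt x)) := hm.size.trans (le_of_eq (by simp [S]))
    have h2 := poly_mono ps (h1.trans (poly_mono S (hsz.trans hpi)))
    simpa [B] using h2
  obtain ⟨answer, t, et, iff, ht⟩ := VC.eval_searchBody rfl implS hB (n + 1) (VC.initSt x)
    (hx ▸ VC.wf_initSt G k) (by rw [hx, VC.length_initSt]; omega) (VC.small_esize _)
  obtain ⟨ti, ei, hti⟩ := implI.call (.arg (x := x))
  refine ⟨answer, ti + t + 1, ⟨_, rfl, ?_⟩, ?_, ?_⟩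
  · rw [← VC.enc_inputOf, ← hx]
    exact .call ei rfl et
  · rw [iff, hx, VC.sol_initSt]
  · have hl := VC.leaves_initSt_le G k hd (n + 1)
    rw [← hx] at hl
    have ht' : ((ti + t + 1 : ℕ) : ℝ) ≤
        ((e.eval N + 3 + 2 * B.eval N * VC.leaves (n + 1) (VC.initSt x) : ℕ) : ℝ) :=
      Nat.cast_le.2 (by omega)
    have h1 : (1 : ℝ) ≤ (1.6253 : ℝ) ^ max ((k : ℝ) - (n : ℝ) / 3) 0 :=
      Real.one_le_rpow (by norm_num) (le_max_right _ _)
    refine ht'.trans ?_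
    rw [← hN]
    simp only [Polynomial.eval_add, Polynomial.eval_mul, Polynomial.eval_ofNat]
    push_cast
    generalize (1.6253 : ℝ) ^ max ((k : ℝ) - (n : ℝ) / 3) 0 = Y at hl h1
    have h2 : (0 : ℝ) ≤ (e.eval N : ℕ) := Nat.cast_nonneg _
    have h3 : (0 : ℝ) ≤ (B.eval N : ℕ) := Nat.cast_nonneg _
    have h4 := mul_le_mul_of_nonneg_left hl (mul_nonneg zero_le_two h3)
    have h5 := mul_le_mul_of_nonneg_left h1 (add_nonneg h2 (show (0 : ℝ) ≤ 4 by norm_num))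
    linarith
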